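/- \textbf{Setting.} Let $\mathcal E$ be a positive Heyting category (finite limits; regular; finite sums which are disjoint and stable; every pullback functor $f^*$ on subobjects has a right adjoint $\forall_f$). A \emph{cover} is a map that factors through no proper subobject of its codomain. A commuting square with top $D\to C$, left $f:D\to B$, right $g:C\to A$ and bottom $p:B\to A$ is a \emph{covering square} if $p$ and the induced map $D\to B\times_A C$ are covers; then $f$ \emph{covers} $g$. Let $\mathcal S$ be a class of small maps in $\mathcal E$: it is stable under pullback, under descent along covers, under binary sums and composition; it contains $0\to1$, $1\to1$, $1+1\to1$ and all diagonals; if $f$ is a cover and $gf\in\mathcal S$ then $g\in\mathcal S$; for a cover $p:Y\to X$ and $f:X\to A$ in $\mathcal S$ there are $Z\to Y$ and $g:Z\to B$ in $\mathcal S$ such that $g$ covers $f$ by a covering square with top $Z\to Y\to X$; and $\forall_f$ sends small monos to small monos for $f\in\mathcal S$. Assume that $(\mathcal E,\mathcal S)$ is a \emph{predicative category with small maps}: small maps are exponentiable and their W-types exist; $\mathcal E$ has a natural numbers object, and it is small; there is a small map $\pi:E\to U$ such that every small map is covered by a pullback of $\pi$; and every equivalence relation given by a small mono has a stable (effective) quotient.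 Assume also the fullness axiom \textbf{(F)}: for all small $\phi:B\to A$ and $A\to X$ there are a cover $X'\to X$, a small map $y:Y\to X'$ and a multi-valued section $P$ of $\phi$ over $Y$ (a subobject $P\subseteq Y\times_XB$ with $P\to Y\times_XA$ a small cover) such that for every $z:Z\to X'$ and every multi-valued section $Q$ of $\phi$ over $Z$ there are $k:U\to Y$ and a cover $l:U\to Z$ with $yk=zl$ and $k^*P\le l^*Q$. Let $\mathbb C$ be an internal category in $\mathcal E$ with small codomain map $\mathrm{cod}:\mathbb C_1\to\mathbb C_0$. A \emph{sieve} on $a\in\mathbb C_0$ is a small collection of arrows with codomain $a$ closed under precomposition. Let $\mathrm{Cov}$ be an internal Grothendieck topology on $\mathbb C$: to every $a$ it assigns a collection $\mathrm{Cov}(a)$ of sieves on $a$ that contains the maximal sieve, is stable ($S\in\mathrm{Cov}(a)$ and $f:b\to a$ imply $f^*S\in\mathrm{Cov}(b)$), and has local character (a sieve $S$ on $a$ belongs to $\mathrm{Cov}(a)$ if there is $R\in\mathrm{Cov}(a)$ with $f^*S\in\mathrm{Cov}(\mathrm{dom} f)$ for all $f\in R$). Assume that the site is \emph{presentable}: there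 is a function assigning to each $a\in\mathbb C_0$ a small collection $\mathrm{BCov}(a)$ of sieves on $a$ such that $S\in\mathrm{Cov}(a)$ iff $R\subseteq S$ for some $R\in\mathrm{BCov}(a)$. Here all statements about elements are read in the internal logic of $\mathcal E$. Let $\mathrm{PSh}$ be the category of internal presheaves on $\mathbb C$, and $i_*:\mathrm{Sh}\to\mathrm{PSh}$ the inclusion of the full subcategory of sheaves (presheaves in which every compatible family indexed by a covering sieve has a unique glueing). A map of presheaves or of sheaves is \emph{pointwise small} if its underlying map over $\mathbb C_0$ is small. For $\sigma_A:A\to\mathbb C_0$ let $\pi_!A$ be the presheaf of pairs $(x\in A,\ f:a\to\sigma_A(x))$ with $(x,f)\cdot g=(x,fg)$. Maps $r:B\to A$ and $s:B\to\mathbb C_1$ with $\mathrm{dom}\,s=\sigma_B$ and $\mathrm{cod}\,s=\sigma_Ar$ determine $(r,s)_!:\pi_!B\to\pi_!A$, $(b,f)\mapsto(r(b),s_bf)$. With $i^*$ left adjoint to $i_*$, a map of sheaves is \emph{locally small} if it is covered, in $\mathrm{Sh}$, by a map $i^*(r,s)_!$ with $r$ small in $\mathcal E$. \textbf{Theorem.}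 \begin{enumerate} \item The inclusion $i_*$ has a left adjoint $i^*$ (sheafification), and if $F$ is a pointwise small map of presheaves, then $i^*F$ is a pointwise small map of sheaves. \item If a map $F$ of sheaves covers a map $G$ of sheaves in $\mathrm{Sh}$ and $F$ is pointwise small, then $G$ is pointwise small. \item A map of sheaves is pointwise small if and only if it is locally small. \end{enumerate} -/

import Mathlib

open CategoryTheory CategoryTheory.Limits

universe v u

noncomputable section

namespace SmallMaps

/-! ### Covering squares and positive Heyting categories

The covers of a category with finite limits are the maps that factor through no proper subobject of
their codomain, i.e. Mathlib's `ExtremalEpi`. -/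

section Squares

variable {D : Type u} [Category.{v} D]

/-- The commuting square with the given four sides is a quasi-pullback: the comparison map into the
pullback of `right` and `bottom` is a cover. -/
def IsQuasiPullback {W X Y Z : D} (top : W ⟶ X) (left : W ⟶ Y) (right : X ⟶ Z)
    (bottom : Y ⟶ Z) : Prop :=
  ∃ (Q : D) (p₁ : Q ⟶ X) (p₂ : Q ⟶ Y) (c : W ⟶ Q),
    IsPullback p₁ p₂ right bottom ∧ c ≫ p₁ = top ∧ c ≫ p₂ = left ∧ ExtremalEpi c

/-- A covering square: a quasi-pullback whose bottom side is a cover. The left side is then said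
to cover the right side. -/
def IsCoveringSquare {W X Y Z : D} (top : W ⟶ X) (left : W ⟶ Y) (right : X ⟶ Z)
    (bottom : Y ⟶ Z) : Prop :=
  IsQuasiPullback top left right bottom ∧ ExtremalEpi bottom

/-- `f` covers `g`. -/
def Covers {W X Y Z : D} (f : W ⟶ Y) (g : X ⟶ Z) : Prop :=
  ∃ (top : W ⟶ X) (bottom : Y ⟶ Z), IsCoveringSquare top f g bottom

end Squares

/-- Positive Heyting categories: regular (in particular with finite limits), with finite sums that
are disjoint and stable, and with right adjoints `∀_f` to pulling back subobjects. -/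
class PositiveHeyting (E : Type u) [Category.{v} E] : Prop where
  regular : Regular E
  extensive : FinitaryExtensive E
  heyting : ∀ {X Y : E} (f : Y ⟶ X), (Subobject.pullback f).IsLeftAdjoint

attribute [instance] PositiveHeyting.regular PositiveHeyting.extensive PositiveHeyting.heyting

variable {E : Type u} [Category.{v} E] [PositiveHeyting E]

/-- Universal quantification of subobjects along `f`. -/
def forallAlong {X Y : E} (f : Y ⟶ X) : Subobject Y ⥤ Subobject X :=
  (Subobject.pullback f).rightAdjoint

/-! ### Classes of small maps -/

/-- The axioms for a class of small maps. -/
structure IsClassOfSmallMaps (S : MorphismProperty E) : Prop where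
  pullback_stable : ∀ {A B C D : E} {t : D ⟶ B} {g : D ⟶ C} {f : B ⟶ A} {p : C ⟶ A},
    IsPullback t g f p → S f → S g
  descent : ∀ {A B C D : E} {t : D ⟶ B} {g : D ⟶ C} {f : B ⟶ A} {p : C ⟶ A},
    IsPullback t g f p → ExtremalEpi p → S g → S f
  sums : ∀ {X Y X' Y' : E} {f : X ⟶ Y} {f' : X' ⟶ Y'}, S f → S f' → S (coprod.map f f')
  finite_zero : S (initial.to (⊤_ E))
  finite_one : S (𝟙 (⊤_ E))
  finite_two : S (terminal.from ((⊤_ E) ⨿ (⊤_ E)))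
  composition : ∀ {X Y Z : E} {f : X ⟶ Y} {g : Y ⟶ Z}, S f → S g → S (f ≫ g)
  quotients : ∀ {X Y Z : E} {f : Z ⟶ Y} {g : Y ⟶ X}, ExtremalEpi f → S (f ≫ g) → S g
  collection : ∀ {A X Y : E} (p : Y ⟶ X) (f : X ⟶ A), ExtremalEpi p → S f →
    ∃ (Z B : E) (z : Z ⟶ Y) (g : Z ⟶ B) (h : B ⟶ A),
      S g ∧ IsCoveringSquare (z ≫ p) g f h
  forall_small : ∀ {X Y : E} (f : Y ⟶ X), S f → ∀ A : Subobject Y, S A.arrow →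
    S ((forallAlong f).obj A).arrow
  diagonals : ∀ X : E, S (diag X)

/-- The polynomial functor `X ↦ ∑ (a : A), X ^ B_a` of an exponentiable map `f : B ⟶ A`. -/
def polynomialFunctor {A B : E} (f : B ⟶ A) [(Over.pullback f).IsLeftAdjoint] : E ⥤ E :=
  Over.star B ⋙ (Over.pullback f).rightAdjoint ⋙ Over.forget A

/-- `(N, z, s)` is a natural numbers object. -/
def IsNaturalNumbersObject (N : E) (z : ⊤_ E ⟶ N) (s : N ⟶ N) : Prop :=
  ∀ (X : E) (x : ⊤_ E ⟶ X) (t : X ⟶ X), ∃! h : N ⟶ X, z ≫ h = x ∧ s ≫ h = h ≫ t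

/-- The pair of maps `r₀, r₁ : R ⟶ X` is an equivalence relation on `X` (in generalized
elements). -/
structure IsEquivalenceRelation {R X : E} (r₀ r₁ : R ⟶ X) : Prop where
  mono : Mono (prod.lift r₀ r₁)
  refl : ∀ {T : E} (x : T ⟶ X), ∃ t : T ⟶ R, t ≫ r₀ = x ∧ t ≫ r₁ = x
  symm : ∀ {T : E} (t : T ⟶ R), ∃ t' : T ⟶ R, t' ≫ r₀ = t ≫ r₁ ∧ t' ≫ r₁ = t ≫ r₀
  trans : ∀ {T : E} (t t' : T ⟶ R), t ≫ r₁ = t' ≫ r₀ →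
    ∃ t'' : T ⟶ R, t'' ≫ r₀ = t ≫ r₀ ∧ t'' ≫ r₁ = t' ≫ r₁

/-- Predicative categories with small maps. In `bounded_exactness`, the category being regular,
a stable (effective) quotient of `R` is the same as a cover whose kernel pair is `R`. -/
structure IsPredicative (S : MorphismProperty E) : Prop extends IsClassOfSmallMaps S where
  exponentiable : ∀ {X Y : E} (f : Y ⟶ X), S f → (Over.pullback f).IsLeftAdjoint
  wtypes : ∀ {A B : E} (f : B ⟶ A) [(Over.pullback f).IsLeftAdjoint], S f →
    HasInitial (Endofunctor.Algebra (polynomialFunctor f))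
  naturals : ∃ (N : E) (z : ⊤_ E ⟶ N) (s : N ⟶ N),
    IsNaturalNumbersObject N z s ∧ S (terminal.from N)
  representability : ∃ (T U : E) (π : T ⟶ U), S π ∧
    ∀ {X Y : E} (f : Y ⟶ X), S f →
      ∃ (A B : E) (g : B ⟶ A) (b : B ⟶ Y) (a : A ⟶ X) (t : B ⟶ T) (w : A ⟶ U),
        IsCoveringSquare b g f a ∧ IsPullback t g π w
  bounded_exactness : ∀ {R X : E} (r₀ r₁ : R ⟶ X), IsEquivalenceRelation r₀ r₁ →
    S (prod.lift r₀ r₁) →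
    ∃ (Q : E) (q : X ⟶ Q), ExtremalEpi q ∧ IsPullback r₀ r₁ q q

/-! ### Families of subobjects, and fullness

An `X`-indexed family of subobjects of `B` is a subobject of `X ⨯ B`. -/

/-- Reindexing along `f : Y ⟶ X` of an `X`-indexed family of subobjects of `B`. -/
def reindex {X Y : E} (f : Y ⟶ X) {B : E} (R : Subobject (X ⨯ B)) : Subobject (Y ⨯ B) :=
  (Subobject.pullback (prod.map f (𝟙 B))).obj R

/-- For `φ : B ⟶ A` over `X` (via `i : A ⟶ X`) and `y : Y ⟶ X`: the subobject `P` of `Y ⨯ B` is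
a multi-valued section of `φ` over `Y`, that is, `P` is contained in `Y ×_X B` and the composite
`P ⟶ Y ×_X B ⟶ Y ×_X A` is a small cover. -/
def IsMvs (S : MorphismProperty E) {X A B Y : E} (φ : B ⟶ A) (i : A ⟶ X) (y : Y ⟶ X)
    (P : Subobject (Y ⨯ B)) : Prop :=
  ∃ h : (P.arrow ≫ prod.fst) ≫ y = (P.arrow ≫ prod.snd ≫ φ) ≫ i,
    S (pullback.lift (P.arrow ≫ prod.fst) (P.arrow ≫ prod.snd ≫ φ) h) ∧
    ExtremalEpi (pullback.lift (P.arrow ≫ prod.fst) (P.arrow ≫ prod.snd ≫ φ) h)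

/-- The fullness axiom (F). -/
def Fullness (S : MorphismProperty E) : Prop :=
  ∀ {X A B : E} (φ : B ⟶ A) (i : A ⟶ X), S φ → S i →
    ∃ (X' Y : E) (q : X' ⟶ X) (y : Y ⟶ X') (P : Subobject (Y ⨯ B)),
      ExtremalEpi q ∧ S y ∧ IsMvs S φ i (y ≫ q) P ∧
      ∀ {Z : E} (z : Z ⟶ X') (Q : Subobject (Z ⨯ B)), IsMvs S φ i (z ≫ q) Q →
        ∃ (U : E) (k : U ⟶ Y) (l : U ⟶ Z),
          ExtremalEpi l ∧ k ≫ y = l ≫ z ∧ reindex k P ≤ reindex l Q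

/-! ### Internal categories -/

variable (E) in
/-- An internal category. Composable pairs are pairs `(f, g)` with `dom f = cod g`, and
`comp (f, g) = f ∘ g`; the equations are stated for generalized elements. -/
structure InternalCategory where
  C₀ : E
  C₁ : E
  dom : C₁ ⟶ C₀
  cod : C₁ ⟶ C₀
  ident : C₀ ⟶ C₁
  comp : pullback dom cod ⟶ C₁
  ident_dom : ident ≫ dom = 𝟙 C₀
  ident_cod : ident ≫ cod = 𝟙 C₀
  comp_dom : comp ≫ dom = pullback.snd dom cod ≫ dom
  comp_cod : comp ≫ cod = pullback.fst dom cod ≫ cod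
  comp_ident : ∀ {X : E} (f : X ⟶ C₁),
    pullback.lift f (f ≫ dom ≫ ident) (by simp [ident_cod]) ≫ comp = f
  ident_comp : ∀ {X : E} (f : X ⟶ C₁),
    pullback.lift (f ≫ cod ≫ ident) f (by simp [ident_dom]) ≫ comp = f
  assoc : ∀ {X : E} (f g h : X ⟶ C₁) (hfg : f ≫ dom = g ≫ cod) (hgh : g ≫ dom = h ≫ cod),
    pullback.lift (pullback.lift f g hfg ≫ comp) h (by rw [Category.assoc, comp_dom, pullback.lift_snd_assoc, hgh]) ≫ comp =
      pullback.lift f (pullback.lift g h hgh ≫ comp) (by rw [Category.assoc, comp_cod, pullback.lift_fst_assoc, hfg]) ≫ comp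

namespace InternalCategory

variable (C : InternalCategory E)

/-- The composite `f ∘ g` of generalized arrows. -/
def mul {X : E} (f g : X ⟶ C.C₁) (h : f ≫ C.dom = g ≫ C.cod) : X ⟶ C.C₁ :=
  pullback.lift f g h ≫ C.comp

lemma mul_dom {X : E} (f g : X ⟶ C.C₁) (h : f ≫ C.dom = g ≫ C.cod) :
    C.mul f g h ≫ C.dom = g ≫ C.dom := by
  rw [mul, Category.assoc, C.comp_dom, pullback.lift_snd_assoc]

lemma mul_cod {X : E} (f g : X ⟶ C.C₁) (h : f ≫ C.dom = g ≫ C.cod) :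
    C.mul f g h ≫ C.cod = f ≫ C.cod := by
  rw [mul, Category.assoc, C.comp_cod, pullback.lift_fst_assoc]

lemma mul_assoc {X : E} (f g k : X ⟶ C.C₁) (h : f ≫ C.dom = g ≫ C.cod)
    (h' : g ≫ C.dom = k ≫ C.cod) :
    C.mul (C.mul f g h) k (by rw [mul_dom, h']) = C.mul f (C.mul g k h') (by rw [mul_cod, h]) :=
  C.assoc f g k h h'

lemma mul_ident {X : E} (f : X ⟶ C.C₁) (a : X ⟶ C.C₀) (h : f ≫ C.dom = a) :
    C.mul f (a ≫ C.ident) (by simp [h, C.ident_cod]) = f := by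
  subst h
  simpa [mul] using C.comp_ident f

lemma precomp_mul {X Y : E} (t : Y ⟶ X) (f g : X ⟶ C.C₁) (h : f ≫ C.dom = g ≫ C.cod) :
    t ≫ C.mul f g h = C.mul (t ≫ f) (t ≫ g) (by simp [h]) := by
  unfold mul
  rw [← Category.assoc]
  congr 1
  apply pullback.hom_ext <;>
    simp only [Category.assoc, pullback.lift_fst, pullback.lift_snd]

end InternalCategory

/-! ### Sieves and sites

An `X`-indexed family of sieves is an `X`-indexed family of subobjects of `C₁`. -/

/-- For `t : Y ⟶ X` and a generalized element `f : Y ⟶ B`: the element `f` belongs to the member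
with index `t` of the family `R`. -/
def Mem {X B : E} (R : Subobject (X ⨯ B)) {Y : E} (t : Y ⟶ X) (f : Y ⟶ B) : Prop :=
  R.Factors (prod.lift t f)

section Sieves

variable (S : MorphismProperty E) (C : InternalCategory E)

/-- `R` is an `X`-indexed family of (small) sieves, the sieve with index `x` being on `a x`. -/
structure IsSieve {X : E} (a : X ⟶ C.C₀) (R : Subobject (X ⨯ C.C₁)) : Prop where
  small : S (R.arrow ≫ prod.fst)
  cod_eq : ∀ {Y : E} (t : Y ⟶ X) (f : Y ⟶ C.C₁), Mem R t f → f ≫ C.cod = t ≫ a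
  closed : ∀ {Y : E} (t : Y ⟶ X) (f g : Y ⟶ C.C₁) (h : f ≫ C.dom = g ≫ C.cod),
    Mem R t f → Mem R t (C.mul f g h)

/-- The family of maximal sieves `{f | cod f = a x}`. -/
def maximalSieve {X : E} (a : X ⟶ C.C₀) : Subobject (X ⨯ C.C₁) :=
  equalizerSubobject (prod.snd ≫ C.cod) (prod.fst ≫ a)

/-- The map `(x, g) ↦ (x, f x ∘ g)` defined on the pairs with `cod g = dom (f x)`. -/
def postcompose {X : E} (f : X ⟶ C.C₁) :
    equalizer (prod.snd ≫ C.cod : X ⨯ C.C₁ ⟶ C.C₀) (prod.fst ≫ f ≫ C.dom) ⟶ X ⨯ C.C₁ :=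
  prod.lift (equalizer.ι _ _ ≫ prod.fst)
    (C.mul (equalizer.ι _ _ ≫ prod.fst ≫ f) (equalizer.ι _ _ ≫ prod.snd)
      (by simpa using (equalizer.condition (prod.snd ≫ C.cod : X ⨯ C.C₁ ⟶ C.C₀)
        (prod.fst ≫ f ≫ C.dom)).symm))

/-- The family of sieves `f^* R = {g | cod g = dom (f x) and f x ∘ g ∈ R x}`. -/
def restrictSieve {X : E} (f : X ⟶ C.C₁) (R : Subobject (X ⨯ C.C₁)) : Subobject (X ⨯ C.C₁) :=
  (Subobject.map (equalizer.ι (prod.snd ≫ C.cod : X ⨯ C.C₁ ⟶ C.C₀) (prod.fst ≫ f ≫ C.dom))).obj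
    ((Subobject.pullback (postcompose C f)).obj R)

/-- An (internal) Grothendieck topology, in Kripke-Joyal form. `Cov a R` says that the family of
sieves `R` consists of sieves covering `a`. By `comprehension`, each family of sieves has a largest
part that consists of covering sieves, compatibly with reindexing: this says that `Cov` is a
subobject of the object of all pairs (object, sieve on it). -/
structure Topology where
  Cov : ∀ {X : E} (_ : X ⟶ C.C₀) (_ : Subobject (X ⨯ C.C₁)), Prop
  isSieve : ∀ {X : E} (a : X ⟶ C.C₀) (R : Subobject (X ⨯ C.C₁)), Cov a R → IsSieve S C a R
  comprehension : ∀ {X : E} (a : X ⟶ C.C₀) (R : Subobject (X ⨯ C.C₁)), IsSieve S C a R →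
    ∃ U : Subobject X, ∀ {Y : E} (t : Y ⟶ X), U.Factors t ↔ Cov (t ≫ a) (reindex t R)
  maximality : ∀ {X : E} (a : X ⟶ C.C₀), Cov a (maximalSieve C a)
  stability : ∀ {X : E} (a : X ⟶ C.C₀) (f : X ⟶ C.C₁) (R : Subobject (X ⨯ C.C₁)),
    f ≫ C.cod = a → Cov a R → Cov (f ≫ C.dom) (restrictSieve C f R)
  local_character : ∀ {X : E} (a : X ⟶ C.C₀) (R T : Subobject (X ⨯ C.C₁)),
    IsSieve S C a T → Cov a R →
    (∀ {Y : E} (t : Y ⟶ X) (f : Y ⟶ C.C₁), Mem R t f →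
      Cov (f ≫ C.dom) (restrictSieve C f (reindex t T))) →
    Cov a T

variable {S C}

/-- A presentation of the topology `J`: a small map `β : B ⟶ C₀` together with a `B`-indexed
family of sieves on `β`, without repetitions, i.e. a `C₀`-indexed family of small subobjects of the
object of sieves. A sieve on `a` is covering precisely when it contains a basic covering sieve on
`a`, where existence is meant internally (on a cover of the domain of variation). -/
structure Presentation (J : Topology S C) where
  B : E
  β : B ⟶ C.C₀
  small : S β
  BCov : Subobject (B ⨯ C.C₁)
  isSieve : IsSieve S C β BCov
  inj : ∀ {X : E} (b b' : X ⟶ B), b ≫ β = b' ≫ β → reindex b BCov = reindex b' BCov → b = b'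
  cov_iff : ∀ {X : E} (a : X ⟶ C.C₀) (R : Subobject (X ⨯ C.C₁)), IsSieve S C a R →
    (J.Cov a R ↔ ∃ (X' : E) (p : X' ⟶ X) (b : X' ⟶ B),
      ExtremalEpi p ∧ b ≫ β = p ≫ a ∧ reindex b BCov ≤ reindex p R)

/-- A site is presentable if its topology has a presentation. -/
def Topology.IsPresentable (J : Topology S C) : Prop := Nonempty (Presentation J)

end Sieves

/-! ### Internal presheaves -/

variable (C : InternalCategory E)

/-- An internal presheaf: an object over `C₀` with an action `x · f`, defined for
`proj x = cod f`. -/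
structure Presheaf where
  obj : E
  proj : obj ⟶ C.C₀
  act : pullback proj C.cod ⟶ obj
  act_proj : act ≫ proj = pullback.snd proj C.cod ≫ C.dom
  act_ident : ∀ {X : E} (x : X ⟶ obj),
    pullback.lift x (x ≫ proj ≫ C.ident) (by simp [C.ident_cod]) ≫ act = x
  act_comp : ∀ {X : E} (x : X ⟶ obj) (f g : X ⟶ C.C₁) (hx : x ≫ proj = f ≫ C.cod)
    (h : f ≫ C.dom = g ≫ C.cod),
    pullback.lift (pullback.lift x f hx ≫ act) g (by rw [Category.assoc, act_proj, pullback.lift_snd_assoc, h]) ≫ act =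
      pullback.lift x (C.mul f g h) (by rw [C.mul_cod, hx]) ≫ act

namespace Presheaf

variable {C}

/-- The restriction `x · f` of a generalized element. -/
def restr (P : Presheaf C) {X : E} (x : X ⟶ P.obj) (f : X ⟶ C.C₁)
    (h : x ≫ P.proj = f ≫ C.cod) : X ⟶ P.obj :=
  pullback.lift x f h ≫ P.act

/-- Morphisms of presheaves: maps over `C₀` that commute with restriction. -/
@[ext]
structure Hom (P Q : Presheaf C) where
  hom : P.obj ⟶ Q.obj
  hom_proj : hom ≫ Q.proj = P.proj
  hom_restr : ∀ {X : E} (x : X ⟶ P.obj) (f : X ⟶ C.C₁) (h : x ≫ P.proj = f ≫ C.cod),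
    P.restr x f h ≫ hom = Q.restr (x ≫ hom) f (by rw [Category.assoc, hom_proj, h])

instance : Category (Presheaf C) where
  Hom := Hom
  id P := { hom := 𝟙 P.obj, hom_proj := by simp, hom_restr := by intros; simp }
  comp F G :=
    { hom := F.hom ≫ G.hom
      hom_proj := by rw [Category.assoc, G.hom_proj, F.hom_proj]
      hom_restr := by
        intro X x f h
        rw [← Category.assoc, F.hom_restr, G.hom_restr]
        simp }
  id_comp F := Hom.ext (Category.id_comp F.hom)
  comp_id F := Hom.ext (Category.comp_id F.hom)
  assoc F G K := Hom.ext (Category.assoc F.hom G.hom K.hom)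

/-- The forgetful functor `π^*`. -/
def forget : Presheaf C ⥤ Over C.C₀ where
  obj P := Over.mk P.proj
  map F := Over.homMk (Hom.hom F) (Hom.hom_proj F)
  map_id _ := rfl
  map_comp _ _ := rfl

/-- Pointwise small maps of presheaves: `π^* F` is small in the slice over `C₀`, which means that
the underlying map is small. -/
def PointwiseSmall (S : MorphismProperty E) {P Q : Presheaf C} (F : P ⟶ Q) : Prop :=
  S (forget.map F).left

/-- The presheaf `π_! A`, whose elements are the pairs `(x, f)` with `x` in `A` and `f` an arrow
into `A.hom x`, with `(x, f) · g = (x, f ∘ g)`. -/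
def shriek (A : Over C.C₀) : Presheaf C where
  obj := pullback A.hom C.cod
  proj := pullback.snd A.hom C.cod ≫ C.dom
  act := pullback.lift (pullback.fst _ _ ≫ pullback.fst A.hom C.cod)
    (C.mul (pullback.fst _ _ ≫ pullback.snd A.hom C.cod) (pullback.snd _ _)
      (by rw [Category.assoc, pullback.condition]))
    (by rw [C.mul_cod, Category.assoc, Category.assoc, pullback.condition])
  act_proj := by
    rw [pullback.lift_snd_assoc, C.mul_dom]
  act_ident := by
    intro X x
    apply pullback.hom_ext
    · simp only [Category.assoc, pullback.lift_fst, pullback.lift_fst_assoc]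
    · rw [Category.assoc, pullback.lift_snd, C.precomp_mul]
      simp only [pullback.lift_fst_assoc, pullback.lift_snd]
      have := C.mul_ident (x ≫ pullback.snd A.hom C.cod)
        (x ≫ pullback.snd A.hom C.cod ≫ C.dom) (by simp)
      simpa using this
  act_comp := by
    intro X x f g hx h
    apply pullback.hom_ext
    · simp only [Category.assoc, pullback.lift_fst, pullback.lift_fst_assoc]
    · simp only [Category.assoc, pullback.lift_snd, C.precomp_mul, pullback.lift_fst_assoc]
      exact C.mul_assoc _ _ _ _ _

lemma shriek_restr (A : Over C.C₀) {X : E} (x : X ⟶ pullback A.hom C.cod) (f : X ⟶ C.C₁)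
    (h : x ≫ pullback.snd A.hom C.cod ≫ C.dom = f ≫ C.cod) :
    (shriek A).restr x f h = pullback.lift (x ≫ pullback.fst A.hom C.cod)
      (C.mul (x ≫ pullback.snd A.hom C.cod) f (by rw [Category.assoc, h]))
      (by rw [C.mul_cod, Category.assoc, Category.assoc, pullback.condition]) := by
  unfold restr shriek
  apply pullback.hom_ext
  · simp only [Category.assoc, pullback.lift_fst, pullback.lift_fst_assoc]
  · simp only [Category.assoc, pullback.lift_snd, C.precomp_mul, pullback.lift_fst_assoc]

/-- The map `(b, f) ↦ (r b, s b ∘ f)`. -/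
def shriekHom {A B : Over C.C₀} (r : B.left ⟶ A.left) (s : B.left ⟶ C.C₁)
    (hdom : s ≫ C.dom = B.hom) (hcod : s ≫ C.cod = r ≫ A.hom) :
    pullback B.hom C.cod ⟶ pullback A.hom C.cod :=
  pullback.lift (pullback.fst B.hom C.cod ≫ r)
    (C.mul (pullback.fst B.hom C.cod ≫ s) (pullback.snd B.hom C.cod)
      ((Category.assoc _ _ _).trans ((congrArg (_ ≫ ·) hdom).trans pullback.condition)))
    (by rw [C.mul_cod, Category.assoc, Category.assoc, hcod])

/-- The morphism `(r, s)_! : π_! B ⟶ π_! A` determined by `r : B ⟶ A` and a family `s` of arrows,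
`s b` being an arrow from `B.hom b` to `A.hom (r b)`. -/
def shriekMap {A B : Over C.C₀} (r : B.left ⟶ A.left) (s : B.left ⟶ C.C₁)
    (hdom : s ≫ C.dom = B.hom) (hcod : s ≫ C.cod = r ≫ A.hom) : shriek B ⟶ shriek A where
  hom := shriekHom r s hdom hcod
  hom_proj := by
    simp only [shriek, shriekHom]
    rw [pullback.lift_snd_assoc, C.mul_dom]
  hom_restr := fun {X} x f h => by
    change X ⟶ pullback B.hom C.cod at x
    change x ≫ pullback.snd B.hom C.cod ≫ C.dom = f ≫ C.cod at h
    have h' : (x ≫ shriekHom r s hdom hcod) ≫ pullback.snd A.hom C.cod ≫ C.dom =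
        f ≫ C.cod := by
      rw [← h, shriekHom, Category.assoc, pullback.lift_snd_assoc, C.mul_dom]
    refine (congrArg (· ≫ shriekHom r s hdom hcod) (shriek_restr B x f h)).trans
      (Eq.trans ?_ (shriek_restr A (x ≫ shriekHom r s hdom hcod) f h').symm)
    apply pullback.hom_ext
    · simp only [shriekHom, Category.assoc, pullback.lift_fst, pullback.lift_fst_assoc]
    · simp only [shriekHom, Category.assoc, pullback.lift_snd, C.precomp_mul,
        pullback.lift_fst_assoc]
      exact (C.mul_assoc _ _ _ _ _).symm

end Presheaf

/-! ### Internal sheaves -/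

section Sheaves

variable {C} {S : MorphismProperty E}

/-- `x` is a compatible family of elements of `P` on the family of sieves `R`: to an arrow `f` in
the sieve it assigns an element `x f` over `dom f`, such that `x (f ∘ g) = x f · g`. -/
structure IsCompatible (P : Presheaf C) {X : E} (R : Subobject (X ⨯ C.C₁))
    (x : (R : E) ⟶ P.obj) : Prop where
  over_dom : x ≫ P.proj = R.arrow ≫ prod.snd ≫ C.dom
  compat : ∀ {Y : E} (r r' : Y ⟶ (R : E)) (g : Y ⟶ C.C₁)
    (h : (r ≫ R.arrow ≫ prod.snd) ≫ C.dom = g ≫ C.cod),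
    r' ≫ R.arrow ≫ prod.fst = r ≫ R.arrow ≫ prod.fst →
    r' ≫ R.arrow ≫ prod.snd = C.mul (r ≫ R.arrow ≫ prod.snd) g h →
    r' ≫ x = P.restr (r ≫ x) g (by simpa [over_dom] using h)

/-- `y : X ⟶ P` is a glueing of `x`: it lies over `a`, and `y · f = x f` for all `f` in the
sieve. -/
def IsGlueing (P : Presheaf C) {X : E} (a : X ⟶ C.C₀) (R : Subobject (X ⨯ C.C₁))
    (x : (R : E) ⟶ P.obj) (y : X ⟶ P.obj) : Prop :=
  y ≫ P.proj = a ∧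
    ∃ h : ((R.arrow ≫ prod.fst) ≫ y) ≫ P.proj = (R.arrow ≫ prod.snd) ≫ C.cod,
      P.restr ((R.arrow ≫ prod.fst) ≫ y) (R.arrow ≫ prod.snd) h = x

/-- A presheaf is a sheaf if every compatible family on a covering sieve has a unique glueing. -/
def IsSheaf (J : Topology S C) : ObjectProperty (Presheaf C) := fun P =>
  ∀ {X : E} (a : X ⟶ C.C₀) (R : Subobject (X ⨯ C.C₁)), J.Cov a R →
    ∀ x : (R : E) ⟶ P.obj, IsCompatible P R x → ∃! y : X ⟶ P.obj, IsGlueing P a R x y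

/-- The category of internal sheaves, a full subcategory of the internal presheaves. -/
abbrev InternalSheaf (J : Topology S C) := (IsSheaf J).FullSubcategory

/-- The inclusion `i_*` of sheaves in presheaves. -/
abbrev inclusion (J : Topology S C) : InternalSheaf J ⥤ Presheaf C := (IsSheaf J).ι

variable {J : Topology S C}

/-- Pointwise small maps of sheaves: `ρ^* F` is small in the slice over `C₀`. -/
def PointwiseSmall {A B : InternalSheaf J} (F : B ⟶ A) : Prop :=
  Presheaf.PointwiseSmall S ((inclusion J).map F)

/-- Locally small maps of sheaves, `L` being the sheafification functor `i^*`: those covered, in the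
category of sheaves, by a map `i^* (r, s)_!` with `r` small. -/
def LocallySmall (L : Presheaf C ⥤ InternalSheaf J) {A B : InternalSheaf J} (F : B ⟶ A) : Prop :=
  ∃ (X Y : Over C.C₀) (r : X.left ⟶ Y.left) (s : X.left ⟶ C.C₁)
    (hdom : s ≫ C.dom = X.hom) (hcod : s ≫ C.cod = r ≫ Y.hom),
    S r ∧ Covers (L.map (Presheaf.shriekMap r s hdom hcod)) F

end Sheaves

end SmallMaps

end

/-!
Everything is reduced to ordinary sheaf theory on the category of stages: a stage is a generalized
object `X ⟶ C₀` of the internal category, and a map of stages is a change of base together with a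
generalized arrow. An internal presheaf `P` has a functor `P.ext` of elements over stages, from which
maps of presheaves can be recovered (`Presheaf.homOfExt`), and the internal topology induces a
Grothendieck topology `stageTopology`, in which a sieve is covering if over a cover of the base it
contains, locally, a covering internal sieve. Transitivity of this topology is where the collection
axiom for small maps enters. An internal presheaf is an internal sheaf exactly if its functor of
elements is a sheaf (`isSheaf_iff`).

*Sheafification.* The sheafification of `P.ext` exists on general grounds, and it has to be shown
that it is again the functor of elements of an internal presheaf. A functor with descent along covers
of the base is of this form as soon as its elements are, locally, the reindexings of a single
element whose equality relation is small (`exists_presheaf_of_chart`); the representing object is the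
quotient by this relation, which exists by exactness for small equivalence relations. Equality is
small because by presentability to be a covering sieve is a small property (`isSmallPred_cov`), and
two elements of a sheaf are equal if they agree on a covering sieve (`isSmallPred_sameAt_app`). The
elements of the sheafification are parametrized by matching families, in the image of `P`, on basic
covering sieves, and these form an object because small maps are exponentiable
(`exists_matching_families`). The outcome is a locally bijective map from `P` to a sheaf
(`exists_sheaf`), and such a map has the universal property (`existsUnique_extension`).

*Smallness of fibres.* The heart of the matter is `pullback_small_of_local_description`. If the
elements of a fibre of a map of sheaves are described, on sieves from a small collection, by elements
of small objects, then each of them is a glueing of a multi-valued section of a small map. Fullness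
provides a small collection of multi-valued sections such that each one is refined by a member of
it. Those members that can be glued form a small part, because equality in a presheaf is small
(`exists_glueing_locus`), and mapping each to its glueing is a cover of the fibre, which is therefore
small. The cover of the parameter object that comes with fullness is removed by collection and by
descent. It follows that a map of sheaves is small if it is covered, locally, by a small map of
presheaves (`small_of_pairSieve`). One application of this is to the naturality square of the locally
bijective unit: sheafification preserves small maps. Another is to covering squares of sheaves, in
which covers are the locally surjective maps (`locallySurjective_of_extremalEpi`,
`extremalEpi_of_locallySurjective`): pointwise small maps are closed under covered maps.

*Locally small maps.* The presheaf map `(r, s)_!` is small for small `r`, so the two closure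
properties show that locally small maps are pointwise small. Conversely, a pointwise small map
`F : B ⟶ A` is covered by the sheafification of `(r, s)_!`, where the domain of `r` and `s` consists
of the triples `(x, f, y)` with `F y = x · f`, and `r` and `s` are the projections to `x` and `f`.
-/

open CategoryTheory CategoryTheory.Limits
universe w

namespace SmallMaps

attribute [local simp] prod.lift_fst prod.lift_snd prod.lift_fst_assoc prod.lift_snd_assoc
  pullback.lift_fst pullback.lift_snd pullback.lift_fst_assoc pullback.lift_snd_assoc

open Opposite InternalCategory

noncomputable section

/-! ### Covers in a regular category -/

section Covers

variable {E : Type u} [Category.{v} E] [Regular E]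

lemma cover_comp {X Y Z : E} {f : X ⟶ Y} {g : Y ⟶ Z} (hf : ExtremalEpi f) (hg : ExtremalEpi g) :
    ExtremalEpi (f ≫ g) := by
  rw [extremalEpi_iff_strongEpi_of_hasPullbacks] at *
  exact strongEpi_comp f g

lemma cover_of_comp {X Y Z : E} {f : X ⟶ Y} {g : Y ⟶ Z} (h : ExtremalEpi (f ≫ g)) :
    ExtremalEpi g := by
  rw [extremalEpi_iff_strongEpi_of_hasPullbacks] at *
  exact strongEpi_of_strongEpi f g

lemma cover_of_lift {X Y Z : E} {g : Y ⟶ Z} {p : X ⟶ Z} (hp : ExtremalEpi p) (l : X ⟶ Y)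
    (h : l ≫ g = p) : ExtremalEpi g :=
  cover_of_comp (f := l) (h ▸ hp)

lemma cover_of_isPullback {A B C D : E} {t : D ⟶ B} {g : D ⟶ C} {f : B ⟶ A} {p : C ⟶ A}
    (h : IsPullback t g f p) (hf : ExtremalEpi f) : ExtremalEpi g := by
  have : IsRegularEpi f := inferInstance
  have : MorphismProperty.regularEpi E g :=
    Regular.regularEpiIsStableUnderBaseChange.of_isPullback h this
  have : IsRegularEpi g := this
  infer_instance

/-- A generalized element that factors through a mono after passing to a cover factors through
it. -/
lemma factors_of_cover {T' T X M : E} {p : T' ⟶ T} (hp : ExtremalEpi p) (m : M ⟶ X) [Mono m]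
    {t : T ⟶ X} {u : T' ⟶ M} (h : u ≫ m = p ≫ t) : ∃ u' : T ⟶ M, u' ≫ m = t := by
  rw [extremalEpi_iff_strongEpi_of_hasPullbacks] at hp
  have sq : CommSq u p m t := ⟨h⟩
  exact ⟨sq.lift, sq.fac_right⟩

lemma subobject_factors_of_cover {T' T X : E} {p : T' ⟶ T} (hp : ExtremalEpi p)
    {U : Subobject X} {t : T ⟶ X} (h : U.Factors (p ≫ t)) : U.Factors t := by
  obtain ⟨u', hu'⟩ := factors_of_cover hp U.arrow (Subobject.factorThru_arrow U _ h)
  rw [← hu']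
  exact Subobject.factors_comp_arrow _

/-- Descent of a generalized element along a cover. -/
lemma cover_desc {X Q V : E} {q : X ⟶ Q} (hq : ExtremalEpi q) (m : X ⟶ V)
    (h : ∀ {T : E} (t t' : T ⟶ X), t ≫ q = t' ≫ q → t ≫ m = t' ≫ m) :
    ∃ n : Q ⟶ V, q ≫ n = m := by
  have : IsRegularEpi q := inferInstance
  let s := IsRegularEpi.getStruct q
  exact ⟨Cofork.IsColimit.desc s.isColimit m (h _ _ s.w), Cofork.IsColimit.π_desc' s.isColimit _ _⟩

/-- Every map is a cover followed by a mono. -/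
lemma exists_image {X Y : E} (f : X ⟶ Y) :
    ∃ (I : E) (e : X ⟶ I) (m : I ⟶ Y), ExtremalEpi e ∧ Mono m ∧ e ≫ m = f :=
  ⟨_, (Regular.strongEpiMonoFactorisation f).e, (Regular.strongEpiMonoFactorisation f).m,
    inferInstance, inferInstance, by simp⟩

omit [Regular E] in
lemma IsCoveringSquare.w {W X Y Z : E} {top : W ⟶ X} {left : W ⟶ Y} {right : X ⟶ Z}
    {bottom : Y ⟶ Z} (h : IsCoveringSquare top left right bottom) :
    top ≫ right = left ≫ bottom := by
  obtain ⟨⟨Q, p₁, p₂, c, hQ, rfl, rfl, _⟩, _⟩ := h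
  simp [hQ.w]

/-- Local lifting along a covering square: a generalized element of the pullback lifts locally. -/
lemma IsCoveringSquare.exists_lift {W X Y Z : E} {top : W ⟶ X} {left : W ⟶ Y} {right : X ⟶ Z}
    {bottom : Y ⟶ Z} (h : IsCoveringSquare top left right bottom) {T : E} (x : T ⟶ X)
    (y : T ⟶ Y) (hxy : x ≫ right = y ≫ bottom) :
    ∃ (T' : E) (p : T' ⟶ T) (w : T' ⟶ W), ExtremalEpi p ∧ w ≫ top = p ≫ x ∧ w ≫ left = p ≫ y := by
  obtain ⟨⟨Q, p₁, p₂, c, hQ, rfl, rfl, hc⟩, _⟩ := h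
  refine ⟨pullback c (hQ.lift x y hxy), pullback.snd _ _, pullback.fst _ _,
    cover_of_isPullback (IsPullback.of_hasPullback _ _) hc, ?_, ?_⟩
  · rw [← Category.assoc, pullback.condition]; simp
  · rw [← Category.assoc, pullback.condition]; simp

lemma exists_lift_of_cover {X Y T : E} {p : Y ⟶ X} (hp : ExtremalEpi p) (t : T ⟶ X) :
    ∃ (T' : E) (q : T' ⟶ T) (y : T' ⟶ Y), ExtremalEpi q ∧ y ≫ p = q ≫ t :=
  ⟨pullback p t, pullback.snd _ _, pullback.fst _ _,
    cover_of_isPullback (IsPullback.of_hasPullback _ _) hp, pullback.condition⟩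

end Covers

/-! ### Small maps and small predicates on generalized elements -/

section Small

variable {E : Type u} [Category.{v} E] [PositiveHeyting E]

/-- The class of all maps. -/
lemma isClassOfSmallMaps_top : IsClassOfSmallMaps (⊤ : MorphismProperty E) where
  pullback_stable _ _ := trivial
  descent _ _ _ := trivial
  sums _ _ := trivial
  finite_zero := trivial
  finite_one := trivial
  finite_two := trivial
  composition _ _ := trivial
  quotients _ _ := trivial
  collection := fun {A X Y} p f hp _ =>
    ⟨Y, A, 𝟙 Y, p ≫ f, 𝟙 A, trivial, ⟨X, 𝟙 X, f, p, IsPullback.of_horiz_isIso ⟨by simp⟩,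
      by simp, rfl, hp⟩, inferInstance⟩
  forall_small _ _ _ _ := trivial
  diagonals _ := trivial

variable {S : MorphismProperty E} (hS : IsClassOfSmallMaps S)

include hS

namespace IsClassOfSmallMaps

lemma id_small (X : E) : S (𝟙 X) :=
  hS.pullback_stable (t := terminal.from X) (p := terminal.from X)
    (IsPullback.of_vert_isIso ⟨by simp⟩) hS.finite_one

lemma iso_small {X Y : E} (f : X ⟶ Y) [IsIso f] : S f :=
  hS.pullback_stable (t := f) (p := 𝟙 Y) (f := 𝟙 Y)
    (IsPullback.of_horiz_isIso ⟨by simp⟩) (hS.id_small Y)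

lemma snd_small {A B C : E} (f : B ⟶ A) (p : C ⟶ A) (hf : S f) : S (pullback.snd f p) :=
  hS.pullback_stable (IsPullback.of_hasPullback f p) hf

lemma fst_small {A B C : E} (f : B ⟶ A) (p : C ⟶ A) (hp : S p) : S (pullback.fst f p) :=
  hS.pullback_stable (IsPullback.of_hasPullback f p).flip hp

/-- Left cancellation: small maps have small diagonals. -/
lemma of_comp {X Y Z : E} {f : X ⟶ Y} {g : Y ⟶ Z} (h : S (f ≫ g)) : S f := by
  have h₁ : IsPullback f (pullback.lift (𝟙 X) f (by simp)) (diag Y)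
      (prod.lift (pullback.fst (f ≫ g) g ≫ f) (pullback.snd (f ≫ g) g)) := by
    refine ⟨⟨by ext <;> simp⟩, ⟨PullbackCone.IsLimit.mk _ (fun s => s.snd ≫ pullback.fst _ _)
      (fun s => ?_) (fun s => ?_) (fun s m h₁ h₂ => ?_)⟩⟩
    · have := s.condition =≫ prod.fst
      simp only [Category.assoc, diag, prod.lift_fst, Category.comp_id] at this
      simp [this]
    · have h1 := s.condition =≫ prod.fst
      have h2 := s.condition =≫ prod.snd
      simp only [Category.assoc, diag, prod.lift_fst, prod.lift_snd, Category.comp_id] at h1 h2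
      apply pullback.hom_ext
      · simp
      · simp [← h2, h1]
    · rw [← h₂]; simp
  have h₂ := hS.pullback_stable h₁ (hS.diagonals Y)
  simpa using hS.composition h₂ (hS.snd_small _ g h)

lemma equalizer_small {X Y : E} (f g : X ⟶ Y) : S (equalizer.ι f g) := by
  refine hS.pullback_stable (t := equalizer.ι f g ≫ f) (p := prod.lift f g) (f := diag Y) ?_
    (hS.diagonals Y)
  refine ⟨⟨by ext <;> simp [equalizer.condition f g]⟩,
    ⟨PullbackCone.IsLimit.mk _ (fun s => equalizer.lift s.snd ?_)
    (fun s => ?_) (fun s => by simp) (fun s m h₁ h₂ => ?_)⟩⟩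
  · have h1 := s.condition =≫ prod.fst
    have h2 := s.condition =≫ prod.snd
    simp only [Category.assoc, diag, prod.lift_fst, prod.lift_snd, Category.comp_id] at h1 h2
    rw [← h1, ← h2]
  · have h1 := s.condition =≫ prod.fst
    simp only [Category.assoc, diag, prod.lift_fst, Category.comp_id] at h1
    simp [h1]
  · rw [← cancel_mono (equalizer.ι f g), h₂]; simp

end IsClassOfSmallMaps

omit hS in
variable (S) in
/-- The predicate `φ` on generalized elements of `X` is represented by a small mono. -/
def IsSmallPred {X : E} (φ : ∀ ⦃T : E⦄, (T ⟶ X) → Prop) : Prop :=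
  ∃ (M : E) (m : M ⟶ X), Mono m ∧ S m ∧ ∀ ⦃T : E⦄ (t : T ⟶ X), (∃ u, u ≫ m = t) ↔ φ t

namespace IsSmallPred

omit hS [PositiveHeyting E] in
lemma congr {X : E} {φ ψ : ∀ ⦃T : E⦄, (T ⟶ X) → Prop} (h : IsSmallPred S φ)
    (hφ : ∀ ⦃T : E⦄ (t : T ⟶ X), φ t ↔ ψ t) : IsSmallPred S ψ := by
  obtain ⟨M, m, h₁, h₂, h₃⟩ := h
  exact ⟨M, m, h₁, h₂, fun T t => (h₃ t).trans (hφ t)⟩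

lemma eq {X Y : E} (f g : X ⟶ Y) : IsSmallPred S (fun _ t => t ≫ f = t ≫ g) := by
  refine ⟨equalizer f g, equalizer.ι f g, inferInstance, hS.equalizer_small f g,
    fun T t => ⟨?_, fun h => ⟨equalizer.lift t h, by simp⟩⟩⟩
  rintro ⟨u, rfl⟩
  simp [equalizer.condition f g]

/-- Reindexing of a small predicate. -/
lemma reindex {X Y : E} {φ : ∀ ⦃T : E⦄, (T ⟶ X) → Prop} (h : IsSmallPred S φ) (g : Y ⟶ X) :
    IsSmallPred S (fun _ t => φ (t ≫ g)) := by
  obtain ⟨M, m, h₁, h₂, h₃⟩ := h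
  refine ⟨pullback m g, pullback.snd m g, inferInstance, hS.snd_small _ _ h₂, fun T t =>
    ⟨?_, fun h => ?_⟩⟩
  · rintro ⟨u, rfl⟩
    refine (h₃ _).1 ⟨u ≫ pullback.fst _ _, by simp [pullback.condition]⟩
  · obtain ⟨u, hu⟩ := (h₃ _).2 h
    exact ⟨pullback.lift u t hu, by simp⟩

/-- A small predicate on a small subobject. -/
lemma sigma {X M : E} (m : M ⟶ X) [Mono m] (hm : S m) {φ : ∀ ⦃T : E⦄, (T ⟶ M) → Prop}
    (h : IsSmallPred S φ) : IsSmallPred S (fun _ t => ∃ u, u ≫ m = t ∧ φ u) := by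
  obtain ⟨N, n, h₁, h₂, h₃⟩ := h
  refine ⟨N, n ≫ m, inferInstance, hS.composition h₂ hm, fun T t => ⟨?_, ?_⟩⟩
  · rintro ⟨u, rfl⟩
    exact ⟨u ≫ n, by simp, (h₃ _).1 ⟨u, rfl⟩⟩
  · rintro ⟨u, rfl, hu⟩
    obtain ⟨w, rfl⟩ := (h₃ _).2 hu
    exact ⟨w, by simp⟩

/-- Existential quantification along a small map; existence is local. -/
lemma exist {X Y : E} (f : Y ⟶ X) (hf : S f) {φ : ∀ ⦃T : E⦄, (T ⟶ Y) → Prop}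
    (h : IsSmallPred S φ) : IsSmallPred S (fun T t =>
      ∃ (T' : E) (p : T' ⟶ T) (u : T' ⟶ Y), ExtremalEpi p ∧ u ≫ f = p ≫ t ∧ φ u) := by
  obtain ⟨M, m, h₁, h₂, h₃⟩ := h
  obtain ⟨I, e, n, he, hn, hen⟩ := exists_image (m ≫ f)
  refine ⟨I, n, hn, hS.quotients he (hen ▸ hS.composition h₂ hf), fun T t => ⟨?_, ?_⟩⟩
  · rintro ⟨u, rfl⟩
    obtain ⟨T', p, w, hp, hw⟩ := exists_lift_of_cover he u
    exact ⟨T', p, w ≫ m, hp, by rw [Category.assoc, ← hen, ← Category.assoc, hw]; simp,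
      (h₃ _).1 ⟨w, rfl⟩⟩
  · rintro ⟨T', p, u, hp, hu, hφ⟩
    obtain ⟨w, rfl⟩ := (h₃ _).2 hφ
    exact factors_of_cover hp n (u := w ≫ e) (by rw [← hu]; simp [hen])

/-- Universal quantification along a small map. -/
lemma all {X Y : E} (f : Y ⟶ X) (hf : S f) {φ : ∀ ⦃T : E⦄, (T ⟶ Y) → Prop}
    (h : IsSmallPred S φ) : IsSmallPred S (fun T t =>
      ∀ (T' : E) (s : T' ⟶ T) (u : T' ⟶ Y), u ≫ f = s ≫ t → φ u) := by
  obtain ⟨M, m, h₁, h₂, h₃⟩ := h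
  have hA : S (Subobject.mk m).arrow := by
    have := hS.composition (hS.iso_small (Subobject.underlyingIso m).hom) h₂
    simpa using this
  let adj : Subobject.pullback f ⊣ forallAlong f := Adjunction.ofIsLeftAdjoint _
  have hle : (Subobject.pullback f).obj ((forallAlong f).obj (Subobject.mk m)) ≤ Subobject.mk m :=
    (adj.counit.app (Subobject.mk m)).le
  refine ⟨_, ((forallAlong f).obj (Subobject.mk m)).arrow, inferInstance,
    hS.forall_small f hf _ hA, fun T t => ⟨?_, fun H => ?_⟩⟩
  · rintro ⟨w, rfl⟩ T' s u hu
    rw [← h₃]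
    have h₄ := (Subobject.isPullback f ((forallAlong f).obj (Subobject.mk m)))
    let l := h₄.lift (s ≫ w) u (by simp [hu])
    refine ⟨l ≫ Subobject.ofLE _ _ hle ≫ (Subobject.underlyingIso m).hom, ?_⟩
    simp [l]
  · obtain ⟨I, e, n, he, hn, rfl⟩ := exists_image t
    have h₅ : (Subobject.pullback f).obj (Subobject.mk n) ≤ Subobject.mk m := by
      rw [Subobject.pullback_obj_mk (IsPullback.of_hasPullback f n).flip]
      suffices h : ∃ u, u ≫ m = pullback.fst f n from
        Subobject.mk_le_mk_of_comm h.choose h.choose_spec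
      obtain ⟨T', p, w, hp, hw⟩ := exists_lift_of_cover he (pullback.snd f n)
      obtain ⟨u, hu⟩ := (h₃ (p ≫ pullback.fst f n)).2 (H T' w _ (by
        rw [Category.assoc, pullback.condition, ← Category.assoc, ← hw]; simp))
      exact factors_of_cover hp m hu
    have h₆ := (adj.homEquiv _ _ (homOfLE h₅)).le
    exact ⟨e ≫ (Subobject.underlyingIso n).inv ≫ Subobject.ofLE _ _ h₆, by simp⟩

end IsSmallPred

end Small

section

variable {E : Type u} [Category.{v} E] [PositiveHeyting E]

/-! ### Stages: generalized objects and arrows of the internal category -/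

namespace InternalCategory

variable (C : InternalCategory E)

lemma ident_mul {X : E} (f : X ⟶ C.C₁) (a : X ⟶ C.C₀) (h : f ≫ C.cod = a) :
    C.mul (a ≫ C.ident) f (by simp [h, C.ident_dom]) = f := by
  subst h
  simpa [mul] using C.ident_comp f

/-- A stage is a generalized object of the internal category `C`. -/
structure Stage where
  base : E
  pt : base ⟶ C.C₀

variable {C}

/-- A map of stages is a change of base together with a generalized arrow of `C`. -/
@[ext]
structure Stage.Hom (Y X : Stage C) where
  map : Y.base ⟶ X.base
  arr : Y.base ⟶ C.C₁
  arr_dom : arr ≫ C.dom = Y.pt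
  arr_cod : arr ≫ C.cod = map ≫ X.pt

attribute [simp] Stage.Hom.arr_dom Stage.Hom.arr_cod

instance : Category (Stage C) where
  Hom := Stage.Hom
  id X := ⟨𝟙 _, X.pt ≫ C.ident, by simp [C.ident_dom], by simp [C.ident_cod]⟩
  comp φ ψ := ⟨φ.map ≫ ψ.map, C.mul (φ.map ≫ ψ.arr) φ.arr (by simp), by simp [mul_dom],
    by simp [mul_cod]⟩
  id_comp φ := by
    ext
    · simp
    · simp only [Category.id_comp]
      exact C.mul_ident _ _ (by simp)
  comp_id φ := by
    ext
    · simp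
    · have := C.ident_mul φ.arr _ φ.arr_cod
      simpa using this
  assoc φ ψ χ := by
    ext
    · simp
    · have := C.mul_assoc ((φ.map ≫ ψ.map) ≫ χ.arr) (φ.map ≫ ψ.arr) φ.arr (by simp) (by simp)
      refine this.symm.trans ?_
      simp [precomp_mul]

namespace Stage

@[simp] lemma id_map (X : Stage C) : Hom.map (𝟙 X) = 𝟙 X.base := rfl
@[simp] lemma id_arr (X : Stage C) : Hom.arr (𝟙 X) = X.pt ≫ C.ident := rfl
@[simp] lemma comp_map {X Y Z : Stage C} (φ : X ⟶ Y) (ψ : Y ⟶ Z) :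
    Hom.map (φ ≫ ψ) = Hom.map φ ≫ Hom.map ψ := rfl
lemma comp_arr {X Y Z : Stage C} (φ : X ⟶ Y) (ψ : Y ⟶ Z) :
    Hom.arr (φ ≫ ψ) = C.mul (Hom.map φ ≫ Hom.arr ψ) (Hom.arr φ)
      ((Category.assoc _ _ _).trans ((congrArg _ ψ.arr_dom).trans φ.arr_cod.symm)) := rfl

@[ext]
lemma hom_ext {X Y : Stage C} {φ ψ : X ⟶ Y} (h₁ : Hom.map φ = Hom.map ψ)
    (h₂ : Hom.arr φ = Hom.arr ψ) : φ = ψ :=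
  Hom.ext h₁ h₂

/-- The map of stages given by a generalized arrow and a change of base. -/
def mkHom {Y X : Stage C} (t : Y.base ⟶ X.base) (f : Y.base ⟶ C.C₁) (h : f ≫ C.dom = Y.pt)
    (h' : f ≫ C.cod = t ≫ X.pt) : Y ⟶ X := ⟨t, f, h, h'⟩

@[simp] lemma mkHom_map {Y X : Stage C} (t : Y.base ⟶ X.base) (f : Y.base ⟶ C.C₁) (h h') :
    Hom.map (mkHom (X := X) t f h h') = t := rfl
@[simp] lemma mkHom_arr {Y X : Stage C} (t : Y.base ⟶ X.base) (f : Y.base ⟶ C.C₁) (h h') :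
    Hom.arr (mkHom (X := X) t f h h') = f := rfl

/-- A pure change of base, the arrow being an identity. -/
def rebase {Y X : Stage C} (t : Y.base ⟶ X.base) (h : t ≫ X.pt = Y.pt) : Y ⟶ X :=
  mkHom t (Y.pt ≫ C.ident) (by simp [C.ident_dom]) (by simp [C.ident_cod, h])

@[simp] lemma rebase_map {Y X : Stage C} (t : Y.base ⟶ X.base) (h : t ≫ X.pt = Y.pt) :
    Hom.map (rebase t h) = t := rfl
@[simp] lemma rebase_arr {Y X : Stage C} (t : Y.base ⟶ X.base) (h : t ≫ X.pt = Y.pt) :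
    Hom.arr (rebase t h) = Y.pt ≫ C.ident := rfl

@[simp] lemma rebase_comp_arr {Z Y X : Stage C} (t : Z.base ⟶ Y.base) (h : t ≫ Y.pt = Z.pt)
    (φ : Y ⟶ X) : Hom.arr (rebase t h ≫ φ) = t ≫ Hom.arr φ := by
  rw [comp_arr]
  exact C.mul_ident _ _ (by simp [h])

@[simp] lemma comp_rebase_arr {Z Y X : Stage C} (t : Y.base ⟶ X.base) (h : t ≫ X.pt = Y.pt)
    (φ : Z ⟶ Y) : Hom.arr (φ ≫ rebase t h) = Hom.arr φ := by
  have := C.ident_mul φ.arr _ φ.arr_cod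
  rw [comp_arr]
  simpa using this

lemma map_congr {G : (Stage C)ᵒᵖ ⥤ Type w} {X Y : Stage C} {φ ψ : Y ⟶ X}
    (h₁ : Hom.map φ = Hom.map ψ) (h₂ : Hom.arr φ = Hom.arr ψ) (g : G.obj (op X)) :
    G.map φ.op g = G.map ψ.op g := by
  rw [hom_ext h₁ h₂]

end Stage

end InternalCategory

open InternalCategory

variable {C : InternalCategory E}

/-! ### Internal presheaves as presheaves on the category of stages -/

namespace Presheaf

variable (P Q : Presheaf C)

lemma restr_proj {X : E} (x : X ⟶ P.obj) (f : X ⟶ C.C₁) (h : x ≫ P.proj = f ≫ C.cod) :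
    P.restr x f h ≫ P.proj = f ≫ C.dom := by
  simp [restr, P.act_proj]

lemma precomp_restr {X Y : E} (t : Y ⟶ X) (x : X ⟶ P.obj) (f : X ⟶ C.C₁)
    (h : x ≫ P.proj = f ≫ C.cod) :
    t ≫ P.restr x f h = P.restr (t ≫ x) (t ≫ f) (by simp [h]) := by
  unfold restr
  rw [← Category.assoc]
  congr 1
  apply pullback.hom_ext <;> simp

lemma restr_congr {X : E} {x x' : X ⟶ P.obj} {f f' : X ⟶ C.C₁} (hx : x = x') (hf : f = f')
    (h : x ≫ P.proj = f ≫ C.cod) (h' : x' ≫ P.proj = f' ≫ C.cod) :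
    P.restr x f h = P.restr x' f' h' := by
  subst hx hf; rfl

lemma restr_ident {X : E} (x : X ⟶ P.obj) (a : X ⟶ C.C₀) (h : x ≫ P.proj = a) :
    P.restr x (a ≫ C.ident) (by simp [h, C.ident_cod]) = x := by
  subst h
  simpa [restr] using P.act_ident x

lemma restr_mul {X : E} (x : X ⟶ P.obj) (f g : X ⟶ C.C₁) (hx : x ≫ P.proj = f ≫ C.cod)
    (h : f ≫ C.dom = g ≫ C.cod) :
    P.restr x (C.mul f g h) (by rw [mul_cod, hx]) =
      P.restr (P.restr x f hx) g (by rw [restr_proj, h]) :=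
  (P.act_comp x f g hx h).symm

variable {P Q} in
@[simp] lemma comp_hom {R : Presheaf C} (F : P ⟶ Q) (G : Q ⟶ R) :
    Hom.hom (F ≫ G) = Hom.hom F ≫ Hom.hom G := rfl
@[simp] lemma id_hom : Hom.hom (𝟙 P) = 𝟙 P.obj := rfl

variable {P Q} in
@[ext] lemma hom_ext {F G : P ⟶ Q} (h : Hom.hom F = Hom.hom G) : F = G := Hom.ext h

/-- The externalization of an internal presheaf: its value at a stage consists of the generalized
elements over the generalized object. -/
def ext : (Stage C)ᵒᵖ ⥤ Type v where
  obj X := { x : X.unop.base ⟶ P.obj // x ≫ P.proj = X.unop.pt }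
  map φ := ↾fun x => ⟨P.restr (φ.unop.map ≫ x.1) φ.unop.arr (by simp [x.2]), by simp [restr_proj]⟩
  map_id X := by
    ext x
    simp [P.restr_ident x.1 _ x.2]
  map_comp φ ψ := by
    ext x
    have hx := x.2
    have h := P.restr_mul (ψ.unop.map ≫ φ.unop.map ≫ x.1) (ψ.unop.map ≫ φ.unop.arr) ψ.unop.arr
      (by simp [hx]) (by simp)
    exact (P.restr_congr (Category.assoc _ _ _) (Stage.comp_arr _ _) _ _).trans (h.trans
      (P.restr_congr (P.precomp_restr _ _ _ _).symm rfl _ _))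

/-- The element of the externalization given by a generalized element. -/
def el {X : Stage C} (x : X.base ⟶ P.obj) (h : x ≫ P.proj = X.pt) : P.ext.obj (op X) := ⟨x, h⟩

variable {P Q}

/-- The generalized element underlying an element of the externalization. -/
def val {X : Stage C} (x : P.ext.obj (op X)) : X.base ⟶ P.obj := x.1

@[simp] lemma val_proj {X : Stage C} (x : P.ext.obj (op X)) : val x ≫ P.proj = X.pt := x.2

@[simp] lemma val_el {X : Stage C} (x : X.base ⟶ P.obj) (h : x ≫ P.proj = X.pt) :
    val (P.el x h) = x := rfl

lemma val_injective {X : Stage C} {x y : P.ext.obj (op X)} (h : val x = val y) : x = y :=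
  Subtype.ext h

lemma val_map {X Y : Stage C} (φ : Y ⟶ X) (x : P.ext.obj (op X)) :
    val (P.ext.map φ.op x) = P.restr (Stage.Hom.map φ ≫ val x) (Stage.Hom.arr φ)
      (by rw [Category.assoc, val_proj]; exact φ.arr_cod.symm) := rfl

@[simp] lemma val_map_rebase {X Y : Stage C} (t : Y.base ⟶ X.base) (h : t ≫ X.pt = Y.pt)
    (x : P.ext.obj (op X)) : val (P.ext.map (Stage.rebase t h).op x) = t ≫ val x := by
  have hx : (t ≫ val x) ≫ P.proj = Y.pt := by rw [Category.assoc, val_proj]; exact h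
  exact P.restr_ident (t ≫ val x) Y.pt hx

/-- The map of externalizations induced by a map of presheaves. -/
def extMap (F : P ⟶ Q) : P.ext ⟶ Q.ext where
  app X := ↾fun x => Q.el (val (X := X.unop) x ≫ Hom.hom F)
    (by rw [Category.assoc, Hom.hom_proj]; exact x.2)
  naturality X Y φ := by
    ext x
    apply Subtype.ext
    exact (Hom.hom_restr F _ _ _).trans (Q.restr_congr (Category.assoc _ _ _) rfl _ _)

lemma extMap_map (F : P ⟶ Q) {X Y : Stage C} (φ : Y ⟶ X) (x : P.ext.obj (op X)) :
    (extMap F).app _ (P.ext.map φ.op x) = Q.ext.map φ.op ((extMap F).app _ x) :=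
  NatTrans.naturality_apply (extMap F) φ.op x

variable (P) in
/-- The stage of the generic element of a presheaf. -/
abbrev stage : Stage C := ⟨P.obj, P.proj⟩

variable (P) in
/-- The generic element of a presheaf. -/
def gen : P.ext.obj (op P.stage) := P.el (𝟙 _) (by simp)

lemma map_gen {X : Stage C} (x : P.ext.obj (op X)) :
    P.ext.map (Stage.rebase (X := P.stage) (val x) (val_proj x)).op P.gen = x := by
  apply val_injective
  rw [val_map_rebase]
  exact Category.comp_id _

variable (P) in
/-- A natural family of maps from the elements of `P` to a presheaf `G` on the category of
stages (whose universe is arbitrary). -/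
structure ExtHom (G : (Stage C)ᵒᵖ ⥤ Type w) where
  app : ∀ {X : Stage C}, P.ext.obj (op X) → G.obj (op X)
  map_app : ∀ {X Y : Stage C} (φ : Y ⟶ X) (x : P.ext.obj (op X)),
    app (P.ext.map φ.op x) = G.map φ.op (app x)

lemma ExtHom.val_app (α : ExtHom P Q.ext) {X : Stage C} (x : P.ext.obj (op X)) :
    val (α.app x) = val x ≫ val (α.app P.gen) := by
  conv_lhs => rw [← map_gen x, α.map_app, val_map_rebase]

/-- A natural family of maps between elements of presheaves is a map of presheaves. -/
def homOfExt (α : ExtHom P Q.ext) : P ⟶ Q where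
  hom := val (α.app P.gen)
  hom_proj := val_proj (α.app P.gen)
  hom_restr {X} x f h := by
    let φ : (⟨X, f ≫ C.dom⟩ : Stage C) ⟶ ⟨X, x ≫ P.proj⟩ :=
      Stage.mkHom (𝟙 X) f rfl (by simp [h])
    let e : P.ext.obj (op (⟨X, x ≫ P.proj⟩ : Stage C)) := P.el x rfl
    have h₁ := (α.val_app _).symm.trans (congrArg val (α.map_app φ e))
    rw [val_map, val_map] at h₁
    refine Eq.trans (congrArg (· ≫ _) (P.restr_congr ?_ rfl _ _)) (h₁.trans
      (Q.restr_congr ?_ rfl _ _))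
    · simp [φ, e]
    · rw [α.val_app]; simp [φ, e]

lemma homOfExt_app (α : ExtHom P Q.ext) {X : Stage C} (x : P.ext.obj (op X)) :
    (extMap (homOfExt α)).app _ x = α.app x :=
  val_injective (α.val_app x).symm

end Presheaf

/-- A presheaf on the category of stages whose elements, as far as change of base is concerned,
are represented by an object over `C₀` is the externalization of an internal presheaf. -/
lemma exists_presheaf_of_representable (G : (Stage C)ᵒᵖ ⥤ Type w) (V : Stage C)
    (u : G.obj (op V))
    (hu : ∀ (X : Stage C) (g : G.obj (op X)), ∃! q : X.base ⟶ V.base,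
      ∃ h : q ≫ V.pt = X.pt, G.map (Stage.rebase q h).op u = g) :
    ∃ (Q : Presheaf C) (e : Presheaf.ExtHom Q G), ∀ X, Function.Bijective (e.app (X := X)) := by
  choose q hq hq' using hu
  choose hqV hqu using hq
  -- the element classified by a map to `V`
  let el (X : Stage C) (x : X.base ⟶ V.base) (h : x ≫ V.pt = X.pt) : G.obj (op X) :=
    G.map (Stage.rebase x h).op u
  have el_q (X g) : el X (q X g) (hqV X g) = g := hqu X g
  have q_el (X x h) : q X (el X x h) = x := (hq' X _ x ⟨h, rfl⟩).symm
  have el_rebase {X Y : Stage C} (t : Y.base ⟶ X.base) (ht : t ≫ X.pt = Y.pt) (x h) :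
      G.map (Stage.rebase t ht).op (el X x h) = el Y (t ≫ x) (by simp [h, ht]) := by
    simp only [el, ← Functor.map_comp_apply, ← op_comp]
    exact Stage.map_congr (by simp) (by simp) u
  let A : Stage C := ⟨pullback V.pt C.cod, pullback.snd V.pt C.cod ≫ C.dom⟩
  let α : A ⟶ V := Stage.mkHom (pullback.fst _ _) (pullback.snd _ _) rfl pullback.condition.symm
  let act : A.base ⟶ V.base := q A (G.map α.op u)
  have act_proj : act ≫ V.pt = A.pt := hqV A _
  have act_el : el A act act_proj = G.map α.op u := el_q A _
  have hact {Y X : Stage C} (φ : Y ⟶ X) (x : X.base ⟶ V.base) (h : x ≫ V.pt = X.pt)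
      (z : Y.base ⟶ V.base) (f : Y.base ⟶ C.C₁) (hz : z = Stage.Hom.map φ ≫ x)
      (hf : f = Stage.Hom.arr φ) (h₁ h₂) :
      el Y (pullback.lift z f h₁ ≫ act) h₂ = G.map φ.op (el X x h) := by
    subst hz hf
    have h₃ : pullback.lift (Stage.Hom.map φ ≫ x) (Stage.Hom.arr φ) h₁ ≫ A.pt = Y.pt := by
      simp [A]
    rw [← el_rebase (X := A) _ h₃ act act_proj, act_el]
    simp only [el, ← Functor.map_comp_apply, ← op_comp]
    exact Stage.map_congr (by simp [α]) (by simp [α]) u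
  have el_inj {X : Stage C} {x y : X.base ⟶ V.base} {h : x ≫ V.pt = X.pt} {h' : y ≫ V.pt = X.pt}
      (hxy : el X x h = el X y h') : x = y := by
    rw [← q_el X x h, hxy, q_el]
  have proj_act {X : E} (x : X ⟶ V.base) (f : X ⟶ C.C₁) (h : x ≫ V.pt = f ≫ C.cod) :
      (pullback.lift x f h ≫ act) ≫ V.pt = f ≫ C.dom := by
    rw [Category.assoc, act_proj]
    simp [A]
  let Q : Presheaf C :=
    { obj := V.base
      proj := V.pt
      act := act
      act_proj := act_proj
      act_ident := fun {X} x => by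
        have := hact (𝟙 (⟨X, x ≫ V.pt⟩ : Stage C)) x rfl x (x ≫ V.pt ≫ C.ident) (by simp) (by simp)
          (by simp [C.ident_cod]) (by rw [proj_act]; simp [C.ident_dom])
        rw [op_id, G.map_id] at this
        exact el_inj this
      act_comp := fun {X} x f g hx h => by
        let ψ : (⟨X, f ≫ C.dom⟩ : Stage C) ⟶ ⟨X, x ≫ V.pt⟩ :=
          Stage.mkHom (𝟙 X) f rfl (by simp [hx])
        let φ : (⟨X, g ≫ C.dom⟩ : Stage C) ⟶ ⟨X, f ≫ C.dom⟩ :=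
          Stage.mkHom (𝟙 X) g rfl (by simp [h])
        have h₁ := hact ψ x rfl x f (by simp [ψ]) rfl hx (proj_act _ _ _)
        have h₂ := hact φ (pullback.lift x f hx ≫ act) (proj_act _ _ _) _ g (by simp [φ]; rfl) rfl
          (by rw [proj_act, h]) (proj_act _ _ _)
        have h₃ := hact (φ ≫ ψ) x rfl x (C.mul f g h) (by simp [φ, ψ])
          (by simp [Stage.comp_arr, φ, ψ]) (by rw [mul_cod, hx])
          (by rw [proj_act, mul_dom])
        rw [h₁, ← Functor.map_comp_apply, ← op_comp, ← h₃] at h₂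
        exact el_inj h₂ }
  refine ⟨Q, ⟨fun {X} x => el X (Presheaf.val x) (Presheaf.val_proj x), fun {X Y} φ x => ?_⟩,
    fun X => ⟨fun x y hxy => ?_, fun g => ⟨Q.el (q X g) (hqV X g), el_q X g⟩⟩⟩
  · exact hact φ _ (Presheaf.val_proj x) _ _ rfl rfl _ _
  · exact Presheaf.val_injective (el_inj hxy)

end

section

variable {E : Type u} [Category.{v} E] [PositiveHeyting E]

/-! ### Families of sieves in terms of generalized elements -/

section Mem

variable {C : InternalCategory E} {S : MorphismProperty E}

lemma precomp_prod_lift {W X Y Z : E} (s : W ⟶ X) (f : X ⟶ Y) (g : X ⟶ Z) :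
    s ≫ prod.lift f g = prod.lift (s ≫ f) (s ≫ g) := by
  ext <;> simp

lemma eq_prod_lift {X Y Z : E} (t : X ⟶ Y ⨯ Z) : t = prod.lift (t ≫ prod.fst) (t ≫ prod.snd) := by
  ext <;> simp

lemma factors_iff_mem {X B Y : E} {R : Subobject (X ⨯ B)} (t : Y ⟶ X ⨯ B) :
    R.Factors t ↔ Mem R (t ≫ prod.fst) (t ≫ prod.snd) := by
  rw [Mem, ← eq_prod_lift]

lemma mem_iff {X B Y : E} {R : Subobject (X ⨯ B)} {t : Y ⟶ X} {f : Y ⟶ B} :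
    Mem R t f ↔ ∃ r : Y ⟶ (R : E), r ≫ R.arrow ≫ prod.fst = t ∧ r ≫ R.arrow ≫ prod.snd = f := by
  constructor
  · intro h
    have e := R.factorThru_arrow (prod.lift t f) h
    refine ⟨R.factorThru (prod.lift t f) h, ?_, ?_⟩ <;> rw [← Category.assoc, e] <;> simp
  · rintro ⟨r, rfl, rfl⟩
    rw [Mem, ← precomp_prod_lift, ← eq_prod_lift]
    exact Subobject.factors_comp_arrow _

lemma mem_generic {X B : E} (R : Subobject (X ⨯ B)) :
    Mem R (R.arrow ≫ prod.fst) (R.arrow ≫ prod.snd) :=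
  mem_iff.2 ⟨𝟙 _, by simp, by simp⟩

lemma Mem.precomp {X B Y Z : E} {R : Subobject (X ⨯ B)} {t : Y ⟶ X} {f : Y ⟶ B} (h : Mem R t f)
    (s : Z ⟶ Y) : Mem R (s ≫ t) (s ≫ f) := by
  obtain ⟨r, rfl, rfl⟩ := mem_iff.1 h
  exact mem_iff.2 ⟨s ≫ r, by simp, by simp⟩

lemma mem_of_cover {X B Y Z : E} {R : Subobject (X ⨯ B)} {t : Y ⟶ X} {f : Y ⟶ B} {p : Z ⟶ Y}
    (hp : ExtremalEpi p) (h : Mem R (p ≫ t) (p ≫ f)) : Mem R t f := by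
  rw [Mem, ← precomp_prod_lift] at h
  exact subobject_factors_of_cover hp h

lemma pullback_factors_iff {X Y Z : E} (f : Y ⟶ X) (U : Subobject X) (t : Z ⟶ Y) :
    ((Subobject.pullback f).obj U).Factors t ↔ U.Factors (t ≫ f) := by
  have h := Subobject.isPullback f U
  constructor
  · intro ht
    rw [← Subobject.factorThru_arrow _ t ht, Category.assoc, ← h.w, ← Category.assoc]
    exact Subobject.factors_comp_arrow _
  · intro ht
    have : t = h.lift (U.factorThru _ ht) t (by simp) ≫
      ((Subobject.pullback f).obj U).arrow := by simp
    rw [this]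
    exact Subobject.factors_comp_arrow _

lemma mem_reindex {X X' B Y : E} {R : Subobject (X ⨯ B)} {p : X' ⟶ X} {t : Y ⟶ X'} {f : Y ⟶ B} :
    Mem (reindex p R) t f ↔ Mem R (t ≫ p) f := by
  rw [Mem, reindex, pullback_factors_iff, prod.lift_map, Category.comp_id, Mem]

omit [PositiveHeyting E] in
lemma le_iff_factors {X : E} {U V : Subobject X} :
    U ≤ V ↔ ∀ {Y : E} (t : Y ⟶ X), U.Factors t → V.Factors t := by
  constructor
  · intro h Y t ht
    exact Subobject.factors_of_le t h ht
  · intro h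
    have := h U.arrow (Subobject.factors_self U)
    exact Subobject.le_of_comm (V.factorThru _ this) (by simp)

lemma le_iff_mem {X B : E} {R R' : Subobject (X ⨯ B)} :
    R ≤ R' ↔ ∀ {Y : E} (t : Y ⟶ X) (f : Y ⟶ B), Mem R t f → Mem R' t f := by
  rw [le_iff_factors]
  exact ⟨fun h Y t f => h _, fun h Y t ht => factors_iff_mem _ |>.2 (h _ _ (factors_iff_mem _ |>.1 ht))⟩

lemma ext_of_mem {X B : E} {R R' : Subobject (X ⨯ B)}
    (h : ∀ {Y : E} (t : Y ⟶ X) (f : Y ⟶ B), Mem R t f ↔ Mem R' t f) : R = R' :=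
  le_antisymm (le_iff_mem.2 fun t f => (h t f).1) (le_iff_mem.2 fun t f => (h t f).2)

lemma reindex_comp {X X' X'' B : E} (R : Subobject (X ⨯ B)) (p : X' ⟶ X) (q : X'' ⟶ X') :
    reindex q (reindex p R) = reindex (q ≫ p) R :=
  ext_of_mem fun t f => by simp [mem_reindex]

lemma reindex_id {X B : E} (R : Subobject (X ⨯ B)) : reindex (𝟙 X) R = R :=
  ext_of_mem fun t f => by simp [mem_reindex]

omit [PositiveHeyting E] in
lemma mk_factors_iff' {X M T : E} (m : M ⟶ X) [Mono m] (t : T ⟶ X) :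
    (Subobject.mk m).Factors t ↔ ∃ u, u ≫ m = t := by
  rw [Subobject.mk_factors_iff]
  rfl

lemma mem_maximalSieve {X Y : E} {a : X ⟶ C.C₀} {t : Y ⟶ X} {f : Y ⟶ C.C₁} :
    Mem (maximalSieve C a) t f ↔ f ≫ C.cod = t ≫ a := by
  rw [Mem, maximalSieve, equalizerSubobject_factors_iff]
  simp

omit [PositiveHeyting E] in
lemma map_factors_iff {X M T : E} (m : M ⟶ X) [Mono m] (U : Subobject M) (t : T ⟶ X) :
    ((Subobject.map m).obj U).Factors t ↔ ∃ u, u ≫ m = t ∧ U.Factors u := by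
  have hU : (Subobject.map m).obj U = Subobject.mk (U.arrow ≫ m) := by
    conv_lhs => rw [← Subobject.mk_arrow U, Subobject.map_mk]
  rw [hU, mk_factors_iff']
  constructor
  · rintro ⟨u, rfl⟩
    exact ⟨u ≫ U.arrow, by simp, Subobject.factors_comp_arrow _⟩
  · rintro ⟨u, rfl, hu⟩
    exact ⟨U.factorThru _ hu, by simp⟩

lemma mem_restrictSieve {X Y : E} {g : X ⟶ C.C₁} {R : Subobject (X ⨯ C.C₁)} {t : Y ⟶ X}
    {f : Y ⟶ C.C₁} :
    Mem (restrictSieve C g R) t f ↔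
      ∃ h : (t ≫ g) ≫ C.dom = f ≫ C.cod, Mem R t (C.mul (t ≫ g) f h) := by
  have key : ∀ (u : Y ⟶ equalizer (prod.snd ≫ C.cod : X ⨯ C.C₁ ⟶ C.C₀) (prod.fst ≫ g ≫ C.dom)) h
      (_ : u ≫ equalizer.ι _ _ = prod.lift t f),
      u ≫ postcompose C g = prod.lift t (C.mul (t ≫ g) f h) := by
    intro u h hu
    have h₁ : u ≫ equalizer.ι _ _ ≫ prod.fst = t := by rw [← Category.assoc, hu]; simp
    have h₂ : u ≫ equalizer.ι _ _ ≫ prod.snd = f := by rw [← Category.assoc, hu]; simp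
    have h₃ : u ≫ equalizer.ι _ _ ≫ prod.fst ≫ g = t ≫ g := by rw [← h₁]; simp
    rw [postcompose, precomp_prod_lift, h₁, precomp_mul]
    simp only [h₂, h₃]
  rw [Mem, restrictSieve, map_factors_iff]
  constructor
  · rintro ⟨u, hu, hR⟩
    have h : (t ≫ g) ≫ C.dom = f ≫ C.cod := by
      have := u ≫= equalizer.condition (prod.snd ≫ C.cod : X ⨯ C.C₁ ⟶ C.C₀) (prod.fst ≫ g ≫ C.dom)
      simp only [← Category.assoc, hu] at this
      simpa using this.symm
    rw [pullback_factors_iff, key u h hu] at hR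
    exact ⟨h, hR⟩
  · rintro ⟨h, hR⟩
    refine ⟨equalizer.lift (prod.lift t f) (by simpa using h.symm), by simp, ?_⟩
    rw [pullback_factors_iff, key _ h (by simp)]
    exact hR

variable (hS : IsClassOfSmallMaps S)

include hS

lemma isSmallPred_factors_iff {X : E} {R : Subobject X} :
    IsSmallPred S (fun _ t => R.Factors t) ↔ S R.arrow := by
  constructor
  · rintro ⟨M, m, h₁, h₂, h₃⟩
    have hR : R = Subobject.mk m := le_antisymm
      (le_iff_factors.2 fun t ht => (mk_factors_iff' _ _).2 ((h₃ t).2 ht))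
      (le_iff_factors.2 fun t ht => (h₃ t).1 ((mk_factors_iff' _ _).1 ht))
    subst hR
    rw [← Subobject.underlyingIso_hom_comp_eq_mk]
    exact hS.composition (hS.iso_small _) h₂
  · intro h
    refine ⟨_, R.arrow, inferInstance, h, fun T t => ⟨?_, fun ht => ⟨R.factorThru t ht, by simp⟩⟩⟩
    rintro ⟨u, rfl⟩
    exact Subobject.factors_comp_arrow _

lemma IsSieve.small_arrow {X : E} {a : X ⟶ C.C₀} {R : Subobject (X ⨯ C.C₁)}
    (hR : IsSieve S C a R) : S R.arrow :=
  hS.of_comp hR.small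

lemma isSieve_of_small_arrow (hcod : S C.cod) {X : E} {a : X ⟶ C.C₀} {R : Subobject (X ⨯ C.C₁)}
    (hR : S R.arrow)
    (cod_eq : ∀ {Y : E} (t : Y ⟶ X) (f : Y ⟶ C.C₁), Mem R t f → f ≫ C.cod = t ≫ a)
    (closed : ∀ {Y : E} (t : Y ⟶ X) (f g : Y ⟶ C.C₁) (h : f ≫ C.dom = g ≫ C.cod),
      Mem R t f → Mem R t (C.mul f g h)) : IsSieve S C a R where
  cod_eq := cod_eq
  closed := closed
  small := by
    let k : (R : E) ⟶ pullback C.cod a := pullback.lift (R.arrow ≫ prod.snd) (R.arrow ≫ prod.fst)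
      (cod_eq _ _ (mem_generic R))
    have hk : k ≫ prod.lift (pullback.snd C.cod a) (pullback.fst C.cod a) = R.arrow := by
      rw [precomp_prod_lift, eq_prod_lift R.arrow]
      simp [k]
    have := hS.composition (hS.of_comp (f := k) (hk ▸ hR)) (hS.snd_small C.cod a hcod)
    simpa [k] using this

lemma IsSieve.reindex {X Y : E} {a : X ⟶ C.C₀} {R : Subobject (X ⨯ C.C₁)}
    (hR : IsSieve S C a R) (hcod : S C.cod) (t : Y ⟶ X) :
    IsSieve S C (t ≫ a) (SmallMaps.reindex t R) := by
  refine isSieve_of_small_arrow hS hcod ?_ (fun s f h => ?_) (fun s f g hfg h => ?_)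
  · rw [← isSmallPred_factors_iff hS]
    have := ((isSmallPred_factors_iff hS).2 (hR.small_arrow hS)).reindex hS (prod.map t (𝟙 C.C₁))
    exact this.congr fun T s => (pullback_factors_iff _ _ _).symm
  · rw [hR.cod_eq _ _ (mem_reindex.1 h), Category.assoc]
  · exact mem_reindex.2 (hR.closed _ _ _ hfg (mem_reindex.1 h))

lemma IsSieve.restrict {X : E} {a : X ⟶ C.C₀} {R : Subobject (X ⨯ C.C₁)}
    (hR : IsSieve S C a R) (hcod : S C.cod) (f : X ⟶ C.C₁) :
    IsSieve S C (f ≫ C.dom) (restrictSieve C f R) := by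
  refine isSieve_of_small_arrow hS hcod ?_ (fun s k h => ?_) (fun s k g hkg h => ?_)
  · rw [← isSmallPred_factors_iff hS]
    have h₁ := ((isSmallPred_factors_iff hS).2 (hR.small_arrow hS)).reindex hS (postcompose C f)
    exact (h₁.sigma hS _ (hS.equalizer_small _ _)).congr fun T s => by
      rw [restrictSieve, map_factors_iff]
      simp [pullback_factors_iff]
  · obtain ⟨h, -⟩ := mem_restrictSieve.1 h
    rw [← h, Category.assoc]
  · obtain ⟨h, hk⟩ := mem_restrictSieve.1 h
    refine mem_restrictSieve.2 ⟨by rw [h, mul_cod], ?_⟩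
    rw [← C.mul_assoc _ _ _ h hkg]
    exact hR.closed _ _ _ _ hk

end Mem

/-! ### The topology on the category of stages -/

section Cov

variable {C : InternalCategory E} {S : MorphismProperty E} {J : Topology S C}

namespace Topology

lemma cov_reindex {X Y : E} {a : X ⟶ C.C₀} {R : Subobject (X ⨯ C.C₁)} (h : J.Cov a R)
    (t : Y ⟶ X) : J.Cov (t ≫ a) (reindex t R) := by
  obtain ⟨U, hU⟩ := J.comprehension a R (J.isSieve a R h)
  have h₁ : U.Factors (𝟙 X) := (hU _).2 (by simpa [reindex_id] using h)
  refine (hU t).1 ?_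
  simpa using Subobject.factors_of_factors_right (P := U) t h₁

/-- Covering is local on the base: by comprehension it is a subobject of the base, and a cover does
not factor through a proper one. -/
lemma cov_of_cover {X Y : E} {a : X ⟶ C.C₀} {R : Subobject (X ⨯ C.C₁)} (hR : IsSieve S C a R)
    {p : Y ⟶ X} (hp : ExtremalEpi p) (h : J.Cov (p ≫ a) (reindex p R)) : J.Cov a R := by
  obtain ⟨U, hU⟩ := J.comprehension a R hR
  have h₁ : U.Factors (p ≫ 𝟙 X) := by rw [Category.comp_id]; exact (hU _).2 h
  simpa [reindex_id] using (hU (𝟙 X)).1 (subobject_factors_of_cover hp h₁)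

/-- A sieve that contains a covering sieve is covering: its restriction along the members of the
smaller one is maximal, so that local character applies. -/
lemma cov_mono {X : E} {a : X ⟶ C.C₀} {R T : Subobject (X ⨯ C.C₁)} (hT : IsSieve S C a T)
    (hR : J.Cov a R) (h : R ≤ T) : J.Cov a T := by
  refine J.local_character a R T hT hR fun {Y} t f hf => ?_
  have hf' : Mem (reindex t T) (𝟙 Y) f := mem_reindex.2 (by simpa using le_iff_mem.1 h _ _ hf)
  have : restrictSieve C f (reindex t T) = maximalSieve C (f ≫ C.dom) := by
    refine ext_of_mem fun s g => ?_
    rw [mem_maximalSieve, mem_restrictSieve]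
    constructor
    · rintro ⟨h, -⟩
      simpa using h.symm
    · intro hg
      refine ⟨by simpa using hg.symm, mem_reindex.2 (hT.closed _ _ _ _ ?_)⟩
      simpa using (mem_reindex.1 hf').precomp s
  rw [this]
  exact J.maximality _

end Topology

/-- Membership in a sieve of stages, for a generalized element given as a change of base and
an arrow. -/
def SieveMem {X : Stage C} (σ : Sieve X) {Y : E} (t : Y ⟶ X.base) (f : Y ⟶ C.C₁) : Prop :=
  ∃ h : f ≫ C.cod = t ≫ X.pt, σ (Stage.mkHom t f rfl h : (⟨Y, f ≫ C.dom⟩ : Stage C) ⟶ X)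

lemma sieveMem_iff {X Y : Stage C} {σ : Sieve X} (φ : Y ⟶ X) :
    SieveMem σ (Stage.Hom.map φ) (Stage.Hom.arr φ) ↔ σ φ := by
  obtain ⟨Y, b⟩ := Y
  obtain ⟨t, f, hd, hc⟩ := φ
  dsimp at t f hd hc
  subst hd
  exact ⟨fun ⟨_, h⟩ => h, fun h => ⟨hc, h⟩⟩

lemma sieveMem_of {X Y : Stage C} {σ : Sieve X} {φ : Y ⟶ X} (h : σ φ) {t : Y.base ⟶ X.base}
    {f : Y.base ⟶ C.C₁} (ht : Stage.Hom.map φ = t) (hf : Stage.Hom.arr φ = f) :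
    SieveMem σ t f := by
  subst ht hf
  exact (sieveMem_iff φ).2 h

lemma sieve_of_sieveMem {X Y : Stage C} {σ : Sieve X} {φ : Y ⟶ X} {t : Y.base ⟶ X.base}
    {f : Y.base ⟶ C.C₁} (h : SieveMem σ t f) (ht : Stage.Hom.map φ = t)
    (hf : Stage.Hom.arr φ = f) : σ φ := by
  subst ht hf
  exact (sieveMem_iff φ).1 h

lemma SieveMem.mul {X : Stage C} {σ : Sieve X} {Y : E} {t : Y ⟶ X.base} {f : Y ⟶ C.C₁}
    (h : SieveMem σ t f) (g : Y ⟶ C.C₁) (hg : f ≫ C.dom = g ≫ C.cod) :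
    SieveMem σ t (C.mul f g hg) := by
  obtain ⟨hc, h⟩ := h
  exact sieveMem_of (σ.downward_closed h
    (Stage.mkHom (X := ⟨Y, f ≫ C.dom⟩) (Y := ⟨Y, g ≫ C.dom⟩) (𝟙 _) g rfl (by simp [hg])))
    (by simp) (by simp [Stage.comp_arr])

/-- The sieve of stages determined by a family of sieves. -/
def sieveOf {X : Stage C} {R : Subobject (X.base ⨯ C.C₁)} (hR : IsSieve S C X.pt R) :
    Sieve X where
  arrows _ φ := Mem R (Stage.Hom.map φ) (Stage.Hom.arr φ)
  downward_closed {Y Z φ} h ψ := by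
    rw [Stage.comp_arr, Stage.comp_map]
    exact hR.closed _ _ _ _ (h.precomp _)

@[simp] lemma sieveOf_apply {X Y : Stage C} {R : Subobject (X.base ⨯ C.C₁)}
    (hR : IsSieve S C X.pt R) (φ : Y ⟶ X) :
    sieveOf hR φ ↔ Mem R (Stage.Hom.map φ) (Stage.Hom.arr φ) := Iff.rfl

variable (J) in
/-- A sieve of stages is covering if, on a cover of the base, it contains locally the members of
a family of covering sieves of the internal site. -/
def IsCoveringSieve {X : Stage C} (σ : Sieve X) : Prop :=
  ∃ (X' : E) (p : X' ⟶ X.base) (R : Subobject (X' ⨯ C.C₁)), ExtremalEpi p ∧ J.Cov (p ≫ X.pt) R ∧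
    ∀ {Y : E} (t : Y ⟶ X') (f : Y ⟶ C.C₁), Mem R t f →
      ∃ (Y' : E) (q : Y' ⟶ Y), ExtremalEpi q ∧ SieveMem σ (q ≫ t ≫ p) (q ≫ f)

lemma isCoveringSieve_pullback {X Y : Stage C} {σ : Sieve X} (h : IsCoveringSieve J σ)
    (φ : Y ⟶ X) : IsCoveringSieve J (σ.pullback φ) := by
  obtain ⟨X', p, R, hp, hR, H⟩ := h
  obtain ⟨Y', q, y, hq, hy⟩ := exists_lift_of_cover hp (Stage.Hom.map φ)
  have hc : (q ≫ Stage.Hom.arr φ) ≫ C.cod = y ≫ p ≫ X.pt := by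
    rw [Category.assoc, φ.arr_cod, ← Category.assoc, ← hy, Category.assoc]
  have hcov := J.stability (y ≫ p ≫ X.pt) (q ≫ Stage.Hom.arr φ) (reindex y R) hc
    (Topology.cov_reindex hR y)
  rw [Category.assoc, φ.arr_dom] at hcov
  refine ⟨Y', q, _, hq, hcov, fun {Z} t f hf => ?_⟩
  obtain ⟨h, hm⟩ := mem_restrictSieve.1 hf
  obtain ⟨Z', r, hr, hσ⟩ := H _ _ (mem_reindex.1 hm)
  refine ⟨Z', r, hr, ?_⟩
  have h' : (r ≫ f) ≫ C.cod = (r ≫ t ≫ q) ≫ Y.pt := by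
    rw [Category.assoc, ← h]; simp
  refine ⟨h', ?_⟩
  rw [Sieve.pullback_apply]
  refine sieve_of_sieveMem hσ ?_ ?_
  · simp [hy]
  · simp [Stage.comp_arr, precomp_mul]

/-- The composite of a covering family with covering families over its members is covering. This
is where the collection axiom enters: it makes the composite a small sieve. -/
lemma isCoveringSieve_transitive (hS : IsClassOfSmallMaps S) (hcod : S C.cod) {X : Stage C}
    {σ τ : Sieve X} (h : IsCoveringSieve J σ)
    (hτ : ∀ {Y : Stage C} (φ : Y ⟶ X), σ φ → IsCoveringSieve J (τ.pullback φ)) :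
    IsCoveringSieve J τ := by
  obtain ⟨X', p, R, hp, hR, H⟩ := h
  have hR' := J.isSieve _ _ hR
  -- the generic member of `R` belongs locally to `σ`
  obtain ⟨R', q, hq, hcσ, hσ⟩ := H _ _ (mem_generic R)
  obtain ⟨R'', p₂, T, hp₂, hT, HT⟩ := hτ _ hσ
  obtain ⟨Z, X'', z, g, h, hg, hsq⟩ := hS.collection (p₂ ≫ q) (R.arrow ≫ prod.fst)
    (cover_comp hp₂ hq) hR'.small
  have hsq_w := hsq.w
  have hTZ := Topology.cov_reindex hT z
  have hTZ' := J.isSieve _ _ hTZ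
  -- the union of the sieves `f ∘ T_z`, where `z` lies over `f`
  let f₀ : Z ⟶ C.C₁ := z ≫ p₂ ≫ q ≫ R.arrow ≫ prod.snd
  have hf₀ {Y : E} (s : Y ⟶ Z) (l : Y ⟶ C.C₁) (hm : Mem T (s ≫ z) l) :
      (s ≫ f₀) ≫ C.dom = l ≫ C.cod := by
    have := (J.isSieve _ _ hT).cod_eq _ _ hm
    simp only [Category.assoc] at this
    simp [f₀, this]
  let W : E := (reindex z T : Subobject (Z ⨯ C.C₁))
  let tW : W ⟶ Z := (reindex z T).arrow ≫ prod.fst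
  let gW : W ⟶ C.C₁ := (reindex z T).arrow ≫ prod.snd
  have hW : Mem T (tW ≫ z) gW := mem_reindex.1 (mem_generic _)
  obtain ⟨I, e, n, he, hn, hen⟩ := exists_image
    (prod.lift (tW ≫ g) (C.mul (tW ≫ f₀) gW (hf₀ _ _ hW)))
  have hen₁ : e ≫ n ≫ prod.fst = tW ≫ g := by rw [← Category.assoc, hen]; simp
  have hen₂ : e ≫ n ≫ prod.snd = C.mul (tW ≫ f₀) gW (hf₀ _ _ hW) := by
    rw [← Category.assoc, hen]; simp
  let V : Subobject (X'' ⨯ C.C₁) := Subobject.mk n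
  have hV {Y : E} (t : Y ⟶ X'') (k : Y ⟶ C.C₁) : Mem V t k ↔
      ∃ (Y' : E) (r : Y' ⟶ Y) (s : Y' ⟶ Z) (l : Y' ⟶ C.C₁) (hm : Mem T (s ≫ z) l),
        ExtremalEpi r ∧ s ≫ g = r ≫ t ∧ r ≫ k = C.mul (s ≫ f₀) l (hf₀ _ _ hm) := by
    rw [Mem, mk_factors_iff']
    constructor
    · rintro ⟨u, hu⟩
      obtain ⟨Y', r, w, hr, hw⟩ := exists_lift_of_cover he u
      have h₁ : w ≫ e ≫ n = r ≫ prod.lift t k := by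
        rw [← Category.assoc, hw, Category.assoc, hu]
      refine ⟨Y', r, w ≫ tW, w ≫ gW, by simpa using hW.precomp w, hr, ?_, ?_⟩
      · have := h₁ =≫ prod.fst
        simpa [hen₁] using this
      · have := h₁ =≫ prod.snd
        simp only [Category.assoc, hen₂, prod.lift_snd] at this
        rw [← this, precomp_mul]
        simp
    · rintro ⟨Y', r, s, l, hm, hr, h₁, h₂⟩
      obtain ⟨w, hw₁, hw₂⟩ := mem_iff.1 (mem_reindex.2 hm : Mem (reindex z T) s l)
      refine factors_of_cover hr n (u := w ≫ e) ?_
      rw [Category.assoc, hen, precomp_prod_lift, precomp_prod_lift, h₂, ← h₁, precomp_mul]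
      simp only [tW, gW, ← Category.assoc] at hw₁ hw₂ ⊢
      simp only [hw₁, hw₂]
  have hcodV {Y : E} (t : Y ⟶ X'') (k : Y ⟶ C.C₁) (hk : Mem V t k) :
      k ≫ C.cod = t ≫ h ≫ p ≫ X.pt := by
    obtain ⟨Y', r, s, l, hm, hr, h₁, h₂⟩ := (hV t k).1 hk
    rw [← cancel_epi r, ← Category.assoc, h₂, mul_cod]
    have h₃ := hR'.cod_eq _ _ (mem_generic R)
    have h₄ := (s ≫ z ≫ p₂ ≫ q) ≫= h₃
    have h₅ := hsq_w =≫ (p ≫ X.pt)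
    simp only [Category.assoc, f₀] at h₄ h₅ ⊢
    rw [h₄, h₅, ← Category.assoc, h₁, Category.assoc]
  have hVs : IsSieve S C ((h ≫ p) ≫ X.pt) V := by
    refine ⟨?_, fun t k hk => by simpa using hcodV t k hk, fun t k k' hkk' hk => ?_⟩
    · refine hS.quotients (f := e ≫ (Subobject.underlyingIso n).inv) (cover_comp he inferInstance) ?_
      have := hS.composition hTZ'.small hg
      simpa [V, hen₁, tW] using this
    · obtain ⟨Y', r, s, l, hm, hr, h₁, h₂⟩ := (hV t k).1 hk
      have h₃ : l ≫ C.dom = (r ≫ k') ≫ C.cod := by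
        have := congrArg (· ≫ C.dom) h₂
        simp only [mul_dom, Category.assoc] at this
        rw [← this, hkk', Category.assoc]
      refine (hV _ _).2 ⟨Y', r, s, C.mul l (r ≫ k') h₃, ?_, hr, h₁, ?_⟩
      · exact (J.isSieve _ _ hT).closed _ _ _ _ hm
      · rw [precomp_mul, ← C.mul_assoc _ _ _ (hf₀ _ _ hm) h₃]
        simp only [h₂]
  refine ⟨X'', h ≫ p, V, cover_comp hsq.2 hp, ?_, fun {Y} t k hk => ?_⟩
  · have hR₂ := Topology.cov_reindex hR h
    rw [← Category.assoc] at hR₂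
    refine J.local_character _ _ V hVs hR₂ fun {Y} t f hf => ?_
    obtain ⟨ρ, hρ₁, hρ₂⟩ := mem_iff.1 (mem_reindex.1 hf)
    obtain ⟨Y', r, s, hr, hs₁, hs₂⟩ := hsq.exists_lift ρ t (by rw [hρ₁])
    have hsf : s ≫ f₀ = r ≫ f := by
      have := hs₁ =≫ (R.arrow ≫ prod.snd)
      simp only [Category.assoc, hρ₂] at this
      simpa [f₀] using this
    have hVt := ((hVs.reindex hS hcod t).restrict hS hcod f)
    refine Topology.cov_of_cover hVt hr ?_
    have hTs := Topology.cov_reindex hT (s ≫ z)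
    have e₁ : (s ≫ z) ≫ p₂ ≫ (q ≫ R.arrow ≫ prod.snd) ≫ C.dom = r ≫ f ≫ C.dom := by
      rw [← Category.assoc r, ← hsf]; simp [f₀]
    rw [e₁] at hTs
    refine Topology.cov_mono (hVt.reindex hS hcod r) hTs (le_iff_mem.2 fun {Y₁} u l hl => ?_)
    rw [mem_reindex] at hl
    rw [mem_reindex, mem_restrictSieve]
    rw [← Category.assoc] at hl
    have e₂ := hf₀ _ _ hl
    have e₃ : (u ≫ s) ≫ f₀ = (u ≫ r) ≫ f := by rw [Category.assoc, hsf, Category.assoc]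
    refine ⟨by rw [← e₃, e₂], mem_reindex.2 ((hV _ _).2 ⟨Y₁, 𝟙 _, u ≫ s, l, hl, inferInstance,
      by simp [hs₂], ?_⟩)⟩
    simp only [e₃, Category.id_comp]
  · obtain ⟨Y', r, s, l, hm, hr, h₁, h₂⟩ := (hV t k).1 hk
    obtain ⟨Y₁, r₁, hr₁, hτ'⟩ := HT _ _ hm
    refine ⟨Y₁, r₁ ≫ r, cover_comp hr₁ hr, ?_⟩
    obtain ⟨hc, hτ'⟩ := hτ'
    rw [Sieve.pullback_apply] at hτ'
    refine sieveMem_of hτ' ?_ ?_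
    · have h₃ := (r₁ ≫ s) ≫= (hsq_w =≫ p)
      simp only [Category.assoc] at h₃
      simp only [Stage.comp_map, Stage.mkHom_map, Category.assoc]
      rw [h₃, ← Category.assoc s, h₁]
      simp
    · have e : (r₁ ≫ r) ≫ k = C.mul (r₁ ≫ s ≫ f₀) (r₁ ≫ l) (by simpa using r₁ ≫= hf₀ _ _ hm) := by
        rw [Category.assoc, h₂, precomp_mul]
      refine Eq.trans ?_ e.symm
      simp [Stage.comp_arr, f₀]

variable (J) in
/-- The topology on the category of stages induced by a topology on the internal category. -/
def stageTopology (hS : IsClassOfSmallMaps S) (hcod : S C.cod) : GrothendieckTopology (Stage C) where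
  sieves X := {σ | IsCoveringSieve J σ}
  top_mem' X := ⟨X.base, 𝟙 _, maximalSieve C (𝟙 _ ≫ X.pt), inferInstance, J.maximality _,
    fun {Y} t f hf => ⟨Y, 𝟙 _, inferInstance, by
      have := mem_maximalSieve.1 hf
      exact ⟨by simpa using this, trivial⟩⟩⟩
  pullback_stable' _ _ _ φ h := isCoveringSieve_pullback h φ
  transitive' _ _ h _ hτ := isCoveringSieve_transitive hS hcod h fun {_} _ hφ => hτ hφ

end Cov

end

section

variable {E : Type u} [Category.{v} E] [PositiveHeyting E]
  {C : InternalCategory E} {S : MorphismProperty E} {J : Topology S C}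

/-! ### Internal sheaves as sheaves on the category of stages -/

section

variable (hS : IsClassOfSmallMaps S) (hcod : S C.cod)

/-- The sieve of all maps of stages whose change of base factors through `q`. -/
def baseSieve {X : Stage C} {X' : E} (q : X' ⟶ X.base) : Sieve X where
  arrows _ φ := ∃ k, k ≫ q = Stage.Hom.map φ
  downward_closed := by
    rintro Y Z φ ⟨k, hk⟩ ψ
    exact ⟨Stage.Hom.map ψ ≫ k, by simp [hk]⟩

lemma baseSieve_pullback {X Y : Stage C} {X' : E} (q : X' ⟶ X.base) (φ : Y ⟶ X) :
    (baseSieve q).pullback φ = baseSieve (pullback.snd q (Stage.Hom.map φ)) := by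
  ext Z ψ
  constructor
  · rintro ⟨k, hk⟩
    exact ⟨pullback.lift k (Stage.Hom.map ψ) (by simpa using hk), by simp⟩
  · rintro ⟨k, hk⟩
    refine ⟨k ≫ pullback.fst _ _, ?_⟩
    rw [Category.assoc, pullback.condition, ← Category.assoc, hk]
    rfl

lemma baseSieve_le {X : Stage C} {X' : E} (q : X' ⟶ X.base) {σ : Sieve X}
    (h : σ (Stage.rebase (Y := ⟨X', q ≫ X.pt⟩) q rfl)) : baseSieve q ≤ σ := by
  rintro Y φ ⟨k, hk⟩
  refine sieve_of_sieveMem (sieveMem_of (σ.downward_closed h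
    (Stage.mkHom (Y := Y) k (Stage.Hom.arr φ) φ.arr_dom ?_)) rfl rfl) ?_ ?_
  · rw [φ.arr_cod, ← hk]; simp
  · simp [hk]
  · simp

lemma baseSieve_mem {X : Stage C} {X' : E} {q : X' ⟶ X.base} (hq : ExtremalEpi q) :
    baseSieve q ∈ stageTopology J hS hcod X := by
  refine ⟨X', q, maximalSieve C _, hq, J.maximality _, fun {Y} t f hf => ⟨Y, 𝟙 _, inferInstance, ?_⟩⟩
  have hf' := mem_maximalSieve.1 hf
  exact ⟨by simpa using hf', t, by simp⟩

lemma sieveOf_mem_iff {X : Stage C} {R : Subobject (X.base ⨯ C.C₁)} (hR : IsSieve S C X.pt R) :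
    sieveOf hR ∈ stageTopology J hS hcod X ↔ J.Cov X.pt R := by
  constructor
  · rintro ⟨X', p, T, hp, hT, H⟩
    refine Topology.cov_of_cover hR hp (Topology.cov_mono (hR.reindex hS hcod p) hT
      (le_iff_mem.2 fun t f hf => mem_reindex.2 ?_))
    obtain ⟨Y', q, hq, hc, h⟩ := H t f hf
    exact mem_of_cover hq h
  · intro h
    refine ⟨X.base, 𝟙 _, R, inferInstance, by simpa using h, fun {Y} t f hf =>
      ⟨Y, 𝟙 _, inferInstance, ?_⟩⟩
    refine ⟨by simpa using hR.cod_eq _ _ hf, ?_⟩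
    simpa using hf

lemma Presheaf.map_eq_map {P : Presheaf C} {Y X X' : Stage C} {φ : Y ⟶ X} {ψ : Y ⟶ X'}
    {x : P.ext.obj (op X)} {y : P.ext.obj (op X')}
    (h : Stage.Hom.map φ ≫ val x = Stage.Hom.map ψ ≫ val y)
    (h' : Stage.Hom.arr φ = Stage.Hom.arr ψ) : P.ext.map φ.op x = P.ext.map ψ.op y :=
  val_injective (P.restr_congr h h' _ _)

/-- Elements of an internal presheaf descend along covers of the base, since an element over a stage
is a map into the underlying object and covers are coequalizers of their kernel pairs. -/
lemma isSheafFor_baseSieve (P : Presheaf C) {X : Stage C} {X' : E} {q : X' ⟶ X.base}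
    (hq : ExtremalEpi q) : Presieve.IsSheafFor P.ext (baseSieve (C := C) q).arrows := by
  let ρ : (⟨X', q ≫ X.pt⟩ : Stage C) ⟶ X := Stage.rebase q rfl
  have hρ : baseSieve q ρ := ⟨𝟙 _, by simp [ρ]⟩
  intro ξ hξ
  have hξ' := hξ.to_sieveCompatible
  obtain ⟨z, hz⟩ := cover_desc hq (Presheaf.val (ξ ρ hρ)) (fun {T} t t' h => by
    let τ : (⟨T, t ≫ q ≫ X.pt⟩ : Stage C) ⟶ ⟨X', q ≫ X.pt⟩ := Stage.rebase t rfl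
    let τ' : (⟨T, t ≫ q ≫ X.pt⟩ : Stage C) ⟶ ⟨X', q ≫ X.pt⟩ := Stage.rebase t' (by
      simp only [← Category.assoc, h])
    have := hξ τ τ' hρ hρ (by ext <;> simp [τ, τ', ρ, h])
    simpa [τ, τ'] using congrArg Presheaf.val this)
  have hzp : z ≫ P.proj = X.pt := by
    rw [← cancel_epi q, ← Category.assoc, hz, Presheaf.val_proj]
  refine ⟨P.el z hzp, fun Y φ hφ => ?_, fun y hy => ?_⟩
  · obtain ⟨k, hk⟩ := hφ
    let ψ : Y ⟶ (⟨X', q ≫ X.pt⟩ : Stage C) := Stage.mkHom k (Stage.Hom.arr φ) φ.arr_dom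
      (by rw [φ.arr_cod, ← hk]; simp)
    have hψ : ψ ≫ ρ = φ := by ext <;> simp [ψ, ρ, hk]
    have h₁ := hξ' ρ ψ hρ
    have h₂ : ξ (ψ ≫ ρ) ((baseSieve q).downward_closed hρ ψ) = ξ φ ⟨k, hk⟩ := by
      congr
    rw [← h₂, h₁]
    refine Presheaf.map_eq_map ?_ rfl
    simp [ψ, ← hz, ← hk]
  · refine Presheaf.val_injective ?_
    have := congrArg Presheaf.val (hy ρ hρ)
    rw [Presheaf.val_el, ← cancel_epi q, hz, ← this]
    simp [ρ]

/-- Sieves that contain a cover of the base impose no condition on an internal presheaf. -/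
lemma isSheafFor_of_cover (P : Presheaf C) {X : Stage C} {X' : E} {q : X' ⟶ X.base}
    (hq : ExtremalEpi q) {σ : Sieve X} (h : baseSieve q ≤ σ) :
    Presieve.IsSheafFor P.ext σ.arrows := by
  refine Presieve.isSheafFor_subsieve P.ext h fun Y φ => ?_
  rw [baseSieve_pullback]
  exact isSheafFor_baseSieve P (cover_of_isPullback (IsPullback.of_hasPullback _ _) hq)

/-- The generic member of a family of sieves. -/
def genericMember {X : Stage C} {R : Subobject (X.base ⨯ C.C₁)} (hR : IsSieve S C X.pt R) :
    (⟨(R : E), (R.arrow ≫ prod.snd) ≫ C.dom⟩ : Stage C) ⟶ X :=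
  Stage.mkHom (R.arrow ≫ prod.fst) (R.arrow ≫ prod.snd) rfl (hR.cod_eq _ _ (mem_generic R))

lemma genericMember_mem {X : Stage C} {R : Subobject (X.base ⨯ C.C₁)} (hR : IsSieve S C X.pt R) :
    sieveOf hR (genericMember hR) := mem_generic R

/-- Every member of a family of sieves is a base change of the generic one. -/
lemma exists_genericMember {X Y : Stage C} {R : Subobject (X.base ⨯ C.C₁)}
    (hR : IsSieve S C X.pt R) {φ : Y ⟶ X} (hφ : sieveOf hR φ) :
    ∃ (r : Y.base ⟶ (R : E)) (h : r ≫ (R.arrow ≫ prod.snd) ≫ C.dom = Y.pt),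
      Stage.rebase (X := ⟨(R : E), (R.arrow ≫ prod.snd) ≫ C.dom⟩) r h ≫ genericMember hR = φ := by
  obtain ⟨r, hr₁, hr₂⟩ := mem_iff.1 hφ
  refine ⟨r, ?_, ?_⟩
  · have := φ.arr_dom
    change Stage.Hom.arr φ ≫ C.dom = Y.pt at this
    rw [← this, ← hr₂]; simp
  · ext
    · simpa [genericMember] using hr₁
    · simpa [genericMember] using hr₂

/-- The internal sheaf condition for a family of sieves in terms of stages. -/
lemma isSheafFor_sieveOf_iff (P : Presheaf C) {X : Stage C} {R : Subobject (X.base ⨯ C.C₁)}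
    (hR : IsSieve S C X.pt R) : Presieve.IsSheafFor P.ext (sieveOf hR).arrows ↔
      ∀ x : (R : E) ⟶ P.obj, IsCompatible P R x → ∃! y : X.base ⟶ P.obj, IsGlueing P X.pt R x y := by
  have hglue (x : (R : E) ⟶ P.obj) (y : P.ext.obj (op X)) :
      IsGlueing P X.pt R x (Presheaf.val y) ↔
        Presheaf.val (P.ext.map (genericMember hR).op y) = x := by
    constructor
    · rintro ⟨_, _, h⟩; exact h
    · intro h
      exact ⟨Presheaf.val_proj y, _, h⟩
  constructor
  · intro H x hx
    have hfac {Y : Stage C} {φ : Y ⟶ X} (hφ : sieveOf hR φ) := mem_iff.1 hφ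
    choose fac hfac₁ hfac₂ using @hfac
    let ξ : Presieve.FamilyOfElements P.ext (sieveOf hR).arrows := fun Y φ hφ =>
      P.el (fac hφ ≫ x) (by
        have := φ.arr_dom
        change Stage.Hom.arr φ ≫ C.dom = Y.pt at this
        rw [Category.assoc, hx.over_dom, ← this, ← hfac₂ hφ]; simp)
    have hξ : ξ.Compatible := by
      rw [Presieve.compatible_iff_sieveCompatible]
      intro Y Z φ g hφ
      apply Presheaf.val_injective
      have h₁ : (g.map ≫ fac hφ) ≫ R.arrow ≫ prod.snd = g.map ≫ φ.arr := by
        rw [Category.assoc, hfac₂]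
      have := hx.compat (g.map ≫ fac hφ) (fac ((sieveOf hR).downward_closed hφ g)) g.arr
        (by rw [h₁]; simp) (by rw [hfac₁, Category.assoc, hfac₁]; rfl)
        (by simp only [hfac₂, h₁]; rfl)
      exact this.trans (P.restr_congr (Category.assoc _ _ _) rfl _ _)
    obtain ⟨y, hy, hy'⟩ := H ξ hξ
    refine ⟨Presheaf.val y, (hglue x y).2 ?_, fun y' hy'' => ?_⟩
    · rw [hy _ (genericMember_mem hR)]
      have : fac (genericMember_mem hR) = 𝟙 _ := by
        rw [← cancel_mono R.arrow]
        have h₁ := hfac₁ (genericMember_mem hR)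
        have h₂ := hfac₂ (genericMember_mem hR)
        ext
        · simpa [genericMember] using h₁
        · simpa [genericMember] using h₂
      simp [ξ, this]
    · have hy₁ := hy''
      rw [← Presheaf.val_el (P := P) (X := X) y' hy''.1, hglue] at hy₁
      rw [← hy' (P.el y' hy''.1) fun Y φ hφ => ?_]
      · rfl
      · obtain ⟨r, h, rfl⟩ := exists_genericMember hR hφ
        rw [op_comp, Functor.map_comp_apply]
        apply Presheaf.val_injective
        rw [Presheaf.val_map_rebase, hy₁]
        simp only [ξ, Presheaf.val_el]
        congr 1
        rw [← cancel_mono R.arrow]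
        have h₁ := hfac₁ hφ
        have h₂ := hfac₂ hφ
        ext
        · simpa [genericMember] using h₁.symm
        · simpa [genericMember] using h₂.symm
  · intro H ξ hξ
    have hξ' := hξ.to_sieveCompatible
    let ρ := genericMember hR
    have hρ : sieveOf hR ρ := genericMember_mem hR
    obtain ⟨y, hy, hy'⟩ := H (Presheaf.val (ξ ρ hρ)) ⟨by simp, fun {Y} r r' g h h₁ h₂ => by
      let g₁ : (⟨Y, g ≫ C.dom⟩ : Stage C) ⟶ ⟨(R : E), (R.arrow ≫ prod.snd) ≫ C.dom⟩ :=
        Stage.rebase r' (by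
          have := h₂ =≫ C.dom
          rw [mul_dom] at this
          simpa using this)
      let g₂ : (⟨Y, g ≫ C.dom⟩ : Stage C) ⟶ ⟨(R : E), (R.arrow ≫ prod.snd) ≫ C.dom⟩ :=
        Stage.mkHom r g rfl (by simpa using h.symm)
      have h₃ := hξ g₁ g₂ hρ hρ (by
        ext
        · simpa [g₁, g₂, ρ, genericMember] using h₁
        · rw [Stage.rebase_comp_arr, Stage.comp_arr]
          exact h₂)
      have h₄ := congrArg Presheaf.val h₃
      rw [Presheaf.val_map_rebase] at h₄
      exact h₄⟩
    have hy₁ := hy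
    rw [← Presheaf.val_el (P := P) (X := X) y hy.1, hglue] at hy₁
    refine ⟨P.el y hy.1, fun Y φ hφ => ?_, fun y' hy'' => ?_⟩
    · obtain ⟨r, h, rfl⟩ := exists_genericMember hR hφ
      have h₁ := hξ' ρ (Stage.rebase r h) hρ
      refine Eq.trans ?_ h₁.symm
      rw [op_comp, Functor.map_comp_apply]
      congr 1
      exact Presheaf.val_injective hy₁
    · apply Presheaf.val_injective
      exact hy' _ ((hglue _ _).2 (congrArg Presheaf.val (hy'' ρ hρ)))

lemma sieveOf_pullback {X Y : Stage C} {R : Subobject (X.base ⨯ C.C₁)} (hR : IsSieve S C X.pt R)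
    (hcov : J.Cov X.pt R) (φ : Y ⟶ X) :
    ∃ (T : Subobject (Y.base ⨯ C.C₁)) (hT : IsSieve S C Y.pt T), J.Cov Y.pt T ∧
      (sieveOf hR).pullback φ = sieveOf hT := by
  have h := J.stability (Stage.Hom.map φ ≫ X.pt) (Stage.Hom.arr φ)
    (reindex (Stage.Hom.map φ) R) φ.arr_cod (Topology.cov_reindex hcov _)
  have e := φ.arr_dom
  change Stage.Hom.arr φ ≫ C.dom = Y.pt at e
  rw [e] at h
  refine ⟨_, J.isSieve _ _ h, h, ?_⟩
  ext Z ψ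
  rw [Sieve.pullback_apply, sieveOf_apply, sieveOf_apply, mem_restrictSieve, Stage.comp_arr]
  constructor
  · intro hm
    exact ⟨_, mem_reindex.2 hm⟩
  · rintro ⟨_, hm⟩
    exact mem_reindex.1 hm

/-- Internal sheaves are the internal presheaves that are sheaves on the category of stages. -/
theorem isSheaf_iff (P : Presheaf C) :
    IsSheaf J P ↔ Presieve.IsSheaf (stageTopology J hS hcod) P.ext := by
  constructor
  · intro H
    have hR₀ {X : Stage C} {R : Subobject (X.base ⨯ C.C₁)} (hR : IsSieve S C X.pt R)
        (hcov : J.Cov X.pt R) : Presieve.IsSheafFor P.ext (sieveOf hR).arrows :=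
      (isSheafFor_sieveOf_iff P hR).2 (H X.pt R hcov)
    rintro X σ ⟨X', p, R, hp, hcov, hσ⟩
    have hR : IsSieve S C (⟨X', p ≫ X.pt⟩ : Stage C).pt R := J.isSieve _ R hcov
    refine Presieve.isSheafFor_trans P.ext (baseSieve p) σ (isSheafFor_baseSieve P hp)
      (fun Y φ _ => ?_) (fun Y φ hφ => ?_)
    · rw [baseSieve_pullback]
      exact (isSheafFor_baseSieve P
        (cover_of_isPullback (IsPullback.of_hasPullback _ _) hp)).isSeparatedFor
    · obtain ⟨k, hk⟩ := hφ
      let ψ : Y ⟶ (⟨X', p ≫ X.pt⟩ : Stage C) := Stage.mkHom k (Stage.Hom.arr φ) φ.arr_dom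
        (by rw [φ.arr_cod, ← hk]; simp)
      obtain ⟨T, hT, hTcov, hTeq⟩ := sieveOf_pullback (X := ⟨X', p ≫ X.pt⟩) hR hcov ψ
      refine Presieve.isSheafFor_trans P.ext (sieveOf hT) (σ.pullback φ) (hR₀ hT hTcov)
        (fun Z χ _ => ?_) (fun Z χ hχ => ?_)
      · obtain ⟨T', hT', hTcov', hTeq'⟩ := sieveOf_pullback hT hTcov χ
        rw [hTeq']
        exact (hR₀ hT' hTcov').isSeparatedFor
      · rw [← hTeq, Sieve.pullback_apply, sieveOf_apply] at hχ
        obtain ⟨Z', q, hq, hσ'⟩ := hσ _ _ hχ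
        refine isSheafFor_of_cover P hq (baseSieve_le q ?_)
        rw [Sieve.pullback_apply, Sieve.pullback_apply]
        refine sieve_of_sieveMem hσ' ?_ ?_
        · simp [ψ, hk]
        · rw [Category.assoc, Stage.rebase_comp_arr]; rfl
  · intro H X a R hcov
    have hR := J.isSieve a R hcov
    refine (isSheafFor_sieveOf_iff P (X := ⟨X, a⟩) hR).1 (H _ ?_)
    exact (sieveOf_mem_iff hS hcod (X := ⟨X, a⟩) hR).2 hcov

end

end

section

variable {E : Type u} [Category.{v} E] [PositiveHeyting E]
  {C : InternalCategory E} {S : MorphismProperty E} {J : Topology S C}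

/-! ### Quotients by small equality relations -/

section

variable {G : (Stage C)ᵒᵖ ⥤ Type w}

lemma Stage.map_map {X Y Z : Stage C} (φ : Y ⟶ X) (ψ : Z ⟶ Y)
    (g : G.obj (op X)) : G.map ψ.op (G.map φ.op g) = G.map (ψ ≫ φ).op g := by
  rw [op_comp, Functor.map_comp_apply]

/-- The reindexings along `t` and `t'` of two elements agree. -/
def SameAt {V V' : Stage C} (u : G.obj (op V)) {T : E} (t : T ⟶ V.base) (u' : G.obj (op V'))
    (t' : T ⟶ V'.base) : Prop :=
  ∃ h : t' ≫ V'.pt = t ≫ V.pt, G.map (Stage.rebase (Y := ⟨T, t ≫ V.pt⟩) t rfl).op u =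
    G.map (Stage.rebase (Y := ⟨T, t ≫ V.pt⟩) t' h).op u'

/-- The stage at which two reindexed elements are compared may be any stage over the given
base whose object is the common one, not only the one named in the definition. -/
lemma sameAt_iff {V V' Y : Stage C} {u : G.obj (op V)} {t : Y.base ⟶ V.base} {u' : G.obj (op V')}
    {t' : Y.base ⟶ V'.base} (h : t ≫ V.pt = Y.pt) (h' : t' ≫ V'.pt = Y.pt) :
    SameAt u t u' t' ↔ G.map (Stage.rebase t h).op u = G.map (Stage.rebase t' h').op u' := by
  obtain ⟨Y, y⟩ := Y
  dsimp at t t' h h'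
  subst h
  exact ⟨fun ⟨_, h⟩ => h, fun h => ⟨h', h⟩⟩

namespace SameAt

variable {V V' V'' : Stage C} {u : G.obj (op V)} {T : E} {t : T ⟶ V.base} {u' : G.obj (op V')}
  {t' : T ⟶ V'.base} {u'' : G.obj (op V'')} {t'' : T ⟶ V''.base}

lemma refl (u : G.obj (op V)) (t : T ⟶ V.base) : SameAt u t u t := ⟨rfl, rfl⟩

lemma symm (h : SameAt u t u' t') : SameAt u' t' u t :=
  (sameAt_iff (Y := ⟨T, t ≫ V.pt⟩) h.1 rfl).2 h.2.symm

lemma trans (h : SameAt u t u' t') (h' : SameAt u' t' u'' t'') : SameAt u t u'' t'' :=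
  ⟨h'.1.trans h.1, h.2.trans ((sameAt_iff (Y := ⟨T, t ≫ V.pt⟩) h.1 (h'.1.trans h.1)).1 h')⟩

lemma precomp (h : SameAt u t u' t') {T' : E} (s : T' ⟶ T) : SameAt u (s ≫ t) u' (s ≫ t') := by
  obtain ⟨h₁, h₂⟩ := h
  have h₃ := congrArg (G.map (Stage.rebase (Y := ⟨T', s ≫ t ≫ V.pt⟩) (X := ⟨T, t ≫ V.pt⟩)
    s rfl).op) h₂
  rw [Stage.map_map, Stage.map_map] at h₃
  refine (sameAt_iff (Y := ⟨T', s ≫ t ≫ V.pt⟩) (by simp) (by simp [h₁])).2 ?_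
  refine (Stage.map_congr ?_ ?_ _).trans (h₃.trans (Stage.map_congr ?_ ?_ _)) <;> simp

/-- Reindexing in two steps. -/
lemma of_map {Y : Stage C} (s : Y.base ⟶ V.base) (hs : s ≫ V.pt = Y.pt) (r : T ⟶ Y.base)
    (hr : r ≫ s = t) (u : G.obj (op V)) : SameAt (G.map (Stage.rebase s hs).op u) r u t := by
  subst hr
  refine ⟨by rw [Category.assoc, hs], ?_⟩
  rw [Stage.map_map]
  exact Stage.map_congr (by simp) (by simp) _

/-- Restrictions along the same arrow agree once the underlying elements do. -/
lemma map_eq (h : SameAt u t u' t') {Y : Stage C} {φ : Y ⟶ V} {φ' : Y ⟶ V'} (s : Y.base ⟶ T)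
    (h₁ : s ≫ t = Stage.Hom.map φ) (h₂ : s ≫ t' = Stage.Hom.map φ')
    (h₃ : Stage.Hom.arr φ = Stage.Hom.arr φ') : G.map φ.op u = G.map φ'.op u' := by
  obtain ⟨h, e⟩ := h
  let χ : Y ⟶ (⟨T, t ≫ V.pt⟩ : Stage C) := Stage.mkHom s (Stage.Hom.arr φ) φ.arr_dom
    (by rw [φ.arr_cod]; simp only [← h₁, ← Category.assoc])
  have e₁ := congrArg (G.map χ.op) e
  rw [Stage.map_map, Stage.map_map] at e₁
  refine (Stage.map_congr ?_ ?_ u).trans (e₁.trans (Stage.map_congr ?_ ?_ u')) <;>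
    simp [χ, h₁, h₂, h₃]

end SameAt

variable (G) in
/-- Separation and glueing of elements of `G` along covers of the base of a stage. -/
structure IsCoverSheaf : Prop where
  sep : ∀ {X : Stage C} {X' : E} {q : X' ⟶ X.base}, ExtremalEpi q → ∀ {g g' : G.obj (op X)},
    SameAt g q g' q → g = g'
  glue : ∀ {X : Stage C} {X' : E} {q : X' ⟶ X.base}, ExtremalEpi q →
    ∀ g : G.obj (op (⟨X', q ≫ X.pt⟩ : Stage C)),
    (∀ {T : E} (t t' : T ⟶ X'), t ≫ q = t' ≫ q → SameAt g t g t') →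
    ∃ g₀ : G.obj (op X), SameAt g₀ q g (𝟙 X')

/-- Equality of elements of a cover sheaf is local on the base. -/
lemma SameAt.of_cover (hG : IsCoverSheaf G) {V V' : Stage C} {u : G.obj (op V)} {T : E}
    {t : T ⟶ V.base} {u' : G.obj (op V')} {t' : T ⟶ V'.base} {T' : E} {q : T' ⟶ T}
    (hq : ExtremalEpi q) (h : SameAt u (q ≫ t) u' (q ≫ t')) : SameAt u t u' t' := by
  have e : t' ≫ V'.pt = t ≫ V.pt := by
    have := h.1
    simp only [Category.assoc] at this
    rwa [cancel_epi] at this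
  refine ⟨e, hG.sep hq ?_⟩
  exact (SameAt.of_map (Y := ⟨T, t ≫ V.pt⟩) _ _ _ rfl _).trans
    (h.trans (SameAt.of_map (Y := ⟨T, t ≫ V.pt⟩) _ _ _ rfl _).symm)

/-- The topology on stages contains the covers of the base, so sheaves on stages are cover
sheaves. -/
lemma isCoverSheaf_of_isSheaf (hS : IsClassOfSmallMaps S) (hcod : S C.cod)
    (hG : Presieve.IsSheaf (stageTopology J hS hcod) G) : IsCoverSheaf G where
  sep {X X' q} hq g g' h := by
    refine (hG _ (baseSieve_mem (J := J) hS hcod hq)).isSeparatedFor.ext fun Y φ hφ => ?_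
    obtain ⟨k, hk⟩ := hφ
    exact h.map_eq k hk hk rfl
  glue {X X' q} hq g hg := by
    have hfac {Y : Stage C} {φ : Y ⟶ X} (hφ : baseSieve q φ) :
        ∃ ψ : Y ⟶ (⟨X', q ≫ X.pt⟩ : Stage C), ψ ≫ Stage.rebase q rfl = φ := by
      obtain ⟨k, hk⟩ := hφ
      refine ⟨Stage.mkHom k (Stage.Hom.arr φ) φ.arr_dom (by rw [φ.arr_cod, ← hk]; simp), ?_⟩
      ext <;> simp [hk]
    choose fac hfac using @hfac
    let ξ : Presieve.FamilyOfElements G (baseSieve (C := C) q).arrows :=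
      fun Y φ hφ => G.map (fac hφ).op g
    have hwd {Y : Stage C} (ψ ψ' : Y ⟶ (⟨X', q ≫ X.pt⟩ : Stage C))
        (h : ψ ≫ Stage.rebase (X := X) q rfl = ψ' ≫ Stage.rebase (X := X) q rfl) :
        G.map ψ.op g = G.map ψ'.op g := by
      have h₁ := congrArg Stage.Hom.map h
      have h₂ := congrArg Stage.Hom.arr h
      simp only [Stage.comp_map, Stage.rebase_map, Stage.comp_rebase_arr] at h₁ h₂
      exact (hg _ _ h₁).map_eq (𝟙 _) (by simp) (by simp) h₂
    have hξ : ξ.Compatible := by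
      intro Y₁ Y₂ Z g₁ g₂ f₁ f₂ h₁ h₂ hc
      simp only [ξ]
      rw [Stage.map_map, Stage.map_map]
      exact hwd _ _ (by simp only [Category.assoc, hfac, hc])
    obtain ⟨g₀, hg₀, -⟩ := hG _ (baseSieve_mem (J := J) hS hcod hq) ξ hξ
    have hρ : baseSieve q (Stage.rebase (X := X) (Y := ⟨X', q ≫ X.pt⟩) q rfl) := ⟨𝟙 _, by simp⟩
    refine ⟨g₀, by simp, (hg₀ _ hρ).trans (hwd _ _ ?_)⟩
    rw [hfac]
    ext <;> simp

/-- A cover sheaf all of whose elements are locally reindexings of a single element `u`, for which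
the equality of reindexings is a small predicate, is represented by an internal presheaf: the
quotient of the base of `u` by this equality. -/
lemma exists_presheaf_of_chart (hP : IsPredicative S)
    (hG : IsCoverSheaf G) (V : Stage C) (u : G.obj (op V))
    (hsmall : IsSmallPred S (X := V.base ⨯ V.base) (fun _ t =>
      SameAt u (t ≫ prod.fst) u (t ≫ prod.snd)))
    (hloc : ∀ (X : Stage C) (g : G.obj (op X)), ∃ (X' : E) (q : X' ⟶ X.base) (x : X' ⟶ V.base),
      ExtremalEpi q ∧ SameAt u x g q) :
    ∃ (Q : Presheaf C) (e : Presheaf.ExtHom Q G), ∀ X, Function.Bijective (e.app (X := X)) := by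
  obtain ⟨M, m, hm, hmS, hM⟩ := hsmall
  -- the relation in terms of pairs of generalized elements
  have hM' {T : E} (t t' : T ⟶ V.base) :
      (∃ k : T ⟶ M, k ≫ m ≫ prod.fst = t ∧ k ≫ m ≫ prod.snd = t') ↔ SameAt u t u t' := by
    have h₁ := hM (prod.lift t t')
    simp only [prod.lift_fst, prod.lift_snd] at h₁
    rw [← h₁]
    exact exists_congr fun k => ⟨fun ⟨h₁, h₂⟩ => by ext <;> simp [h₁, h₂],
        fun hk => ⟨by rw [← Category.assoc, hk]; simp, by rw [← Category.assoc, hk]; simp⟩⟩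
  have heq : IsEquivalenceRelation (m ≫ prod.fst) (m ≫ prod.snd) := by
    refine ⟨?_, fun {T} x => ?_, fun {T} t => ?_, fun {T} t t' htt' => ?_⟩
    · rwa [← eq_prod_lift]
    · exact (hM' x x).2 (.refl _ _)
    · exact (hM' _ _).2 ((hM' _ _).1 ⟨t, rfl, rfl⟩).symm
    · exact (hM' _ _).2 (((hM' _ _).1 ⟨t, rfl, rfl⟩).trans ((hM' _ _).1 ⟨t', htt'.symm, rfl⟩))
  obtain ⟨Q, q, hq, hQ⟩ := hP.bounded_exactness _ _ heq (by rwa [← eq_prod_lift])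
  have hker {T : E} (t t' : T ⟶ V.base) : t ≫ q = t' ≫ q ↔ SameAt u t u t' := by
    rw [← hM']
    constructor
    · intro e
      exact ⟨hQ.lift t t' e, by simp, by simp⟩
    · rintro ⟨k, rfl, rfl⟩
      simp [hQ.w]
  obtain ⟨pt, hpt⟩ := cover_desc hq V.pt (fun {T} t t' h => ((hker t t').1 h).1.symm)
  obtain ⟨base, vpt⟩ := V
  dsimp at q hpt
  subst hpt
  obtain ⟨u', hu'⟩ := hG.glue (X := ⟨Q, pt⟩) hq u fun {T} t t' htt' => (hker t t').1 htt'
  have hu'' {T : E} (t : T ⟶ base) : SameAt (V := ⟨Q, pt⟩) (V' := ⟨base, q ≫ pt⟩) u' (t ≫ q) u t := by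
    simpa using hu'.precomp t
  suffices h : ∀ (X : Stage C) (g : G.obj (op X)), ∃! z : X.base ⟶ Q,
      SameAt (V := ⟨Q, pt⟩) u' z g (𝟙 _) by
    refine exists_presheaf_of_representable G ⟨Q, pt⟩ u' fun X g => ?_
    refine (existsUnique_congr fun z => ?_).1 (h X g)
    constructor
    · rintro ⟨h, h'⟩
      refine ⟨by simpa using h.symm, ?_⟩
      rw [(sameAt_iff (Y := X) (by simpa using h.symm) (by simp)).1 ⟨h, h'⟩]
      refine (Stage.map_congr (ψ := 𝟙 X) (by simp) (by simp) g).trans ?_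
      simp
    · rintro ⟨h, rfl⟩
      exact (SameAt.of_map _ _ _ (by simp) _).symm
  intro X g
  obtain ⟨X', p, x, hp, hxg⟩ := hloc X g
  obtain ⟨z, hz⟩ := cover_desc hp (x ≫ q) (fun {T} t t' h => by
    rw [← Category.assoc, ← Category.assoc]
    refine (hker _ _).2 ((hxg.precomp t).trans ?_)
    rw [h]
    exact (hxg.precomp t').symm)
  refine ⟨z, SameAt.of_cover hG hp ?_, fun y hy => ?_⟩
  · rw [hz, Category.comp_id]
    exact (hu'' x).trans hxg
  · obtain ⟨Y, r, s, hr, hs⟩ := exists_lift_of_cover hq (p ≫ y)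
    rw [← cancel_epi p, ← cancel_epi r, hz, ← hs, ← Category.assoc]
    refine (hker _ _).2 ((hu'' s).symm.trans ?_)
    rw [hs]
    have := hy.precomp (r ≫ p)
    simp only [Category.assoc, Category.comp_id] at this
    exact this.trans (hxg.precomp r).symm

end

end

section

variable {E : Type u} [Category.{v} E] [PositiveHeyting E]
  {C : InternalCategory E} {S : MorphismProperty E} {J : Topology S C}

/-! ### Smallness of covering and of equality in a sheaf -/

section

variable (hS : IsClassOfSmallMaps S) (hcod : S C.cod)

lemma isSmallPred_mem (hS : IsClassOfSmallMaps S) {X : E} {a : X ⟶ C.C₀}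
    {R : Subobject (X ⨯ C.C₁)} (hR : IsSieve S C a R) {Y : E} (t : Y ⟶ X) (f : Y ⟶ C.C₁) :
    IsSmallPred S (fun _ s => Mem R (s ≫ t) (s ≫ f)) :=
  (((isSmallPred_factors_iff hS).2 (hR.small_arrow hS)).reindex hS (prod.lift t f)).congr
    fun T s => by rw [precomp_prod_lift]; rfl

include hS hcod in
/-- Being covering is a small property of sieves, by presentability of the site. -/
lemma isSmallPred_cov (pres : Presentation J) {X : E} {a : X ⟶ C.C₀} {R : Subobject (X ⨯ C.C₁)}
    (hR : IsSieve S C a R) : IsSmallPred S (fun _ t => J.Cov (t ≫ a) (reindex t R)) := by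
  have hB := pres.isSieve
  let P := pullback pres.β a
  let D := pullback (pres.BCov.arrow ≫ prod.fst) (pullback.fst pres.β a)
  have h₁ : IsSmallPred S (X := D) (fun _ s => Mem R (s ≫ pullback.snd _ _ ≫ pullback.snd _ _)
      (s ≫ pullback.fst _ _ ≫ pres.BCov.arrow ≫ prod.snd)) := isSmallPred_mem hS hR _ _
  have h₂ := h₁.all hS (pullback.snd _ _ : D ⟶ P) (hS.snd_small _ _ hB.small)
  have h₃ := h₂.exist hS (pullback.snd pres.β a) (hS.snd_small _ _ pres.small)
  refine h₃.congr fun T t => ?_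
  rw [pres.cov_iff _ _ (hR.reindex hS hcod t)]
  constructor
  · rintro ⟨T', p, w, hp, hw, H⟩
    refine ⟨T', p, w ≫ pullback.fst _ _, hp, ?_, le_iff_mem.2 fun {Y} s f hf => ?_⟩
    · rw [Category.assoc, pullback.condition, ← Category.assoc, hw, Category.assoc]
    · obtain ⟨r, hr₁, hr₂⟩ := mem_iff.1 (mem_reindex.1 hf)
      have := H Y s (pullback.lift r (s ≫ w) (by simp [hr₁])) (by simp)
      rw [reindex_comp, mem_reindex]
      simpa [hr₂, hw] using this
  · rintro ⟨T', p, b, hp, hb, hle⟩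
    refine ⟨T', p, pullback.lift b (p ≫ t) (by rw [hb, Category.assoc]), hp, by simp,
      fun Y s d hd => ?_⟩
    have h₄ : (d ≫ pullback.fst _ _) ≫ pres.BCov.arrow ≫ prod.fst = s ≫ b := by
      rw [Category.assoc, pullback.condition, ← Category.assoc, hd]
      simp
    have h₅ := le_iff_mem.1 hle s (d ≫ pullback.fst _ _ ≫ pres.BCov.arrow ≫ prod.snd)
      (mem_reindex.2 (mem_iff.2 ⟨d ≫ pullback.fst _ _, h₄, by simp⟩))
    rw [reindex_comp, mem_reindex] at h₅
    rw [← Category.assoc d, hd]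
    simpa using h₅

variable {G : (Stage C)ᵒᵖ ⥤ Type w} {P : Presheaf C}

/-- The sieve of maps along which two elements become equal. -/
def eqSieve {X : Stage C} (x y : G.obj (op X)) : Sieve X where
  arrows _ φ := G.map φ.op x = G.map φ.op y
  downward_closed h ψ := by rw [← Stage.map_map, h, Stage.map_map]

lemma eqSieve_apply {X Y : Stage C} (x y : G.obj (op X)) (φ : Y ⟶ X) :
    eqSieve x y φ ↔ G.map φ.op x = G.map φ.op y := Iff.rfl

lemma eqSieve_self {X : Stage C} (x : G.obj (op X)) : eqSieve x x = ⊤ := by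
  ext Y φ
  simp [eqSieve_apply]

/-- The sieve of maps along which an element is in the image of `e`. -/
def imSieve (e : P.ExtHom G) {X : Stage C} (g : G.obj (op X)) : Sieve X where
  arrows _ φ := ∃ x, e.app x = G.map φ.op g
  downward_closed := by
    rintro Y Z φ ⟨x, hx⟩ ψ
    exact ⟨P.ext.map ψ.op x, by rw [e.map_app, hx, Stage.map_map]⟩

/-- `g` is described by elements of `P` on a small covering sieve. -/
def IsPresented (J : Topology S C) (e : P.ExtHom G) {X : Stage C} (g : G.obj (op X)) : Prop :=
  ∃ (R : Subobject (X.base ⨯ C.C₁)) (hR : IsSieve S C X.pt R), J.Cov X.pt R ∧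
    ∃ x, e.app x = G.map (genericMember hR).op g

lemma sieveOf_reindex {X : Stage C} {R : Subobject (X.base ⨯ C.C₁)} (hR : IsSieve S C X.pt R)
    (hS : IsClassOfSmallMaps S) (hcod : S C.cod) {Y : E} (t : Y ⟶ X.base) :
    sieveOf (X := ⟨Y, t ≫ X.pt⟩) (hR.reindex hS hcod t) =
      (sieveOf hR).pullback (Stage.rebase (Y := ⟨Y, t ≫ X.pt⟩) t rfl) := by
  ext Z φ
  rw [Sieve.pullback_apply, sieveOf_apply, sieveOf_apply, mem_reindex]
  simp

include hS in
/-- Being described on a small covering sieve is stable under change of base. -/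
lemma IsPresented.map {e : P.ExtHom G} {X Y : Stage C} {g : G.obj (op X)}
    (hg : IsPresented J e g) (hcod : S C.cod) (t : Y.base ⟶ X.base) (ht : t ≫ X.pt = Y.pt) :
    IsPresented J e (G.map (Stage.rebase t ht).op g) := by
  obtain ⟨R, hR, hcov, x, hx⟩ := hg
  obtain ⟨Y, y⟩ := Y
  dsimp at t ht
  subst ht
  refine ⟨reindex t R, hR.reindex hS hcod t, Topology.cov_reindex hcov t, ?_⟩
  have hm := genericMember_mem (X := ⟨Y, t ≫ X.pt⟩) (hR.reindex hS hcod t)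
  rw [sieveOf_reindex hR hS hcod, Sieve.pullback_apply] at hm
  obtain ⟨r, h, hr⟩ := exists_genericMember hR hm
  exact ⟨P.ext.map (Stage.rebase r h).op x, by rw [e.map_app, hx, Stage.map_map, Stage.map_map, hr]⟩

include hS hcod in
/-- A small sieve of stages is given by a family of sieves. -/
lemma exists_sieveOf_eq {X : Stage C} (σ : Sieve X) (hσ : IsSmallPred S (X := X.base ⨯ C.C₁)
    (fun _ t => SieveMem σ (t ≫ prod.fst) (t ≫ prod.snd))) :
    ∃ (R : Subobject (X.base ⨯ C.C₁)) (hR : IsSieve S C X.pt R), sieveOf hR = σ := by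
  obtain ⟨M, m, hm, hmS, hM⟩ := hσ
  have hR (Y : E) (t : Y ⟶ X.base) (f : Y ⟶ C.C₁) : Mem (Subobject.mk m) t f ↔ SieveMem σ t f := by
    rw [Mem, mk_factors_iff', hM]
    simp
  refine ⟨Subobject.mk m, isSieve_of_small_arrow hS hcod ?_ (fun {Y} t f h => ?_)
    (fun t f g hfg h => ?_), ?_⟩
  · rw [← Subobject.underlyingIso_hom_comp_eq_mk]
    exact hS.composition (hS.iso_small _) hmS
  · exact ((hR _ _ _).1 h).1
  · exact (hR _ _ _).2 (((hR _ _ _).1 h).mul g hfg)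
  · ext Y φ
    rw [sieveOf_apply, hR, sieveMem_iff]

/-- For a small sieve of stages, the locus where it is covering is small. -/
lemma isSmallPred_pullback_mem (pres : Presentation J) {X : Stage C} (σ : Sieve X)
    (hσ : IsSmallPred S (X := X.base ⨯ C.C₁)
      (fun _ t => SieveMem σ (t ≫ prod.fst) (t ≫ prod.snd))) :
    IsSmallPred S (fun T t => σ.pullback (Stage.rebase (Y := ⟨T, t ≫ X.pt⟩) t rfl) ∈
      stageTopology J hS hcod _) := by
  obtain ⟨R, hR, rfl⟩ := exists_sieveOf_eq hS hcod σ hσ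
  refine (isSmallPred_cov hS hcod pres hR).congr fun T t => ?_
  rw [← sieveOf_reindex hR hS hcod, sieveOf_mem_iff]

/-- Elements with a common image are equal on a covering sieve. -/
def IsLocallyInjective (e : P.ExtHom G) : Prop :=
  ∀ {X : Stage C} (x y : P.ext.obj (op X)), e.app x = e.app y →
    eqSieve x y ∈ stageTopology J hS hcod X

/-- Elements are in the image on a covering sieve. -/
def IsLocallySurjective (e : P.ExtHom G) : Prop :=
  ∀ {X : Stage C} (g : G.obj (op X)), imSieve e g ∈ stageTopology J hS hcod X

lemma eqSieve_pullback {X Y : Stage C} (x y : G.obj (op X)) (φ : Y ⟶ X) :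
    (eqSieve x y).pullback φ = eqSieve (G.map φ.op x) (G.map φ.op y) := by
  ext Z ψ
  rw [Sieve.pullback_apply, eqSieve_apply, eqSieve_apply, Stage.map_map, Stage.map_map]

lemma eq_of_eqSieve_mem (hG : Presieve.IsSheaf (stageTopology J hS hcod) G) {X : Stage C}
    {x y : G.obj (op X)} (h : eqSieve x y ∈ stageTopology J hS hcod X) : x = y :=
  (hG _ h).isSeparatedFor.ext fun _ _ h => h

lemma sameAt_self_iff {X : Stage C} {g g' : G.obj (op X)} {T : E} {t : T ⟶ X.base} :
    SameAt g t g' t ↔ G.map (Stage.rebase (Y := ⟨T, t ≫ X.pt⟩) t rfl).op g =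
      G.map (Stage.rebase (Y := ⟨T, t ≫ X.pt⟩) t rfl).op g' :=
  sameAt_iff (Y := ⟨T, t ≫ X.pt⟩) rfl rfl

/-- Equality in a sheaf is a small predicate on elements coming from `P`. -/
lemma isSmallPred_sameAt_app (pres : Presentation J)
    (hG : Presieve.IsSheaf (stageTopology J hS hcod) G) {e : P.ExtHom G}
    (he : IsLocallyInjective (J := J) hS hcod e) {X : Stage C} (y y' : P.ext.obj (op X)) :
    IsSmallPred S (X := X.base) (fun _ t => SameAt (e.app y) t (e.app y') t) := by
  have hR := J.isSieve X.pt _ (J.maximality X.pt)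
  have hσ : IsSmallPred S (X := X.base ⨯ C.C₁)
      (fun _ t => SieveMem (eqSieve y y') (t ≫ prod.fst) (t ≫ prod.snd)) := by
    refine (IsSmallPred.sigma hS _ (hR.small_arrow hS) (IsSmallPred.eq hS
      (Presheaf.val (P.ext.map (genericMember hR).op y))
      (Presheaf.val (P.ext.map (genericMember hR).op y')))).congr fun T t => ?_
    constructor
    · rintro ⟨u, rfl, hu⟩
      have h := hR.cod_eq _ _ ((mem_generic _).precomp u)
      refine ⟨by simpa using h, ?_⟩
      rw [eqSieve_apply]
      have hu' : SameAt (P.ext.map (genericMember hR).op y) u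
          (P.ext.map (genericMember hR).op y') u := by
        rw [sameAt_self_iff]
        apply Presheaf.val_injective
        simpa using hu
      have h₂ := hu'.map_eq (Y := ⟨T, ((u ≫ (maximalSieve C X.pt).arrow) ≫ prod.snd) ≫ C.dom⟩)
        (φ := Stage.rebase u (by simp)) (φ' := Stage.rebase u (by simp)) (𝟙 _) (by simp) (by simp)
        rfl
      rw [Stage.map_map, Stage.map_map] at h₂
      refine (Stage.map_congr ?_ ?_ y).trans (h₂.trans (Stage.map_congr ?_ ?_ y')) <;>
        simp [genericMember]
    · rintro ⟨h, hy⟩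
      obtain ⟨r, hr, hφ⟩ := exists_genericMember hR (φ := Stage.mkHom
        (Y := ⟨T, (t ≫ prod.snd) ≫ C.dom⟩) (t ≫ prod.fst) (t ≫ prod.snd) rfl h)
        (mem_maximalSieve.2 h)
      refine ⟨r, ?_, ?_⟩
      · have h₁ := congrArg Stage.Hom.map hφ
        have h₂ := congrArg Stage.Hom.arr hφ
        ext
        · simpa [genericMember] using h₁
        · simpa [genericMember] using h₂
      · rw [eqSieve_apply, ← hφ, ← Stage.map_map, ← Stage.map_map] at hy
        simpa using congrArg Presheaf.val hy
  refine (isSmallPred_pullback_mem hS hcod pres _ hσ).congr fun T t => ?_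
  rw [eqSieve_pullback, sameAt_self_iff]
  constructor
  · intro h
    rw [← e.map_app, ← e.map_app]
    refine eq_of_eqSieve_mem hS hcod hG (GrothendieckTopology.superset_covering _ ?_ h)
    intro Z φ hφ
    rw [eqSieve_apply] at hφ ⊢
    rw [← e.map_app, ← e.map_app, hφ]
  · intro h
    rw [← e.map_app, ← e.map_app] at h
    exact he _ _ h

/-- Equality in a sheaf is a small predicate on elements that come from `P` on small covering
sieves. -/
lemma isSmallPred_sameAt (pres : Presentation J)
    (hG : Presieve.IsSheaf (stageTopology J hS hcod) G) {e : P.ExtHom G}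
    (he : IsLocallyInjective (J := J) hS hcod e) {X : Stage C} {g g' : G.obj (op X)}
    (hg : IsPresented J e g) (hg' : IsPresented J e g') :
    IsSmallPred S (X := X.base) (fun _ t => SameAt g t g' t) := by
  obtain ⟨R, hR, hcov, x, hx⟩ := hg
  obtain ⟨R', hR', hcov', x', hx'⟩ := hg'
  let τ : Sieve X := (sieveOf hR ⊓ sieveOf hR') ⊓ eqSieve g g'
  have hτ : IsSmallPred S (X := X.base ⨯ C.C₁)
      (fun _ t => SieveMem τ (t ≫ prod.fst) (t ≫ prod.snd)) := by
    let D : Stage C := ⟨pullback R.arrow R'.arrow,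
      pullback.fst R.arrow R'.arrow ≫ (R.arrow ≫ prod.snd) ≫ C.dom⟩
    let ρ : D ⟶ ⟨(R : E), (R.arrow ≫ prod.snd) ≫ C.dom⟩ := Stage.rebase (pullback.fst _ _) rfl
    let ρ' : D ⟶ ⟨(R' : E), (R'.arrow ≫ prod.snd) ≫ C.dom⟩ := Stage.rebase (pullback.snd _ _) (by
      have := pullback.condition (f := R.arrow) (g := R'.arrow) =≫ (prod.snd ≫ C.dom)
      simpa [D] using this.symm)
    have hρ : ρ ≫ genericMember hR = ρ' ≫ genericMember hR' := by
      have h := pullback.condition (f := R.arrow) (g := R'.arrow)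
      ext
      · simpa [ρ, ρ', genericMember] using h =≫ prod.fst
      · simpa [ρ, ρ', genericMember] using h =≫ prod.snd
    have hD := isSmallPred_sameAt_app hS hcod pres hG he (P.ext.map ρ.op x) (P.ext.map ρ'.op x')
    rw [e.map_app, e.map_app, hx, hx', Stage.map_map, Stage.map_map, ← hρ] at hD
    have hs : S (pullback.fst R.arrow R'.arrow ≫ R.arrow) :=
      hS.composition (hS.fst_small _ _ (hR'.small_arrow hS)) (hR.small_arrow hS)
    refine (IsSmallPred.sigma hS _ hs hD).congr fun T t => ?_
    constructor
    · rintro ⟨u, rfl, hu⟩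
      have h₁ := (mem_generic R).precomp (u ≫ pullback.fst R.arrow R'.arrow)
      have h₂ := (mem_generic R').precomp (u ≫ pullback.snd R.arrow R'.arrow)
      have h₃ := pullback.condition (f := R.arrow) (g := R'.arrow)
      have h := hR.cod_eq _ _ h₁
      simp only [Category.assoc] at h h₁ h₂
      rw [← reassoc_of% h₃, ← reassoc_of% h₃] at h₂
      refine ⟨by simpa using h, ⟨?_, ?_⟩, ?_⟩
      · simpa using h₁
      · simpa using h₂
      · rw [eqSieve_apply]
        have h₄ := hu.map_eq (Y := ⟨T, ((u ≫ pullback.fst R.arrow R'.arrow ≫ R.arrow) ≫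
          prod.snd) ≫ C.dom⟩) (φ := Stage.rebase u (by simp [D])) (φ' := Stage.rebase u (by simp [D]))
          (𝟙 _) (by simp) (by simp) rfl
        rw [Stage.map_map, Stage.map_map] at h₄
        refine (Stage.map_congr ?_ ?_ g).trans (h₄.trans (Stage.map_congr ?_ ?_ g')) <;>
          simp [genericMember, ρ]
    · rintro ⟨h, ⟨h₁, h₂⟩, h₃⟩
      obtain ⟨r, hr, hφ⟩ := exists_genericMember hR h₁
      obtain ⟨r', hr', hφ'⟩ := exists_genericMember hR' h₂
      have e₁ : r ≫ R.arrow = t := by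
        have h₁ := congrArg Stage.Hom.map hφ
        have h₂ := congrArg Stage.Hom.arr hφ
        ext
        · simpa [genericMember] using h₁
        · simpa [genericMember] using h₂
      have e₂ : r' ≫ R'.arrow = t := by
        have h₁ := congrArg Stage.Hom.map hφ'
        have h₂ := congrArg Stage.Hom.arr hφ'
        ext
        · simpa [genericMember] using h₁
        · simpa [genericMember] using h₂
      refine ⟨pullback.lift r r' (by rw [e₁, e₂]), by simp [e₁], ?_⟩
      rw [sameAt_iff (Y := ⟨T, (t ≫ prod.snd) ≫ C.dom⟩) (by simpa [D] using hr)
        (by simpa [D] using hr), Stage.map_map, Stage.map_map]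
      rw [eqSieve_apply, ← hφ] at h₃
      refine (Stage.map_congr ?_ ?_ g).trans (h₃.trans (Stage.map_congr ?_ ?_ g')) <;>
        simp [genericMember, ρ]
  refine (isSmallPred_pullback_mem hS hcod pres _ hτ).congr fun T t => ?_
  rw [sameAt_self_iff]
  constructor
  · intro h
    refine eq_of_eqSieve_mem hS hcod hG (GrothendieckTopology.superset_covering _ ?_ h)
    rw [← eqSieve_pullback]
    exact Sieve.pullback_monotone _ inf_le_right
  · intro h
    simp only [τ, Sieve.pullback_inter, eqSieve_pullback, h]
    refine GrothendieckTopology.intersection_covering _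
      (GrothendieckTopology.intersection_covering _ ?_ ?_) ?_
    · exact GrothendieckTopology.pullback_stable _ _ ((sieveOf_mem_iff hS hcod hR).2 hcov)
    · exact GrothendieckTopology.pullback_stable _ _ ((sieveOf_mem_iff hS hcod hR').2 hcov')
    · rw [eqSieve_self]
      exact GrothendieckTopology.top_mem _ _

end

end

section

variable {E : Type u} [Category.{v} E] [PositiveHeyting E]
  {C : InternalCategory E} {S : MorphismProperty E} {J : Topology S C}

section

variable (hS : IsClassOfSmallMaps S) (hcod : S C.cod)

/-! ### Glueing along a single map of stages -/

/-- The sieve of maps that factor through `δ`. -/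
def factorSieve {D X : Stage C} (δ : D ⟶ X) : Sieve X where
  arrows _ φ := ∃ ψ, ψ ≫ δ = φ
  downward_closed := by
    rintro Y Z φ ⟨ψ, rfl⟩ χ
    exact ⟨χ ≫ ψ, by simp⟩

/-- When a single map `δ` generates a covering sieve, a compatible family on that sieve is one element
over the domain of `δ` that does not distinguish maps with the same composite with `δ`. -/
lemma exists_glueing {G : (Stage C)ᵒᵖ ⥤ Type w} {T : GrothendieckTopology (Stage C)}
    (hG : Presieve.IsSheaf T G) {D X : Stage C} (δ : D ⟶ X) (hδ : factorSieve δ ∈ T X)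
    (y : G.obj (op D)) (hy : ∀ {Y : Stage C} (ψ ψ' : Y ⟶ D), ψ ≫ δ = ψ' ≫ δ →
      G.map ψ.op y = G.map ψ'.op y) : ∃ g : G.obj (op X), G.map δ.op g = y := by
  have hfac {Y : Stage C} {φ : Y ⟶ X} (hφ : factorSieve δ φ) : ∃ ψ, ψ ≫ δ = φ := hφ
  choose fac hfac using @hfac
  let ξ : Presieve.FamilyOfElements G (factorSieve δ).arrows := fun Y φ hφ => G.map (fac hφ).op y
  have hξ : ξ.Compatible := by
    intro Y₁ Y₂ Z g₁ g₂ f₁ f₂ h₁ h₂ hc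
    simp only [ξ]
    rw [Stage.map_map, Stage.map_map]
    exact hy _ _ (by simp only [Category.assoc, hfac, hc])
  obtain ⟨g, hg, -⟩ := hG _ hδ ξ hξ
  have h : factorSieve δ δ := ⟨𝟙 _, by simp⟩
  refine ⟨g, (hg _ h).trans ((hy _ (𝟙 _) ?_).trans ?_)⟩
  · rw [hfac]; simp
  · simp

lemma eq_of_map_eq {G : (Stage C)ᵒᵖ ⥤ Type w} {T : GrothendieckTopology (Stage C)}
    (hG : Presieve.IsSheaf T G) {D X : Stage C} (δ : D ⟶ X) (hδ : factorSieve δ ∈ T X)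
    {g g' : G.obj (op X)} (h : G.map δ.op g = G.map δ.op g') : g = g' := by
  refine (hG _ hδ).isSeparatedFor.ext ?_
  rintro Y φ ⟨ψ, rfl⟩
  rw [← Stage.map_map, h, Stage.map_map]

/-! ### Basic covering families -/

namespace Presentation

variable (pres : Presentation J)

/-- The object of basic covering sieves with a member. -/
abbrev idx : (pres.BCov : E) ⟶ pres.B := pres.BCov.arrow ≫ prod.fst

/-- The member. -/
abbrev arr : (pres.BCov : E) ⟶ C.C₁ := pres.BCov.arrow ≫ prod.snd

lemma arr_cod : pres.arr ≫ C.cod = pres.idx ≫ pres.β :=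
  pres.isSieve.cod_eq _ _ (mem_generic _)

/-- The stage of the members of a family of basic covering sieves. -/
abbrev members {K : E} (a : K ⟶ pres.B) : Stage C :=
  ⟨pullback a pres.idx, (pullback.snd a pres.idx ≫ pres.arr) ≫ C.dom⟩

/-- The generic member of a family of basic covering sieves. -/
def member {X : Stage C} (a : X.base ⟶ pres.B) (h : a ≫ pres.β = X.pt) : pres.members a ⟶ X :=
  Stage.mkHom (pullback.fst a pres.idx) (pullback.snd a pres.idx ≫ pres.arr) rfl (by
    rw [Category.assoc, pres.arr_cod, ← Category.assoc, ← pullback.condition, Category.assoc, h])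

@[simp] lemma member_map {X : Stage C} (a : X.base ⟶ pres.B) (h : a ≫ pres.β = X.pt) :
    Stage.Hom.map (pres.member a h) = pullback.fst a pres.idx := rfl

@[simp] lemma member_arr {X : Stage C} (a : X.base ⟶ pres.B) (h : a ≫ pres.β = X.pt) :
    Stage.Hom.arr (pres.member a h) = pullback.snd a pres.idx ≫ pres.arr := rfl

lemma cov_BCov : J.Cov pres.β pres.BCov :=
  (pres.cov_iff _ _ pres.isSieve).2 ⟨_, 𝟙 _, 𝟙 _, inferInstance, by simp, le_rfl⟩

lemma idx_arr_hom_ext {Y : E} {ρ ρ' : Y ⟶ (pres.BCov : E)} (h : ρ ≫ pres.idx = ρ' ≫ pres.idx)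
    (h' : ρ ≫ pres.arr = ρ' ≫ pres.arr) : ρ = ρ' := by
  rw [← cancel_mono pres.BCov.arrow]
  ext
  · simpa using h
  · simpa using h'

/-- Basic covering sieves are closed under precomposition. -/
lemma exists_mul {Y : E} (ρ : Y ⟶ (pres.BCov : E)) (g : Y ⟶ C.C₁)
    (h : (ρ ≫ pres.arr) ≫ C.dom = g ≫ C.cod) :
    ∃ ρ' : Y ⟶ (pres.BCov : E), ρ' ≫ pres.idx = ρ ≫ pres.idx ∧
      ρ' ≫ pres.arr = C.mul (ρ ≫ pres.arr) g h :=
  mem_iff.1 (pres.isSieve.closed _ _ g h (mem_iff.2 ⟨ρ, rfl, rfl⟩))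

/-- A family of basic covering sieves is covering. -/
lemma cov_reindex_BCov {X : Stage C} (a : X.base ⟶ pres.B) (h : a ≫ pres.β = X.pt) :
    J.Cov X.pt (reindex a pres.BCov) := by
  have h₁ := Topology.cov_reindex pres.cov_BCov a
  rwa [h] at h₁

lemma sieveOf_le_factorSieve {X : Stage C} (a : X.base ⟶ pres.B) (h : a ≫ pres.β = X.pt) :
    sieveOf (J.isSieve _ _ (pres.cov_reindex_BCov a h)) ≤ factorSieve (pres.member a h) := by
  intro Y φ hφ
  obtain ⟨ρ, hρ₁, hρ₂⟩ := mem_iff.1 (mem_reindex.1 hφ)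
  have h₂ : Stage.Hom.map φ ≫ a = ρ ≫ pres.idx := hρ₁.symm
  refine ⟨Stage.rebase (pullback.lift (Stage.Hom.map φ) ρ h₂) ?_, ?_⟩
  · rw [← φ.arr_dom]
    have : ρ ≫ pres.arr = φ.arr := hρ₂
    rw [← this]
    simp
  · ext
    · simp
    · simpa using hρ₂

/-- The generic member of a family of basic covering sieves generates a covering sieve, so that
elements of a sheaf can be glued along this single map. -/
lemma factorSieve_member {X : Stage C} (a : X.base ⟶ pres.B) (h : a ≫ pres.β = X.pt) :
    factorSieve (pres.member a h) ∈ stageTopology J hS hcod X :=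
  GrothendieckTopology.superset_covering _ (pres.sieveOf_le_factorSieve a h)
    ((sieveOf_mem_iff hS hcod _).2 (pres.cov_reindex_BCov a h))

/-- Covering sieves of stages contain, locally, the members of a basic covering sieve. -/
lemma exists_member {X : Stage C} {σ : Sieve X} (hσ : σ ∈ stageTopology J hS hcod X) :
    ∃ (X' : E) (p : X' ⟶ X.base) (b : X' ⟶ pres.B) (h : b ≫ pres.β = p ≫ X.pt), ExtremalEpi p ∧
      ∃ (D : E) (q : D ⟶ pullback b pres.idx), ExtremalEpi q ∧
        σ (Stage.rebase (Y := ⟨D, q ≫ (pres.members b).pt⟩) q rfl ≫ pres.member b h ≫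
          Stage.rebase (Y := ⟨X', p ≫ X.pt⟩) p rfl) := by
  obtain ⟨X', p, R, hp, hR, H⟩ := hσ
  obtain ⟨X'', p', b, hp', hb, hle⟩ := (pres.cov_iff _ _ (J.isSieve _ _ hR)).1 hR
  have hm : Mem (reindex b pres.BCov) (pullback.fst b pres.idx)
      (pullback.snd b pres.idx ≫ pres.arr) :=
    mem_reindex.2 (mem_iff.2 ⟨pullback.snd _ _, pullback.condition.symm, rfl⟩)
  obtain ⟨D, q, hq, hD⟩ := H _ _ (mem_reindex.1 (le_iff_mem.1 hle _ _ hm))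
  refine ⟨X'', p' ≫ p, b, by rw [hb, Category.assoc], cover_comp hp' hp, D, q, hq,
    sieve_of_sieveMem hD ?_ ?_⟩
  · simp
  · rw [Stage.rebase_comp_arr, Stage.comp_rebase_arr, member_arr]

end Presentation

end

end

section

variable {E : Type u} [Category.{v} E] [PositiveHeyting E]
  {C : InternalCategory E} {S : MorphismProperty E} {J : Topology S C}

section

/-! ### Images of internal presheaves -/

/-- To see that the equality relation of an element `u` over `V` is small on all pairs of points of
`V`, it is enough to consider pairs that lie over the same object of `C`, since these form a small
subobject. -/
lemma isSmallPred_sameAt_pair {G : (Stage C)ᵒᵖ ⥤ Type w} (hS : IsClassOfSmallMaps S)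
    (V : Stage C) (u : G.obj (op V))
    (H : ∀ (X : Stage C) (t t' : X.base ⟶ V.base) (h : t ≫ V.pt = X.pt) (h' : t' ≫ V.pt = X.pt),
      IsSmallPred S (X := X.base) (fun _ s => SameAt (G.map (Stage.rebase t h).op u) s
        (G.map (Stage.rebase t' h').op u) s)) :
    IsSmallPred S (X := V.base ⨯ V.base) (fun _ t =>
      SameAt u (t ≫ prod.fst) u (t ≫ prod.snd)) := by
  let f : V.base ⨯ V.base ⟶ C.C₀ := prod.fst ≫ V.pt
  let g : V.base ⨯ V.base ⟶ C.C₀ := prod.snd ≫ V.pt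
  have h := H ⟨equalizer f g, equalizer.ι f g ≫ f⟩ (equalizer.ι f g ≫ prod.fst)
    (equalizer.ι f g ≫ prod.snd) (by simp [f]) (by simp [equalizer.condition f g, g])
  refine (IsSmallPred.sigma hS _ (hS.equalizer_small f g) h).congr fun T t => ?_
  constructor
  · rintro ⟨u, rfl, hu⟩
    exact (SameAt.of_map _ _ _ (by simp) _).symm.trans (hu.trans (SameAt.of_map _ _ _ (by simp) _))
  · intro h
    refine ⟨equalizer.lift t (by simpa [f, g] using h.1.symm), by simp, ?_⟩
    exact (SameAt.of_map _ _ _ (by simp) _).trans (h.trans (SameAt.of_map _ _ _ (by simp) _).symm)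

/-- Every element is a reindexing of the generic one, and so is its image. -/
lemma Presheaf.ExtHom.sameAt_gen {P : Presheaf C} {G : (Stage C)ᵒᵖ ⥤ Type w} (e : P.ExtHom G)
    {X : Stage C} (x : P.ext.obj (op X)) : SameAt (e.app P.gen) (Presheaf.val x) (e.app x) (𝟙 _) := by
  have : e.app x = G.map (Stage.rebase (X := P.stage) (Presheaf.val x) (Presheaf.val_proj x)).op
      (e.app P.gen) := by rw [← e.map_app, Presheaf.map_gen]
  rw [this]
  exact (SameAt.of_map _ _ _ (by simp) _).symm

/-- The elements of `G` that are, on a cover of the base, in the image of `e`. -/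
def coverImage {P : Presheaf C} {G : (Stage C)ᵒᵖ ⥤ Type w} (e : P.ExtHom G) : Subfunctor G where
  obj X := {g | ∃ (X' : E) (q : X' ⟶ X.unop.base) (x : X' ⟶ P.obj), ExtremalEpi q ∧
    SameAt (V := P.stage) (V' := X.unop) (e.app P.gen) x g q}
  map := by
    rintro ⟨X⟩ ⟨Y⟩ ⟨φ⟩ g ⟨X', q, x, hq, h⟩
    dsimp at φ q g h
    obtain ⟨Y', r, t, hr, ht⟩ := exists_lift_of_cover hq (Stage.Hom.map φ)
    have h' := h.precomp t
    rw [ht] at h'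
    let φ' : (⟨Y', r ≫ Y.pt⟩ : Stage C) ⟶ ⟨Y', t ≫ q ≫ X.pt⟩ :=
      Stage.mkHom (𝟙 _) (r ≫ Stage.Hom.arr φ) (by simp) (by
        rw [Category.assoc, φ.arr_cod, ← Category.assoc, ← Category.assoc t, ht]; simp)
    let χ : (⟨Y', t ≫ q ≫ X.pt⟩ : Stage C) ⟶ P.stage := Stage.rebase (t ≫ x) (by
      have := h'.1
      dsimp at this
      rw [← this, ← ht, Category.assoc])
    refine ⟨Y', r, Presheaf.val (P.ext.map (φ' ≫ χ).op P.gen), hr, ?_⟩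
    refine (e.sameAt_gen _).trans ?_
    have e₁ : e.app (P.ext.map (φ' ≫ χ).op P.gen) =
        G.map (Stage.rebase (Y := ⟨Y', r ≫ Y.pt⟩) r rfl ≫ φ).op g := by
      rw [e.map_app]
      exact h'.map_eq (𝟙 _) (by simp [φ', χ]) (by simp) (by simp [φ', χ])
    rw [e₁, ← Stage.map_map]
    exact SameAt.of_map _ _ _ (by simp) _

lemma sameAt_subfunctor {G : (Stage C)ᵒᵖ ⥤ Type w} (A : Subfunctor G) {V V' : Stage C}
    {u : A.toFunctor.obj (op V)} {u' : A.toFunctor.obj (op V')} {T : E} {t : T ⟶ V.base}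
    {t' : T ⟶ V'.base} : SameAt u t u' t' ↔ SameAt u.1 t u'.1 t' :=
  exists_congr fun _ => Subtype.ext_iff

lemma isCoverSheaf_coverImage {P : Presheaf C} {G : (Stage C)ᵒᵖ ⥤ Type w} (e : P.ExtHom G)
    (hG : IsCoverSheaf G) : IsCoverSheaf (coverImage e).toFunctor where
  sep {X X' q} hq g g' h := Subtype.ext (hG.sep hq ((sameAt_subfunctor _).1 h))
  glue {X X' q} hq g hg := by
    obtain ⟨g₀, hg₀⟩ := hG.glue hq g.1 fun t t' h => (sameAt_subfunctor _).1 (hg t t' h)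
    obtain ⟨X'', r, x, hr, hx⟩ := g.2
    refine ⟨⟨g₀, X'', r ≫ q, x, cover_comp hr hq, hx.trans ?_⟩, (sameAt_subfunctor _).2 hg₀⟩
    simpa using (hg₀.precomp r).symm

/-- The image of a presheaf in a cover sheaf is an internal presheaf if equality is small. -/
lemma exists_image_presheaf (hP : IsPredicative S) {P : Presheaf C} {G : (Stage C)ᵒᵖ ⥤ Type w}
    (e : P.ExtHom G) (hG : IsCoverSheaf G)
    (hsmall : IsSmallPred S (X := P.obj ⨯ P.obj) (fun _ t =>
      SameAt (e.app P.gen) (t ≫ prod.fst) (e.app P.gen) (t ≫ prod.snd))) :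
    ∃ (Q : Presheaf C) (e' : Q.ExtHom G), (∀ X, Function.Injective (e'.app (X := X))) ∧
      ∀ {X : Stage C} (g : G.obj (op X)), (∃ x, e'.app x = g) ↔
        ∃ (X' : E) (q : X' ⟶ X.base) (x : X' ⟶ P.obj), ExtremalEpi q ∧
          SameAt (e.app P.gen) x g q := by
  let u : (coverImage e).toFunctor.obj (op P.stage) :=
    ⟨e.app P.gen, _, 𝟙 P.obj, 𝟙 P.obj, inferInstance, .refl _ _⟩
  obtain ⟨Q, e', he'⟩ := exists_presheaf_of_chart hP (isCoverSheaf_coverImage e hG) P.stage u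
    (hsmall.congr fun T t => (sameAt_subfunctor (coverImage e) (u := u) (u' := u)).symm)
    (fun X g => by
      obtain ⟨X', q, x, hq, h⟩ := g.2
      exact ⟨X', q, x, hq, (sameAt_subfunctor _).2 h⟩)
  refine ⟨Q, ⟨fun x => (e'.app x).1, fun φ x => congrArg Subtype.val (e'.map_app φ x)⟩,
    fun X x y h => (he' X).1 (Subtype.ext h), fun {X} g => ?_⟩
  constructor
  · rintro ⟨x, rfl⟩
    exact (e'.app x).2
  · intro h
    obtain ⟨x, hx⟩ := (he' X).2 ⟨g, h⟩
    exact ⟨x, congrArg Subtype.val hx⟩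

end

/-! ### Exponentials -/

/-- For an exponentiable map `r : R ⟶ B` there is an object `K` over `B` of families of elements of
`Z` indexed by the fibres of `r`, with an evaluation map: each family over `b : T ⟶ B` is classified
by a map `T ⟶ K` over `B`. -/
lemma exists_exponential {R B : E} (r : R ⟶ B) [(Over.pullback r).IsLeftAdjoint] (Z : E) :
    ∃ (K : E) (k : K ⟶ B) (ev : pullback k r ⟶ Z), ∀ {T : E} (b : T ⟶ B) (x : pullback b r ⟶ Z),
      ∃ (t : T ⟶ K) (h : t ≫ k = b), pullback.lift (pullback.fst b r ≫ t) (pullback.snd b r)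
        (by rw [Category.assoc, h, pullback.condition]) ≫ ev = x := by
  let F := Over.pullback r
  let U := F.rightAdjoint
  let adj : F ⊣ U := Adjunction.ofIsLeftAdjoint F
  let A : Over R := Over.mk (prod.snd : Z ⨯ R ⟶ R)
  refine ⟨(U.obj A).left, (U.obj A).hom, (adj.counit.app A).left ≫ prod.fst, fun {T} b x => ?_⟩
  let y : F.obj (Over.mk b) ⟶ A := Over.homMk (prod.lift x (pullback.snd b r)) (by simp [A, F])
  let t := adj.homEquiv _ _ y
  have ht : F.map t ≫ adj.counit.app A = y :=
    (adj.homEquiv_counit _ _ _).symm.trans ((adj.homEquiv _ _).symm_apply_apply y)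
  refine ⟨t.left, Over.w t, ?_⟩
  have h := congrArg (fun z => z.left ≫ prod.fst) ht
  simp only [y, Over.homMk_left, prod.lift_fst, Over.comp_left, Category.assoc] at h
  exact (Category.assoc _ _ _).symm.trans ((Category.assoc _ _ _).trans h)

end

section

variable {E : Type u} [Category.{v} E] [PositiveHeyting E]
  {C : InternalCategory E} {S : MorphismProperty E} {J : Topology S C}

/-! ### Representing a sheaf by matching families -/

namespace Presentation

variable (pres : Presentation J)

/-- Reindexing of the stages of members. -/
def membersMap {K K' : E} (a : K ⟶ pres.B) (a' : K' ⟶ pres.B) (u : K ⟶ K') (h : u ≫ a' = a) :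
    pres.members a ⟶ pres.members a' :=
  Stage.rebase (pullback.lift (pullback.fst a pres.idx ≫ u) (pullback.snd a pres.idx)
    (by rw [Category.assoc, h, pullback.condition])) (by simp)

@[simp] lemma membersMap_map {K K' : E} (a : K ⟶ pres.B) (a' : K' ⟶ pres.B) (u : K ⟶ K')
    (h : u ≫ a' = a) : Stage.Hom.map (pres.membersMap a a' u h) =
      pullback.lift (pullback.fst a pres.idx ≫ u) (pullback.snd a pres.idx)
        (by rw [Category.assoc, h, pullback.condition]) := rfl

lemma membersMap_comp_arr {K K' : E} (a : K ⟶ pres.B) (a' : K' ⟶ pres.B) (u : K ⟶ K')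
    (h : u ≫ a' = a) {Y : Stage C} (φ : Y ⟶ pres.members a) :
    Stage.Hom.arr (φ ≫ pres.membersMap a a' u h) = Stage.Hom.arr φ :=
  Stage.comp_rebase_arr _ _ _

lemma membersMap_member {X X' : Stage C} (a : X.base ⟶ pres.B) (a' : X'.base ⟶ pres.B)
    (h : a ≫ pres.β = X.pt) (h' : a' ≫ pres.β = X'.pt) (u : X.base ⟶ X'.base) (hu : u ≫ a' = a) :
    pres.membersMap a a' u hu ≫ pres.member a' h' =
      pres.member a h ≫ Stage.rebase u (by rw [← h', ← Category.assoc, hu, h]) := by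
  ext
  · simp
  · rw [Stage.comp_rebase_arr, membersMap, Stage.rebase_comp_arr]
    simp

end Presentation

section

variable (hS : IsClassOfSmallMaps S) (hcod : S C.cod)

include hS hcod in
/-- Let `e : Q ⟶ G` be an injective map from an internal presheaf to a sheaf. There is one element `u`
of `G`, over an object `K` of matching families of elements of `Q` on basic covering sieves, such
that every element of `G` that is described by elements of `Q` on a basic covering sieve is a
reindexing of `u`. The object `K` is cut out of an exponential along the small map
`pres.BCov ⟶ pres.B`, and `u` is the glueing of the generic matching family. -/
lemma exists_matching_families (hP : IsPredicative S) (pres : Presentation J)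
    {G : (Stage C)ᵒᵖ ⥤ Type w} (hG : Presieve.IsSheaf (stageTopology J hS hcod) G)
    {Q : Presheaf C} (e : Q.ExtHom G) (he : ∀ X, Function.Injective (e.app (X := X))) :
    ∃ (K : E) (k : K ⟶ pres.B) (x : Q.ext.obj (op (pres.members k)))
      (u : G.obj (op (⟨K, k ≫ pres.β⟩ : Stage C))),
      G.map (pres.member (X := ⟨K, k ≫ pres.β⟩) k rfl).op u = e.app x ∧
      ∀ {X : Stage C} (b : X.base ⟶ pres.B) (h : b ≫ pres.β = X.pt) (g : G.obj (op X))
        (y : Q.ext.obj (op (pres.members b))), G.map (pres.member b h).op g = e.app y →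
        ∃ t : X.base ⟶ K, SameAt u t g (𝟙 _) := by
  have := hP.exponentiable pres.idx pres.isSieve.small
  obtain ⟨K, k, ev, hK⟩ := exists_exponential pres.idx Q.obj
  -- the families of elements over the domains of the members; no smallness of the objects of such
  -- families is needed, so the universal quantification is taken with respect to the class of all maps
  obtain ⟨N, n, hn, -, hN⟩ := (IsSmallPred.eq (isClassOfSmallMaps_top (E := E)) (ev ≫ Q.proj)
    ((pullback.snd k pres.idx ≫ pres.arr) ≫ C.dom)).all isClassOfSmallMaps_top
    (pullback.fst k pres.idx) trivial
  let c : pullback (n ≫ k) pres.idx ⟶ pullback k pres.idx :=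
    pullback.lift (pullback.fst _ _ ≫ n) (pullback.snd _ _)
      (by rw [Category.assoc, pullback.condition])
  let x : Q.ext.obj (op (pres.members (n ≫ k))) := Q.el (c ≫ ev) (by
    have := (hN n).1 ⟨𝟙 _, by simp⟩ _ (pullback.fst _ _) c (by simp [c])
    simpa [c] using this)
  -- the compatible families
  let A : Stage C := ⟨pullback (pres.members (n ≫ k)).pt C.cod, pullback.snd _ _ ≫ C.dom⟩
  obtain ⟨ρ, hρ₁, hρ₂⟩ := pres.exists_mul (Y := A.base)
    (pullback.fst _ _ ≫ pullback.snd (n ≫ k) pres.idx) (pullback.snd _ _)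
    (by rw [← pullback.condition]; simp)
  let φ₁ : A ⟶ pres.members (n ≫ k) := Stage.rebase
    (pullback.lift (pullback.fst _ _ ≫ pullback.fst (n ≫ k) pres.idx) ρ (by
      rw [hρ₁, Category.assoc, Category.assoc, pullback.condition]))
    (by
      have h := hρ₂ =≫ C.dom
      rw [mul_dom] at h
      simpa [A] using h)
  let φ₂ : A ⟶ pres.members (n ≫ k) :=
    Stage.mkHom (pullback.fst _ _) (pullback.snd _ _) rfl pullback.condition.symm
  obtain ⟨M, m, hm, -, hM⟩ := (IsSmallPred.eq (isClassOfSmallMaps_top (E := E))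
    (Presheaf.val (Q.ext.map φ₁.op x)) (Presheaf.val (Q.ext.map φ₂.op x))).all
    isClassOfSmallMaps_top (pullback.fst (pres.members (n ≫ k)).pt C.cod ≫
      pullback.fst (n ≫ k) pres.idx) trivial
  let a : M ⟶ pres.B := m ≫ n ≫ k
  let X₀ : Stage C := ⟨M, a ≫ pres.β⟩
  let μ : pres.members a ⟶ pres.members (n ≫ k) := pres.membersMap _ _ m rfl
  obtain ⟨u, hu⟩ := exists_glueing hG (pres.member (X := X₀) a rfl)
    (pres.factorSieve_member hS hcod (X := X₀) a rfl) (e.app (Q.ext.map μ.op x)) (by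
      intro Y ψ ψ' hψ
      rw [← e.map_app, ← e.map_app]
      congr 1
      rw [Stage.map_map, Stage.map_map]
      -- an element over a member is determined by the element over the composite arrow
      have key (χ : Y ⟶ pres.members a) : ∃ (v : Y.base ⟶ A.base) (hv : v ≫ A.pt = Y.pt),
          v ≫ pullback.fst _ _ = Stage.Hom.map (χ ≫ μ) ∧ v ≫ pullback.snd _ _ = Stage.Hom.arr χ ∧
          Q.ext.map (χ ≫ μ).op x = Q.ext.map (Stage.rebase v hv ≫ φ₁).op x := by
        have hv : Stage.Hom.map (χ ≫ μ) ≫ (pres.members (n ≫ k)).pt = Stage.Hom.arr χ ≫ C.cod := by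
          rw [← (χ ≫ μ).arr_cod]
          exact congrArg (· ≫ C.cod) (pres.membersMap_comp_arr _ _ _ _ _)
        have hvA : pullback.lift _ _ hv ≫ A.pt = Y.pt := by
          simp only [A, pullback.lift_snd_assoc]
          exact χ.arr_dom
        refine ⟨pullback.lift _ _ hv, hvA, by simp, by simp, ?_⟩
        have h₁ := (hM m).1 ⟨𝟙 _, by simp⟩ _ (Stage.Hom.map χ ≫ pullback.fst _ _)
          (pullback.lift _ _ hv) (by simp [μ])
        have h₂ : χ ≫ μ = Stage.rebase (pullback.lift _ _ hv) hvA ≫ φ₂ := by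
          refine Stage.hom_ext ?_ ?_
          · simp [φ₂]
          · rw [Stage.rebase_comp_arr]
            simpa [φ₂] using pres.membersMap_comp_arr _ _ _ _ _
        refine (congrArg (fun φ => Q.ext.map (Quiver.Hom.op φ) x) h₂).trans ?_
        rw [← Stage.map_map, ← Stage.map_map φ₁]
        apply Presheaf.val_injective
        rw [Presheaf.val_map_rebase, Presheaf.val_map_rebase]
        exact h₁.symm
      obtain ⟨v, hv, hv₁, hv₂, hv₃⟩ := key ψ
      obtain ⟨v', hv', hv₁', hv₂', hv₃'⟩ := key ψ'
      rw [hv₃, hv₃']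
      have e₁ := congrArg Stage.Hom.map hψ
      have e₂ := congrArg Stage.Hom.arr hψ
      simp only [Stage.comp_map, Presentation.member_map] at e₁
      simp only [Stage.comp_arr, Presentation.member_arr] at e₂
      have h₁ : v ≫ pullback.fst _ _ ≫ pullback.snd _ _ = Stage.Hom.map ψ ≫ pullback.snd _ _ := by
        rw [← Category.assoc, hv₁]; simp [μ]
      have h₁' : v' ≫ pullback.fst _ _ ≫ pullback.snd _ _ = Stage.Hom.map ψ' ≫ pullback.snd _ _ := by
        rw [← Category.assoc, hv₁']; simp [μ]
      have h₂ : v ≫ pullback.fst _ _ ≫ pullback.fst _ _ = v' ≫ pullback.fst _ _ ≫ pullback.fst _ _ := by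
        rw [← Category.assoc, hv₁, ← Category.assoc, hv₁']
        simp [μ, reassoc_of% e₁]
      have h₃ : v ≫ ρ = v' ≫ ρ := by
        refine pres.idx_arr_hom_ext ?_ ?_
        · rw [Category.assoc, Category.assoc, hρ₁]
          have := h₂ =≫ (n ≫ k)
          simpa [pullback.condition] using this
        · rw [Category.assoc, Category.assoc, hρ₂, precomp_mul, precomp_mul]
          simp only [hv₂, hv₂', Category.assoc, reassoc_of% h₁, reassoc_of% h₁']
          simpa using e₂
      refine Stage.map_congr ?_ ?_ x
      · apply pullback.hom_ext
        · simpa [φ₁] using h₂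
        · simpa [φ₁] using h₃
      · simp [φ₁])
  -- a description `y` of `g` is classified by a map `t` into the exponential, which lifts first to the
  -- families over the domains of the members, and then to the compatible ones
  refine ⟨M, a, Q.ext.map μ.op x, u, hu, fun {X} b h g y hy => ?_⟩
  obtain ⟨t, ht, hty⟩ := hK b (Presheaf.val y)
  obtain ⟨t₁, ht₁⟩ := (hN t).2 (by
    intro T' s w hw
    have h₁ : w = pullback.lift s (w ≫ pullback.snd _ _) (by
        rw [Category.assoc, ← pullback.condition, ← Category.assoc, hw, Category.assoc, ht]) ≫
        pullback.lift (pullback.fst b pres.idx ≫ t) (pullback.snd b pres.idx)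
          (by rw [Category.assoc, ht, pullback.condition]) := by
      apply pullback.hom_ext
      · simp [hw]
      · simp
    conv_lhs => rw [h₁]
    rw [Category.assoc, reassoc_of% hty, Presheaf.val_proj]
    simp)
  have ht' : t₁ ≫ n ≫ k = b := by rw [← Category.assoc, ht₁, ht]
  have hτ : Q.ext.map (pres.membersMap b (n ≫ k) t₁ ht').op x = y := by
    apply Presheaf.val_injective
    rw [← hty]
    refine (Presheaf.val_map_rebase _ _ _).trans ?_
    simp only [x, Presheaf.val_el, ← Category.assoc]
    congr 1
    apply pullback.hom_ext <;> simp [c, ht₁]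
  obtain ⟨t₂, ht₂⟩ := (hM t₁).2 (by
    intro T' s w hw
    let Z : Stage C := ⟨T', w ≫ A.pt⟩
    have hs₁ : s ≫ b = (w ≫ pullback.fst _ _ ≫ pullback.snd _ _) ≫ pres.idx := by
      rw [← ht', ← reassoc_of% hw]; simp [pullback.condition]
    let ψ₁ : Z ⟶ pres.members b := Stage.rebase (pullback.lift s (w ≫ ρ) (by
      rw [hs₁, Category.assoc w ρ, hρ₁]; simp)) (by
        have h := w ≫= hρ₂ =≫ C.dom
        rw [mul_dom] at h
        simpa [Z, A] using h)
    let ψ₂ : Z ⟶ pres.members b := Stage.mkHom (pullback.lift s _ hs₁)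
      (w ≫ pullback.snd _ _) (by simp [Z, A]) (by simp [← pullback.condition])
    have e₁ : ψ₁ ≫ pres.membersMap b (n ≫ k) t₁ ht' = Stage.rebase w rfl ≫ φ₁ := by
      refine Stage.hom_ext ?_ ?_
      · apply pullback.hom_ext
        · simpa [ψ₁, φ₁] using hw.symm
        · simp [ψ₁, φ₁]
      · rw [pres.membersMap_comp_arr]
        simp [ψ₁, φ₁, Z]
    have e₂ : ψ₂ ≫ pres.membersMap b (n ≫ k) t₁ ht' = Stage.rebase w rfl ≫ φ₂ := by
      refine Stage.hom_ext ?_ ?_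
      · apply pullback.hom_ext
        · simpa [ψ₂, φ₂] using hw.symm
        · simp [ψ₂, φ₂]
      · rw [pres.membersMap_comp_arr]
        simp [ψ₂, φ₂]
    have e₃ : ψ₁ ≫ pres.member b h = ψ₂ ≫ pres.member b h := by
      ext
      · simp [ψ₁, ψ₂]
      · rw [Stage.rebase_comp_arr, Stage.comp_arr]
        simp only [Presentation.member_arr, pullback.lift_snd_assoc]
        rw [Category.assoc, hρ₂, precomp_mul]
        simp [ψ₂]
    have e₄ : Q.ext.map (Stage.rebase (Y := Z) w rfl ≫ φ₁).op x =
        Q.ext.map (Stage.rebase (Y := Z) w rfl ≫ φ₂).op x := by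
      rw [← e₁, ← e₂, ← Stage.map_map, ← Stage.map_map _ ψ₂, hτ]
      apply he
      rw [e.map_app, e.map_app, ← hy, Stage.map_map, Stage.map_map, e₃]
    rw [← Stage.map_map, ← Stage.map_map φ₂] at e₄
    simpa using congrArg Presheaf.val e₄)
  refine ⟨t₂, ?_⟩
  have ht₃ : t₂ ≫ a = b := by rw [← ht', ← ht₂, Category.assoc]
  have h₁ : t₂ ≫ X₀.pt = X.pt := by simp only [X₀]; rw [← Category.assoc, ht₃, h]
  have h₂ : G.map (Stage.rebase t₂ h₁).op u = g := by
    refine eq_of_map_eq hG _ (pres.factorSieve_member hS hcod b h) ?_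
    rw [Stage.map_map, ← pres.membersMap_member b a h (X' := X₀) rfl t₂ ht₃, ← Stage.map_map, hu,
      ← e.map_app, hy, ← hτ, Stage.map_map]
    congr 1
    refine Stage.map_congr ?_ ?_ x
    · apply pullback.hom_ext <;> simp [μ, ht₂]
    · refine (pres.membersMap_comp_arr _ _ _ _ _).trans ?_
      simp [Presentation.membersMap]
  rw [← h₂]
  exact (SameAt.of_map _ _ _ (by simp) _).symm

end

end

section

variable {E : Type u} [Category.{v} E] [PositiveHeyting E]
  {C : InternalCategory E} {S : MorphismProperty E} {J : Topology S C}

/-! ### Sheafification -/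

namespace Presheaf

/-- A map of presheaves, as a natural family of maps on elements. -/
def toExt {P Q : Presheaf C} (F : P ⟶ Q) : P.ExtHom Q.ext where
  app x := (extMap F).app _ x
  map_app φ x := extMap_map F φ x

@[simp] lemma val_toExt {P Q : Presheaf C} (F : P ⟶ Q) {X : Stage C} (x : P.ext.obj (op X)) :
    val ((toExt F).app x) = val x ≫ Hom.hom F := rfl

lemma toExt_comp {P Q R : Presheaf C} (F : P ⟶ Q) (G : Q ⟶ R) {X : Stage C}
    (x : P.ext.obj (op X)) : (toExt (F ≫ G)).app x = (toExt G).app ((toExt F).app x) :=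
  val_injective (by simp)

lemma hom_ext_app {P Q : Presheaf C} {F G : P ⟶ Q}
    (h : ∀ {X : Stage C} (x : P.ext.obj (op X)), (toExt F).app x = (toExt G).app x) : F = G := by
  have := congrArg val (h P.gen)
  simp only [val_toExt, gen, val_el] at this
  ext
  exact (Category.id_comp _).symm.trans (this.trans (Category.id_comp _))

lemma toExt_homOfExt {P Q : Presheaf C} (α : P.ExtHom Q.ext) {X : Stage C}
    (x : P.ext.obj (op X)) : (toExt (homOfExt α)).app x = α.app x := homOfExt_app α x

end Presheaf

section

variable (hS : IsClassOfSmallMaps S) (hcod : S C.cod)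

/-- The sheaf condition is invariant under isomorphism. The presheaves may take values in different
universes. -/
lemma isSheaf_of_bijective {T : GrothendieckTopology (Stage C)} {G : (Stage C)ᵒᵖ ⥤ Type w}
    (hG : Presieve.IsSheaf T G) {Q : Presheaf C} (e : Q.ExtHom G)
    (he : ∀ X, Function.Bijective (e.app (X := X))) : Presieve.IsSheaf T Q.ext := by
  intro X σ hσ ξ hξ
  obtain ⟨g, hg, hg'⟩ := hG σ hσ (fun Y φ hφ => e.app (ξ φ hφ)) (fun Y₁ Y₂ Z g₁ g₂ f₁ f₂ h₁ h₂ hc => by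
    rw [← e.map_app, ← e.map_app, hξ g₁ g₂ h₁ h₂ hc])
  obtain ⟨x, rfl⟩ := (he X).2 g
  refine ⟨x, fun Y φ hφ => (he Y).1 (by rw [e.map_app, hg φ hφ]), fun y hy => (he X).1 ?_⟩
  exact hg' _ fun Y φ hφ => by rw [← e.map_app, hy φ hφ]

/-- A sheaf on the category of stages that is locally isomorphic to an internal presheaf is itself
represented by an internal presheaf. -/
lemma exists_presheaf_of_locallyBijective (hP : IsPredicative S) (pres : Presentation J)
    {G : (Stage C)ᵒᵖ ⥤ Type w} (hG : Presieve.IsSheaf (stageTopology J hS hcod) G)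
    {P : Presheaf C} (e : P.ExtHom G) (he : IsLocallyInjective (J := J) hS hcod e)
    (he' : IsLocallySurjective (J := J) hS hcod e) :
    ∃ (Q : Presheaf C) (e' : Q.ExtHom G), ∀ X, Function.Bijective (e'.app (X := X)) := by
  have hGc := isCoverSheaf_of_isSheaf hS hcod hG
  -- the image of `P`
  obtain ⟨Q, i, hi, hiQ⟩ := exists_image_presheaf hP e hGc (isSmallPred_sameAt_pair hS P.stage _
    fun X t t' h h' => by
      rw [← e.map_app, ← e.map_app]
      exact isSmallPred_sameAt_app hS hcod pres hG he _ _)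
  have hiP {X : Stage C} (x : P.ext.obj (op X)) : ∃ y, i.app y = e.app x :=
    (hiQ _).2 ⟨X.base, 𝟙 _, Presheaf.val x, inferInstance, e.sameAt_gen x⟩
  have hi' : IsLocallyInjective (J := J) hS hcod i := fun x y h => by
    rw [hi _ h, eqSieve_self]
    exact GrothendieckTopology.top_mem _ _
  -- every element is given on the members of a basic covering sieve by elements of the image
  have hpres {X : Stage C} (g : G.obj (op X)) : ∃ (X' : E) (p : X' ⟶ X.base) (b : X' ⟶ pres.B)
      (h : b ≫ pres.β = p ≫ X.pt), ExtremalEpi p ∧ ∃ y, i.app y =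
        G.map (pres.member (X := ⟨X', p ≫ X.pt⟩) b h).op
          (G.map (Stage.rebase (Y := ⟨X', p ≫ X.pt⟩) p rfl).op g) := by
    obtain ⟨X', p, b, h, hp, D, q, hq, x, hx⟩ := pres.exists_member hS hcod (he' g)
    refine ⟨X', p, b, h, hp, (hiQ _).2 ⟨D, q, Presheaf.val x, hq, ?_⟩⟩
    refine (e.sameAt_gen x).trans ?_
    rw [hx, ← Stage.map_map, ← Stage.map_map]
    exact SameAt.of_map _ _ _ (by simp) _
  obtain ⟨K, k, x, u, hux, hu⟩ := exists_matching_families hS hcod hP pres hG i hi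
  refine exists_presheaf_of_chart hP hGc _ u (isSmallPred_sameAt_pair hS _ _
    fun X t t' h h' => ?_) fun X g => ?_
  · have hup : IsPresented J i u := by
      have hcov := pres.cov_reindex_BCov (X := ⟨K, k ≫ pres.β⟩) k rfl
      refine ⟨_, J.isSieve _ _ hcov, hcov, ?_⟩
      obtain ⟨ψ, hψ⟩ := pres.sieveOf_le_factorSieve (X := ⟨K, k ≫ pres.β⟩) k rfl _
        (genericMember_mem (J.isSieve _ _ hcov))
      exact ⟨Q.ext.map ψ.op x, by rw [i.map_app, ← hux, Stage.map_map, hψ]⟩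
    exact isSmallPred_sameAt hS hcod pres hG hi' (hup.map hS hcod _ _) (hup.map hS hcod _ _)
  · obtain ⟨X', p, b, h, hp, y, hy⟩ := hpres g
    obtain ⟨t, ht⟩ := hu (X := ⟨X', p ≫ X.pt⟩) b h _ y hy.symm
    exact ⟨X', p, t, hp, ht.trans (SameAt.of_map _ _ _ (by simp) _)⟩

/-- Every presheaf is locally isomorphic to a sheaf. -/
lemma exists_sheaf (hP : IsPredicative S) (pres : Presentation J) (P : Presheaf C) :
    ∃ (Q : Presheaf C) (F : P ⟶ Q), IsSheaf J Q ∧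
      IsLocallyInjective (J := J) hS hcod (Presheaf.toExt F) ∧
      IsLocallySurjective (J := J) hS hcod (Presheaf.toExt F) := by
  let T := stageTopology J hS hcod
  -- the category of stages is as large as `E`, so that its presheaves can be sheafified only after
  -- an enlargement of the universe
  let P' : (Stage C)ᵒᵖ ⥤ Type (max u v) := P.ext ⋙ uliftFunctor.{max u v}
  let G : (Stage C)ᵒᵖ ⥤ Type (max u v) := sheafify T P'
  have hG : Presieve.IsSheaf T G := (isSheaf_iff_isSheaf_of_type _ _).1 ((presheafToSheaf T _).obj P').property
  let up {X : Stage C} (x : P.ext.obj (op X)) : P'.obj (op X) := ULift.up x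
  let e : P.ExtHom G := ⟨fun {X} x => (toSheafify T P').app (op X) (up x), fun {X Y} φ x =>
    NatTrans.naturality_apply (toSheafify T P') φ.op (up x)⟩
  have he : IsLocallyInjective (J := J) hS hcod e := fun {X} x y h => by
    have := CategoryTheory.Presheaf.equalizerSieve_mem T (toSheafify T P') (up x) (up y) h
    refine GrothendieckTopology.superset_covering _ ?_ this
    intro Y φ hφ
    exact congrArg ULift.down hφ
  have he' : IsLocallySurjective (J := J) hS hcod e := fun {X} g => by
    have := CategoryTheory.Presheaf.imageSieve_mem T (toSheafify T P') g
    refine GrothendieckTopology.superset_covering _ ?_ this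
    rintro Y φ ⟨x, hx⟩
    exact ⟨ULift.down x, hx⟩
  obtain ⟨Q, i, hi⟩ := exists_presheaf_of_locallyBijective hS hcod hP pres hG e he he'
  let α : P.ExtHom Q.ext := ⟨fun {X} x => ((hi X).2 (e.app x)).choose, fun {X Y} φ x => (hi Y).1 (by
    rw [((hi Y).2 _).choose_spec, i.map_app, ((hi X).2 _).choose_spec, e.map_app])⟩
  have hα {X : Stage C} (x : P.ext.obj (op X)) : i.app (α.app x) = e.app x :=
    ((hi X).2 (e.app x)).choose_spec
  refine ⟨Q, Presheaf.homOfExt α, (isSheaf_iff hS hcod Q).2 (isSheaf_of_bijective hG i hi),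
    fun {X} x y h => ?_, fun {X} g => ?_⟩
  · rw [Presheaf.toExt_homOfExt, Presheaf.toExt_homOfExt] at h
    exact he x y (by rw [← hα, h, hα])
  · refine GrothendieckTopology.superset_covering _ ?_ (he' (i.app g))
    rintro Y φ ⟨x, hx⟩
    exact ⟨x, by rw [Presheaf.toExt_homOfExt]; exact (hi Y).1 (by rw [hα, hx, i.map_app])⟩

/-- A locally bijective map has the universal property of the sheafification. -/
lemma existsUnique_extension {P Q A : Presheaf C} (F : P ⟶ Q)
    (hF : IsLocallyInjective (J := J) hS hcod (Presheaf.toExt F))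
    (hF' : IsLocallySurjective (J := J) hS hcod (Presheaf.toExt F)) (hA : IsSheaf J A)
    (H : P ⟶ A) : ∃! K : Q ⟶ A, F ≫ K = H := by
  rw [isSheaf_iff hS hcod] at hA
  have hH {X : Stage C} (x y : P.ext.obj (op X)) (h : (Presheaf.toExt F).app x =
      (Presheaf.toExt F).app y) : (Presheaf.toExt H).app x = (Presheaf.toExt H).app y := by
    refine eq_of_eqSieve_mem hS hcod hA (GrothendieckTopology.superset_covering _ ?_ (hF _ _ h))
    intro Y φ hφ
    rw [eqSieve_apply] at hφ ⊢
    rw [← (Presheaf.toExt H).map_app, hφ, (Presheaf.toExt H).map_app]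
  have hex {X : Stage C} (q : Q.ext.obj (op X)) : ∃! a : A.ext.obj (op X),
      ∀ {Y : Stage C} (φ : Y ⟶ X) (x : P.ext.obj (op Y)),
        (Presheaf.toExt F).app x = Q.ext.map φ.op q → A.ext.map φ.op a = (Presheaf.toExt H).app x := by
    have hfac {Y : Stage C} {φ : Y ⟶ X} (hφ : imSieve (Presheaf.toExt F) q φ) :
      ∃ x, (Presheaf.toExt F).app x = Q.ext.map φ.op q := hφ
    choose x hx using @hfac
    obtain ⟨a, ha, ha'⟩ := hA _ (hF' q) (fun Y φ hφ => (Presheaf.toExt H).app (x hφ))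
      (fun Y₁ Y₂ Z g₁ g₂ f₁ f₂ h₁ h₂ hc => by
        rw [← (Presheaf.toExt H).map_app, ← (Presheaf.toExt H).map_app]
        refine hH _ _ ?_
        rw [(Presheaf.toExt F).map_app, (Presheaf.toExt F).map_app, hx, hx, Stage.map_map,
          Stage.map_map, hc])
    refine ⟨a, fun φ y hy => ?_, fun b hb => ha' _ fun Y φ hφ => hb φ _ (hx hφ)⟩
    rw [ha φ ⟨y, hy⟩]
    exact hH _ _ ((hx _).trans hy.symm)
  choose a ha ha' using @hex
  let α : Q.ExtHom A.ext := ⟨a, fun {X Y} φ q => (ha' (Q.ext.map φ.op q) (A.ext.map φ.op (a q))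
    fun {Z} ψ x hx => by
      rw [Stage.map_map] at hx ⊢
      exact ha q _ x hx).symm⟩
  refine ⟨Presheaf.homOfExt α, Presheaf.hom_ext_app fun {X} x => ?_, fun K hK => ?_⟩
  · rw [Presheaf.toExt_comp, Presheaf.toExt_homOfExt]
    have := ha ((Presheaf.toExt F).app x) (𝟙 X) x (by simp)
    simpa using this
  · subst hK
    refine Presheaf.hom_ext_app fun {X} q => ?_
    rw [Presheaf.toExt_homOfExt]
    refine ha' q _ fun φ x hx => ?_
    rw [← (Presheaf.toExt K).map_app, ← hx, Presheaf.toExt_comp]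

include hS hcod in
/-- Sheafification exists. -/
theorem inclusion_isRightAdjoint (hP : IsPredicative S) (pres : Presentation J) :
    (inclusion J).IsRightAdjoint := by
  choose Q F hQ hF hF' using exists_sheaf hS hcod hP pres
  refine (Adjunction.adjunctionOfEquivLeft (F_obj := fun P => (⟨Q P, hQ P⟩ : InternalSheaf J))
    (fun P A => Equiv.ofBijective
      (fun K : (⟨Q P, hQ P⟩ : InternalSheaf J) ⟶ A => F P ≫ K.hom) ?_) ?_).isRightAdjoint
  · refine ⟨fun K K' h => ?_, fun H => ?_⟩
    · exact ObjectProperty.hom_ext _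
        ((existsUnique_extension hS hcod (F P) (hF P) (hF' P) A.property (F P ≫ K.hom)).unique rfl h.symm)
    · obtain ⟨K, hK, -⟩ := existsUnique_extension hS hcod (F P) (hF P) (hF' P) A.property H
      exact ⟨ObjectProperty.homMk K, hK⟩
  · intro P A A' g h
    exact (Category.assoc (F P) h.hom g.hom).symm

/-- The unit of any sheafification adjunction is locally bijective. -/
lemma unit_locallyBijective (hP : IsPredicative S) (pres : Presentation J)
    {L : Presheaf C ⥤ InternalSheaf J} (adj : L ⊣ inclusion J) (P : Presheaf C) :
    IsLocallyInjective (J := J) hS hcod (Presheaf.toExt (adj.unit.app P)) ∧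
      IsLocallySurjective (J := J) hS hcod (Presheaf.toExt (adj.unit.app P)) := by
  obtain ⟨Q, F, hQ, hF, hF'⟩ := exists_sheaf hS hcod hP pres P
  obtain ⟨K, hK, -⟩ := existsUnique_extension hS hcod F hF hF' (L.obj P).property (adj.unit.app P)
  let K' : L.obj P ⟶ (⟨Q, hQ⟩ : InternalSheaf J) := (adj.homEquiv P ⟨Q, hQ⟩).symm F
  have hK' : adj.unit.app P ≫ K'.hom = F := by
    have := (adj.homEquiv_unit (f := K')).symm
    simpa [K'] using this
  have h₁ : K ≫ K'.hom = 𝟙 Q :=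
    (existsUnique_extension hS hcod F hF hF' hQ F).unique (by rw [← Category.assoc, hK, hK'])
      (Category.comp_id _)
  have h₂ : K'.hom ≫ K = 𝟙 _ := by
    have : K' ≫ ObjectProperty.homMk K = 𝟙 (L.obj P) := by
      apply (adj.homEquiv _ _).injective
      rw [adj.homEquiv_unit, adj.homEquiv_unit]
      simp [reassoc_of% hK', hK]
    exact (inclusion J).congr_map this
  constructor
  · intro X x y h
    refine hF x y ?_
    rw [← hK', Presheaf.toExt_comp, Presheaf.toExt_comp, h]
  · intro X g
    refine GrothendieckTopology.superset_covering _ ?_ (hF' ((Presheaf.toExt K'.hom).app g))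
    rintro Y φ ⟨x, hx⟩
    refine ⟨x, ?_⟩
    rw [← hK, Presheaf.toExt_comp, hx, (Presheaf.toExt K).map_app, ← Presheaf.toExt_comp, h₂]
    congr 1
    exact Presheaf.val_injective (by simp)

end

end

section

variable {E : Type u} [Category.{v} E] [PositiveHeyting E]
  {C : InternalCategory E} {S : MorphismProperty E} {J : Topology S C}

section

variable (hS : IsClassOfSmallMaps S) (hcod : S C.cod)

/-! ### The locus where local data glue -/

/-- The kernel pair of a small map of stages. -/
lemma exists_kernelPair (hS : IsClassOfSmallMaps S) (hcod : S C.cod) {D X : Stage C} (ε : D ⟶ X)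
    (hε : S (Stage.Hom.map ε)) :
    ∃ (M : Stage C) (κ₁ κ₂ : M ⟶ D), κ₁ ≫ ε = κ₂ ≫ ε ∧ S (Stage.Hom.map (κ₁ ≫ ε)) ∧
      ∀ {Z : Stage C} (ψ₁ ψ₂ : Z ⟶ D), ψ₁ ≫ ε = ψ₂ ≫ ε →
        ∃ (s : Z.base ⟶ M.base) (h : s ≫ M.pt = Z.pt),
          Stage.rebase s h ≫ κ₁ = ψ₁ ∧ Stage.rebase s h ≫ κ₂ = ψ₂ := by
  let A : Stage C := ⟨pullback D.pt C.cod, pullback.snd D.pt C.cod ≫ C.dom⟩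
  let α : A ⟶ D := Stage.mkHom (pullback.fst _ _) (pullback.snd _ _) rfl pullback.condition.symm
  let p : A.base ⟶ X.base := Stage.Hom.map (α ≫ ε)
  have hp : S p := hS.composition (hS.fst_small _ _ hcod) hε
  let f₁ := pullback.fst p p ≫ Stage.Hom.arr (α ≫ ε)
  let f₂ := pullback.snd p p ≫ Stage.Hom.arr (α ≫ ε)
  let j := equalizer.ι f₁ f₂
  have hj : j ≫ f₁ = j ≫ f₂ := equalizer.condition f₁ f₂
  let M : Stage C := ⟨equalizer f₁ f₂, (j ≫ f₁) ≫ C.dom⟩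
  have hα := (α ≫ ε).arr_dom
  let κ₁ : M ⟶ A := Stage.rebase (j ≫ pullback.fst p p) (by
    simp only [M, f₁, Category.assoc]
    exact (congrArg (fun x => j ≫ pullback.fst p p ≫ x) hα).symm)
  let κ₂ : M ⟶ A := Stage.rebase (j ≫ pullback.snd p p) (by
    simp only [M, hj, f₂, Category.assoc]
    exact (congrArg (fun x => j ≫ pullback.snd p p ≫ x) hα).symm)
  refine ⟨M, κ₁ ≫ α, κ₂ ≫ α, ?_, ?_, fun {Z} ψ₁ ψ₂ h => ?_⟩
  · simp only [Category.assoc]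
    refine Stage.hom_ext ?_ ?_
    · have := j ≫= pullback.condition (f := p) (g := p)
      simpa [κ₁, κ₂, p] using this
    · rw [Stage.rebase_comp_arr, Stage.rebase_comp_arr]
      simpa [f₁, f₂] using hj
  · have : Stage.Hom.map ((κ₁ ≫ α) ≫ ε) = j ≫ pullback.fst p p ≫ p := by simp [κ₁, p]
    rw [this]
    exact hS.composition (hS.equalizer_small _ _)
      (hS.composition (hS.fst_small _ _ hp) hp)
  · have hA (ψ : Z ⟶ D) : ∃ (s : Z.base ⟶ A.base) (h : s ≫ A.pt = Z.pt),
        Stage.rebase s h ≫ α = ψ := by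
      refine ⟨pullback.lift (Stage.Hom.map ψ) (Stage.Hom.arr ψ) ψ.arr_cod.symm, ?_, ?_⟩
      · simp only [A, pullback.lift_snd_assoc]
        exact ψ.arr_dom
      · refine Stage.hom_ext ?_ ?_
        · simp [α]
        · rw [Stage.rebase_comp_arr]
          simp [α]
    obtain ⟨s₁, h₁, hs₁⟩ := hA ψ₁
    obtain ⟨s₂, h₂, hs₂⟩ := hA ψ₂
    have e₁ := congrArg Stage.Hom.map h
    have e₂ := congrArg Stage.Hom.arr h
    rw [← hs₁, ← hs₂, Category.assoc, Category.assoc] at e₁ e₂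
    rw [Stage.rebase_comp_arr, Stage.rebase_comp_arr] at e₂
    have e₃ : s₁ ≫ p = s₂ ≫ p := e₁
    let s : Z.base ⟶ M.base := equalizer.lift (pullback.lift s₁ s₂ e₃) (by simpa [f₁, f₂] using e₂)
    have hsj : s ≫ j = pullback.lift s₁ s₂ e₃ := equalizer.lift_ι _ _
    have hs : s ≫ M.pt = Z.pt := by
      simp only [M, f₁, ← Category.assoc, hsj, pullback.lift_fst]
      rw [Category.assoc, hα, h₁]
    refine ⟨s, hs, ?_, ?_⟩
    · rw [← Category.assoc, ← hs₁]
      congr 1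
      refine Stage.hom_ext ?_ ?_
      · simp only [Stage.comp_map, Stage.rebase_map, κ₁]
        rw [← Category.assoc, hsj]
        simp
      · simp [κ₁]
    · rw [← Category.assoc, ← hs₂]
      congr 1
      refine Stage.hom_ext ?_ ?_
      · simp only [Stage.comp_map, Stage.rebase_map, κ₂]
        rw [← Category.assoc, hsj]
        simp
      · simp [κ₂]

/-- The element `a` over `t : W ⟶ X` is a glueing of the restriction to `W` of the element `x`
over `D`. -/
def IsGlueingAt {A : Presheaf C} {D X : Stage C} (ε : D ⟶ X) (x : A.ext.obj (op D)) {W : E}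
    (t : W ⟶ X.base) (a : A.ext.obj (op (⟨W, t ≫ X.pt⟩ : Stage C))) : Prop :=
  ∀ {Z : Stage C} (ψ : Z ⟶ D) (χ : Z ⟶ ⟨W, t ≫ X.pt⟩), χ ≫ Stage.rebase t rfl = ψ ≫ ε →
    A.ext.map χ.op a = A.ext.map ψ.op x

/-- Let `ε : D ⟶ X` be a small map of stages that generates a covering sieve, and `x` an element
over `D` of a sheaf. The part of `X` over which `x` is a compatible family is small. -/
lemma exists_glueing_locus {A : Presheaf C}
    (hA : Presieve.IsSheaf (stageTopology J hS hcod) A.ext) {D X : Stage C} (ε : D ⟶ X)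
    (hε : S (Stage.Hom.map ε)) (hcov : factorSieve ε ∈ stageTopology J hS hcod X)
    (x : A.ext.obj (op D)) :
    ∃ (N : E) (n : N ⟶ X.base) (a : A.ext.obj (op (⟨N, n ≫ X.pt⟩ : Stage C))), S n ∧
      IsGlueingAt ε x n a ∧ ∀ {W : E} (t : W ⟶ X.base) (a' : A.ext.obj (op ⟨W, t ≫ X.pt⟩)),
        IsGlueingAt ε x t a' → ∃ k : W ⟶ N, k ≫ n = t ∧ k ≫ Presheaf.val a = Presheaf.val a' := by
  -- the family is compatible where its two restrictions to the kernel pair `M` of `ε` agree; this is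
  -- a small property of points of `X`, since `M ⟶ X` is small
  obtain ⟨M, κ₁, κ₂, hκ, hκS, hM⟩ := exists_kernelPair hS hcod ε hε
  obtain ⟨N, n, hn, hnS, hN⟩ := (IsSmallPred.eq hS (Presheaf.val (A.ext.map κ₁.op x))
    (Presheaf.val (A.ext.map κ₂.op x))).all hS (Stage.Hom.map (κ₁ ≫ ε)) hκS
  let D' : Stage C := ⟨pullback (Stage.Hom.map ε) n, pullback.fst _ _ ≫ D.pt⟩
  let δ : D' ⟶ D := Stage.rebase (pullback.fst _ _) rfl
  let X' : Stage C := ⟨N, n ≫ X.pt⟩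
  let ε' : D' ⟶ X' := Stage.mkHom (pullback.snd _ _) (pullback.fst _ _ ≫ Stage.Hom.arr ε)
    (by rw [Category.assoc]; exact congrArg _ ε.arr_dom) (by
      have := ε.arr_cod
      rw [Category.assoc]
      refine (congrArg (pullback.fst _ n ≫ ·) this).trans ?_
      simp only [X', ← Category.assoc, ← pullback.condition])
  have hδ : ε' ≫ Stage.rebase n rfl = δ ≫ ε := by
    refine Stage.hom_ext ?_ ?_
    · simpa [ε', δ] using pullback.condition.symm
    · rw [Stage.comp_rebase_arr, Stage.rebase_comp_arr]; rfl
  have hfac {Z : Stage C} (ψ : Z ⟶ D) (χ : Z ⟶ X') (h : χ ≫ Stage.rebase n rfl = ψ ≫ ε) :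
      ∃ ω : Z ⟶ D', ω ≫ ε' = χ ∧ ω ≫ δ = ψ := by
    have h₁ := congrArg Stage.Hom.map h
    have h₂ := congrArg Stage.Hom.arr h
    rw [Stage.comp_rebase_arr] at h₂
    have h₃ : Stage.Hom.map ψ ≫ Stage.Hom.map ε = Stage.Hom.map χ ≫ n := h₁.symm
    refine ⟨Stage.mkHom (pullback.lift _ _ h₃) (Stage.Hom.arr ψ) ψ.arr_dom
      (by rw [ψ.arr_cod]; simp [D']), Stage.hom_ext (by simp [ε']) ?_,
      Stage.hom_ext (by simp [δ]) ?_⟩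
    · rw [h₂, Stage.comp_arr, Stage.comp_arr]
      simp [ε']
    · rw [Stage.comp_rebase_arr]; rfl
  have hpull {W : E} (t : W ⟶ X.base) := GrothendieckTopology.pullback_stable _
    (Stage.rebase (Y := ⟨W, t ≫ X.pt⟩) t rfl) hcov
  have hcov' : factorSieve ε' ∈ stageTopology J hS hcod X' := by
    refine GrothendieckTopology.superset_covering _ ?_ (hpull n)
    rintro Z χ ⟨ψ, h⟩
    obtain ⟨ω, hω, -⟩ := hfac ψ χ h.symm
    exact ⟨ω, hω⟩
  obtain ⟨a, ha⟩ := exists_glueing hA ε' hcov' (A.ext.map δ.op x) (fun {Z} ψ ψ' h => by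
    rw [Stage.map_map, Stage.map_map]
    obtain ⟨s, hs, h₁, h₂⟩ := hM (ψ ≫ δ) (ψ' ≫ δ) (by
      rw [Category.assoc, Category.assoc, ← hδ, ← Category.assoc, h, Category.assoc])
    rw [← h₁, ← h₂, ← Stage.map_map, ← Stage.map_map κ₂]
    apply Presheaf.val_injective
    rw [Presheaf.val_map_rebase, Presheaf.val_map_rebase]
    refine (hN n).1 ⟨𝟙 _, by simp⟩ _ (Stage.Hom.map ψ ≫ pullback.snd _ _) s ?_
    have h₃ := congrArg (fun φ => Stage.Hom.map (φ ≫ ε)) h₁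
    simp only [Stage.comp_map, Stage.rebase_map, Category.assoc] at h₃ ⊢
    rw [h₃]
    simp [δ, pullback.condition])
  have hglue : IsGlueingAt ε x n a := by
    intro Z ψ χ h
    obtain ⟨ω, rfl, rfl⟩ := hfac ψ χ h
    rw [← Stage.map_map, ha, Stage.map_map]
  refine ⟨N, n, a, hnS, hglue, fun {W} t a' ha' => ?_⟩
  obtain ⟨k, hk⟩ := (hN t).2 fun Z s u hu => by
    let Z' : Stage C := ⟨Z, u ≫ M.pt⟩
    let χ : Z' ⟶ (⟨W, t ≫ X.pt⟩ : Stage C) := Stage.mkHom s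
      (Stage.Hom.arr (Stage.rebase (Y := Z') u rfl ≫ κ₁ ≫ ε)) (Stage.Hom.arr_dom _) (by
        refine (Stage.Hom.arr_cod _).trans ?_
        have : Stage.Hom.map (Stage.rebase (Y := Z') u rfl ≫ κ₁ ≫ ε) = s ≫ t := hu
        rw [this, Category.assoc])
    have hχ : χ ≫ Stage.rebase t rfl = Stage.rebase (Y := Z') u rfl ≫ κ₁ ≫ ε := by
      refine Stage.hom_ext hu.symm ?_
      rw [Stage.comp_rebase_arr]; rfl
    have h₁ := ha' (Stage.rebase (Y := Z') u rfl ≫ κ₁) χ (by rw [hχ, Category.assoc])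
    have h₂ := ha' (Stage.rebase (Y := Z') u rfl ≫ κ₂) χ (by rw [hχ, Category.assoc, hκ])
    have h₃ := h₁.symm.trans h₂
    rw [← Stage.map_map, ← Stage.map_map κ₂] at h₃
    simpa using congrArg Presheaf.val h₃
  refine ⟨k, hk, ?_⟩
  subst hk
  have : A.ext.map (Stage.rebase (X := X') (Y := ⟨W, (k ≫ n) ≫ X.pt⟩) k (by simp [X'])).op a = a' := by
    refine (hA _ (hpull (k ≫ n))).isSeparatedFor.ext ?_
    rintro Z φ ⟨ψ, hψ⟩
    rw [ha' ψ φ hψ.symm, Stage.map_map]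
    refine hglue ψ _ ?_
    rw [hψ, Category.assoc]
    congr 1
    refine Stage.hom_ext rfl ?_
    rw [Stage.comp_rebase_arr]; rfl
  rw [← this, Presheaf.val_map_rebase]

end

end

section

variable {E : Type u} [Category.{v} E] [PositiveHeyting E]
  {C : InternalCategory E} {S : MorphismProperty E} {J : Topology S C}

section

variable (hcod : S C.cod)

/-! ### Smallness of fibres from fullness -/

/-- The fibres of `f` over `t ≫ z` are the base change along `t` of the fibres of `f` over `z`. -/
lemma isPullback_snd_comp {X Y Z T : E} (f : X ⟶ Y) (z : Z ⟶ Y) (t : T ⟶ Z) :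
    IsPullback (pullback.lift (pullback.fst f (t ≫ z)) (pullback.snd f (t ≫ z) ≫ t)
      (by rw [pullback.condition, Category.assoc])) (pullback.snd f (t ≫ z))
      (pullback.snd f z) t := by
  refine IsPullback.of_right ?_ (by simp) (IsPullback.of_hasPullback f z)
  simpa using IsPullback.of_hasPullback f (t ≫ z)

lemma IsClassOfSmallMaps.pullback_snd_comp (hS : IsClassOfSmallMaps S) {X Y Z T : E} {f : X ⟶ Y}
    {z : Z ⟶ Y} {z' : T ⟶ Y} (t : T ⟶ Z) (ht : t ≫ z = z') (h : S (pullback.snd f z)) :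
    S (pullback.snd f z') := by
  subst ht
  exact hS.pullback_stable (isPullback_snd_comp f z t) h

lemma IsClassOfSmallMaps.pullback_snd_of_cover (hS : IsClassOfSmallMaps S) {X Y Z T : E}
    {f : X ⟶ Y} {z : Z ⟶ Y} {t : T ⟶ Z} (ht : ExtremalEpi t) (h : S (pullback.snd f (t ≫ z))) :
    S (pullback.snd f z) :=
  hS.descent (isPullback_snd_comp f z t) ht h

include hcod in
/-- Let `θ : A ⟶ B` be a map of sheaves and `z : T ⟶ B`. Suppose that, over a small `π : X ⟶ T`,
there are covering sieves `R` such that each element `a` of the fibre of `θ` over `z` is described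
on one of these sieves by elements of a small object `D ⟶ R`, that is, each `a · f` is of the form
`x d` with `d` in the fibre `D_f`. By fullness a small collection of multi-valued sections of
`D ⟶ R` suffices for this, so that the fibre is small. -/
lemma pullback_small_of_local_description (hP : IsPredicative S) (hF : Fullness S)
    {A B : Presheaf C}
    (hA : Presieve.IsSheaf (stageTopology J hP.toIsClassOfSmallMaps hcod) A.ext)
    (hB : Presieve.IsSheaf (stageTopology J hP.toIsClassOfSmallMaps hcod) B.ext) (θ : A ⟶ B)
    {T X D : E} (z : T ⟶ B.obj) (π : X ⟶ T) (hπ : S π) {R : Subobject (X ⨯ C.C₁)}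
    (hR : J.Cov (π ≫ z ≫ B.proj) R) (δ : D ⟶ (R : E)) (hδ : S δ)
    (x : A.ext.obj (op (⟨D, δ ≫ (R.arrow ≫ prod.snd) ≫ C.dom⟩ : Stage C)))
    (hx : (Presheaf.toExt θ).app x = B.ext.map (Stage.rebase
        (X := ⟨(R : E), (R.arrow ≫ prod.snd) ≫ C.dom⟩) δ rfl ≫
          genericMember (X := ⟨X, π ≫ z ≫ B.proj⟩) (J.isSieve _ _ hR)).op
      (B.el (X := ⟨X, π ≫ z ≫ B.proj⟩) (π ≫ z) (Category.assoc _ _ _)))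
    (H : ∀ {W : E} (w : W ⟶ T) (a : W ⟶ A.obj), a ≫ Presheaf.Hom.hom θ = w ≫ z →
      ∃ (W' : E) (p : W' ⟶ W) (x' : W' ⟶ X), ExtremalEpi p ∧ x' ≫ π = p ≫ w ∧
        ∀ {Y : E} (s : Y ⟶ W') (ρ : Y ⟶ (R : E)), s ≫ x' = ρ ≫ R.arrow ≫ prod.fst →
          ∃ (Y' : E) (q : Y' ⟶ Y) (d : Y' ⟶ D), ExtremalEpi q ∧ d ≫ δ = q ≫ ρ ∧
            ∃ h, d ≫ Presheaf.val x =
              A.restr (q ≫ s ≫ p ≫ a) (q ≫ ρ ≫ R.arrow ≫ prod.snd) h) :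
    S (pullback.snd (Presheaf.Hom.hom θ) z) := by
  have hS := hP.toIsClassOfSmallMaps
  have hR' := J.isSieve _ _ hR
  let i : (R : E) ⟶ X := R.arrow ≫ prod.fst
  let f : (R : E) ⟶ C.C₁ := R.arrow ≫ prod.snd
  have hf : f ≫ C.cod = i ≫ π ≫ z ≫ B.proj := hR'.cod_eq _ _ (mem_generic R)
  obtain ⟨X', Y, q, y, P, hq, hy, ⟨hPeq, hPs, hPc⟩, hfull⟩ := hF δ i hδ hR'.small
  -- the part `N` of `Y` over which the generic multi-valued section describes an element of `A`
  let Ys : Stage C := ⟨Y, (y ≫ q) ≫ π ≫ z ≫ B.proj⟩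
  let Ps : Stage C := ⟨(P : E), (P.arrow ≫ prod.snd) ≫ δ ≫ f ≫ C.dom⟩
  have hεcod : ((P.arrow ≫ prod.snd ≫ δ) ≫ f) ≫ C.cod = (P.arrow ≫ prod.fst) ≫ Ys.pt := by
    have := hPeq =≫ (π ≫ z ≫ B.proj)
    simp only [Category.assoc, hf, Ys] at this ⊢
    exact this.symm
  let ε : Ps ⟶ Ys := Stage.mkHom (P.arrow ≫ prod.fst) ((P.arrow ≫ prod.snd ≫ δ) ≫ f)
    (by simp [Ps]) hεcod
  have hε : S (P.arrow ≫ prod.fst) := by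
    have := hS.composition hPs (hS.fst_small (y ≫ q) i hR'.small)
    simpa using this
  have hcov : factorSieve ε ∈ stageTopology J hP.toIsClassOfSmallMaps hcod Ys := by
    refine ⟨Y, 𝟙 _, reindex (y ≫ q) R, inferInstance, ?_, fun {V} t g hg => ?_⟩
    · have := Topology.cov_reindex hR (y ≫ q)
      simpa [Ys] using this
    · obtain ⟨ρ, hρ₁, hρ₂⟩ := mem_iff.1 (mem_reindex.1 hg)
      obtain ⟨V', r, e, hr, he⟩ := exists_lift_of_cover hPc (pullback.lift t ρ hρ₁.symm)
      have he₁ := he =≫ pullback.fst _ _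
      have he₂ := he =≫ pullback.snd _ _
      simp only [Category.assoc, pullback.lift_fst, pullback.lift_snd] at he₁ he₂
      refine ⟨V', r, hr, sieveMem_of (σ := factorSieve ε)
        (φ := Stage.rebase (Y := ⟨V', e ≫ Ps.pt⟩) e rfl ≫ ε) ⟨_, rfl⟩ ?_ ?_⟩
      · simpa [ε] using he₁
      · rw [Stage.rebase_comp_arr, ← hρ₂]
        simp [ε, reassoc_of% he₂, f]
  let σ : Ps ⟶ (⟨D, δ ≫ f ≫ C.dom⟩ : Stage C) := Stage.rebase (P.arrow ≫ prod.snd) rfl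
  obtain ⟨N, n, a, hnS, ha, hN⟩ := exists_glueing_locus hS hcod hA ε hε hcov (A.ext.map σ.op x)
  obtain ⟨γ, hγ₁, hγ₂, hxγ⟩ : ∃ γ : (⟨D, δ ≫ f ≫ C.dom⟩ : Stage C) ⟶ ⟨X, π ≫ z ≫ B.proj⟩,
      Stage.Hom.map γ = δ ≫ i ∧ Stage.Hom.arr γ = δ ≫ f ∧
        (Presheaf.toExt θ).app x =
          B.ext.map γ.op (B.el (X := ⟨X, π ≫ z ≫ B.proj⟩) (π ≫ z) (Category.assoc _ _ _)) :=
    ⟨_, by simp [genericMember, i], by simp [genericMember, f], hx⟩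
  have haθ : Presheaf.val a ≫ Presheaf.Hom.hom θ = (n ≫ y ≫ q) ≫ π ≫ z := by
    have h : (Presheaf.toExt θ).app a = B.el (X := ⟨N, n ≫ Ys.pt⟩) ((n ≫ y ≫ q) ≫ π ≫ z)
        (by simp [Ys]) := by
      refine (hB _ (GrothendieckTopology.pullback_stable _
        (Stage.rebase (Y := ⟨N, n ≫ Ys.pt⟩) n rfl) hcov)).isSeparatedFor.ext ?_
      rintro Z χ ⟨ψ, hψ⟩
      rw [← (Presheaf.toExt θ).map_app, ha ψ χ hψ.symm, (Presheaf.toExt θ).map_app,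
        (Presheaf.toExt θ).map_app, hxγ, Stage.map_map, Stage.map_map]
      have h₁ := congrArg Stage.Hom.map hψ
      have h₂ := congrArg Stage.Hom.arr hψ
      rw [Stage.comp_rebase_arr] at h₂
      have h₃ : Stage.Hom.map ψ ≫ P.arrow ≫ prod.fst = Stage.Hom.map χ ≫ n := h₁
      refine Presheaf.map_eq_map ?_ ?_
      · have h₄ := Stage.Hom.map ψ ≫= hPeq =≫ (π ≫ z)
        simp only [Category.assoc, reassoc_of% h₃] at h₄
        simpa [σ, hγ₁] using h₄.symm
      · refine Eq.trans ?_ h₂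
        refine (congrArg Stage.Hom.arr (Category.assoc ψ σ γ)).trans ?_
        have h₄ : Stage.Hom.arr (σ ≫ γ) = P.arrow ≫ prod.snd ≫ δ ≫ f := by
          rw [Stage.rebase_comp_arr, hγ₂]
          simp
        rw [Stage.comp_arr, Stage.comp_arr ψ ε]
        simp [h₄, ε]
    exact congrArg Presheaf.val h
  -- collection makes `X'` small over a cover `T'` of `T`
  obtain ⟨Z, T', ζ, g, h, hg, hsq⟩ := hS.collection q π hq hπ
  let N' := pullback (n ≫ y) ζ
  have hsqw : ζ ≫ q ≫ π = g ≫ h := by simpa using hsq.w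
  let β : N' ⟶ pullback (Presheaf.Hom.hom θ) (h ≫ z) :=
    pullback.lift (pullback.fst _ _ ≫ Presheaf.val a) (pullback.snd _ _ ≫ g) (by
      have h₁ := pullback.condition (f := n ≫ y) (g := ζ) =≫ (q ≫ π ≫ z)
      simp only [Category.assoc] at h₁
      rw [Category.assoc, haθ]
      simp only [Category.assoc]
      rw [h₁, reassoc_of% hsqw])
  have hβ : ExtremalEpi β := by
    let V := pullback (Presheaf.Hom.hom θ) (h ≫ z)
    let v : V ⟶ A.obj := pullback.fst _ _
    let t : V ⟶ T' := pullback.snd _ _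
    have hvt : v ≫ Presheaf.Hom.hom θ = t ≫ h ≫ z := pullback.condition
    obtain ⟨W₁, p₁, x', hp₁, hx', H'⟩ := H (t ≫ h) v (by rw [hvt, Category.assoc])
    obtain ⟨W, p₂, w, hp₂, hw₁, hw₂⟩ := hsq.exists_lift x' (p₁ ≫ t) (by rw [hx', Category.assoc])
    -- the multi-valued section of all descriptions of the generic element
    have hvB : v ≫ A.proj = t ≫ h ≫ z ≫ B.proj := by
      rw [← Presheaf.Hom.hom_proj θ, reassoc_of% hvt]
    let G := pullback (p₂ ≫ x') (δ ≫ i)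
    let Gs : Stage C := ⟨G, pullback.snd _ _ ≫ δ ≫ f ≫ C.dom⟩
    let γ₁ : Gs ⟶ (⟨D, δ ≫ f ≫ C.dom⟩ : Stage C) := Stage.rebase (pullback.snd _ _) rfl
    let γ₂ : Gs ⟶ (⟨V, v ≫ A.proj⟩ : Stage C) :=
      Stage.mkHom (pullback.fst _ _ ≫ p₂ ≫ p₁) (pullback.snd _ _ ≫ δ ≫ f) (by simp [Gs]) (by
        have h₁ := pullback.condition (f := p₂ ≫ x') (g := δ ≫ i) =≫ (π ≫ z ≫ B.proj)
        simp only [Category.assoc, reassoc_of% hx'] at h₁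
        simp only [Category.assoc, hf, hvB]
        exact h₁.symm)
    let x₁ := A.ext.map γ₁.op x
    let x₂ := A.ext.map γ₂.op (A.el (X := ⟨V, v ≫ A.proj⟩) v rfl)
    let j := equalizer.ι (Presheaf.val x₁) (Presheaf.val x₂)
    have hj : j ≫ Presheaf.val x₁ = j ≫ Presheaf.val x₂ := equalizer.condition _ _
    have : Mono (prod.lift (pullback.fst (p₂ ≫ x') (δ ≫ i)) (pullback.snd (p₂ ≫ x') (δ ≫ i))) :=
      ⟨fun a b hab => by
        have h₁ := hab =≫ prod.fst
        have h₂ := hab =≫ prod.snd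
        apply pullback.hom_ext
        · simpa using h₁
        · simpa using h₂⟩
    let m := j ≫ prod.lift (pullback.fst (p₂ ≫ x') (δ ≫ i)) (pullback.snd (p₂ ≫ x') (δ ≫ i))
    have hm : Mono m := mono_comp _ _
    have hmem {Y : E} (s : Y ⟶ W) (d : Y ⟶ D) : Mem (Subobject.mk m) s d ↔
        ∃ e, e ≫ j ≫ pullback.fst _ _ = s ∧ e ≫ j ≫ pullback.snd _ _ = d := by
      rw [Mem, mk_factors_iff']
      refine exists_congr fun e => ⟨fun he => ?_, fun he => ?_⟩
      · have h₁ := he =≫ prod.fst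
        have h₂ := he =≫ prod.snd
        simp only [m, Category.assoc, prod.lift_fst, prod.lift_snd] at h₁ h₂
        exact ⟨h₁, h₂⟩
      · ext
        · simpa [m] using he.1
        · simpa [m] using he.2
    let Q := Subobject.mk m
    obtain ⟨e₀, he₁, he₂⟩ := (hmem _ _).1 (mem_generic Q)
    have hwx : (w ≫ ζ) ≫ q = p₂ ≫ x' := by simpa using hw₁
    have hQ : IsMvs S δ i ((w ≫ ζ) ≫ q) Q := by
      have hQeq : (Q.arrow ≫ prod.fst) ≫ (w ≫ ζ) ≫ q = (Q.arrow ≫ prod.snd ≫ δ) ≫ i := by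
        rw [hwx, ← he₁, Category.assoc, Category.assoc, pullback.condition]
        simp [reassoc_of% he₂]
      refine ⟨hQeq, hS.of_comp (g := pullback.fst _ _) ?_, ?_⟩
      · rw [pullback.lift_fst]
        have h₁ : Q.arrow ≫ prod.fst = (Subobject.underlyingIso m).hom ≫ m ≫ prod.fst := by
          rw [← Category.assoc, Subobject.underlyingIso_hom_comp_eq_mk]
        rw [h₁]
        refine hS.composition (hS.iso_small _) ?_
        simp only [m, Category.assoc, prod.lift_fst]
        exact hS.composition (hS.equalizer_small _ _)
          (hS.fst_small _ _ (hS.composition hδ hR'.small))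
      · obtain ⟨Y', r, d, hr, hd, hd', hd''⟩ := H' (pullback.fst ((w ≫ ζ) ≫ q) i ≫ p₂)
          (pullback.snd _ _) ((Category.assoc _ _ _).trans
            ((congrArg (pullback.fst _ i ≫ ·) hwx.symm).trans pullback.condition))
        obtain ⟨l, hl₁, hl₂⟩ := mem_iff.1 ((hmem (r ≫ pullback.fst _ _) d).2 (by
          have hc : (r ≫ pullback.fst ((w ≫ ζ) ≫ q) i) ≫ p₂ ≫ x' = d ≫ δ ≫ i := by
            rw [reassoc_of% hd, ← hwx, Category.assoc, pullback.condition]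
          suffices h₀ : pullback.lift _ _ hc ≫ Presheaf.val x₁ =
              pullback.lift _ _ hc ≫ Presheaf.val x₂ from
            ⟨equalizer.lift _ h₀, by simp only [j, equalizer.lift_ι_assoc, pullback.lift_fst],
              by simp only [j, equalizer.lift_ι_assoc, pullback.lift_snd]⟩
          have h₁ : pullback.lift _ _ hc ≫ Presheaf.val x₁ = d ≫ Presheaf.val x := by
            simp [x₁, γ₁]
          rw [h₁, hd'']
          simp only [x₂]
          rw [Presheaf.val_map, Presheaf.precomp_restr]
          refine A.restr_congr ?_ ?_ _ _
          · simp [γ₂]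
          · simp [γ₂, f, reassoc_of% hd]))
        refine cover_of_lift hr l ?_
        apply pullback.hom_ext
        · simpa using hl₁
        · simp only [Category.assoc, pullback.lift_snd]
          rw [← hd, ← hl₂]
          simp only [Category.assoc]
          rfl
    obtain ⟨U, k, l, hl, hkl, hle⟩ := hfull (w ≫ ζ) Q hQ
    -- the part of it given by fullness still describes the generic element
    have hUpt : (l ≫ p₂ ≫ p₁ ≫ v) ≫ A.proj = k ≫ Ys.pt := by
      simp only [Category.assoc, hvB, Ys]
      rw [reassoc_of% hkl, ← reassoc_of% hx']
      have := hwx =≫ (π ≫ z ≫ B.proj)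
      simp only [Category.assoc] at this
      rw [this]
    obtain ⟨k', hk'₁, hk'₂⟩ := hN k (A.el (l ≫ p₂ ≫ p₁ ≫ v) hUpt) (by
      intro K ψ χ hχ
      have h₁ := congrArg Stage.Hom.map hχ
      have h₂ := congrArg Stage.Hom.arr hχ
      rw [Stage.comp_rebase_arr, Stage.comp_arr] at h₂
      have h₃ : Stage.Hom.map χ ≫ k = Stage.Hom.map ψ ≫ P.arrow ≫ prod.fst := h₁
      obtain ⟨e, he₁, he₂⟩ := (hmem _ _).1 (mem_reindex.1 (le_iff_mem.1 hle (Stage.Hom.map χ)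
        (Stage.Hom.map ψ ≫ P.arrow ≫ prod.snd)
        (mem_reindex.2 (mem_iff.2 ⟨Stage.Hom.map ψ, h₃.symm, rfl⟩))))
      have hse : SameAt x₁ j x₂ j := by
        rw [sameAt_self_iff]
        apply Presheaf.val_injective
        simpa using hj
      let φ : K ⟶ Gs := Stage.mkHom (e ≫ j) (Stage.Hom.arr ψ) ψ.arr_dom (by
        rw [ψ.arr_cod]
        simp only [Gs, Ps, Category.assoc]
        rw [reassoc_of% he₂])
      have h₄ := hse.map_eq (φ := φ) (φ' := φ) e rfl rfl rfl
      simp only [x₁, x₂] at h₄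
      rw [Stage.map_map, Stage.map_map] at h₄
      rw [Stage.map_map]
      refine Eq.trans ?_ (h₄.symm.trans (Stage.map_congr ?_ ?_ x))
      · refine Presheaf.map_eq_map ?_ ?_
        · simp [φ, γ₂, reassoc_of% he₁]
        · rw [h₂, Stage.comp_arr]
          simp [φ, γ₂, ε, reassoc_of% he₂]
      · simp [φ, γ₁, σ, he₂]
      · simp [φ, γ₁, σ])
    refine cover_of_lift (cover_comp hl (cover_comp hp₂ hp₁))
      (pullback.lift k' (l ≫ w) (by
        rw [← Category.assoc, hk'₁, hkl, Category.assoc])) ?_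
    apply pullback.hom_ext
    · simpa [β] using hk'₂
    · simp [β, hw₂, t]
  have hβS : S (pullback.snd (Presheaf.Hom.hom θ) (h ≫ z)) := by
    refine hS.quotients hβ ?_
    simp only [β, pullback.lift_snd]
    exact hS.composition (hS.snd_small _ _ (hS.composition hnS hy)) hg
  exact hS.pullback_snd_of_cover hsq.2 hβS

end

end

section

variable {E : Type u} [Category.{v} E] [PositiveHeyting E]
  {C : InternalCategory E} {S : MorphismProperty E} {J : Topology S C}

section

variable (hcod : S C.cod)

/-! ### Smallness descends along local covers -/

/-- The sieve of maps along which the pair `(y, a)` is in the image of `(F, t)`. -/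
def pairSieve {P Q A : Presheaf C} (F : P ⟶ Q) (t : P ⟶ A) {X : Stage C} (y : Q.ext.obj (op X))
    (a : A.ext.obj (op X)) : Sieve X where
  arrows _ φ := ∃ x, (Presheaf.toExt F).app x = Q.ext.map φ.op y ∧
    (Presheaf.toExt t).app x = A.ext.map φ.op a
  downward_closed := by
    rintro Y Z φ ⟨x, hx, hx'⟩ ψ
    exact ⟨P.ext.map ψ.op x, by rw [Presheaf.ExtHom.map_app, hx, Stage.map_map],
      by rw [Presheaf.ExtHom.map_app, hx', Stage.map_map]⟩

/-- The members of a basic covering sieve are the elements of the corresponding sieve. -/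
lemma Presentation.exists_lift_member (pres : Presentation J) {X' X : E} {b : X' ⟶ pres.B}
    {c : X ⟶ pres.B} {x' : X' ⟶ X} (hb : x' ≫ c = b) {D : E}
    {q : D ⟶ pullback b pres.idx} (hq : ExtremalEpi q) {Y : E} (s : Y ⟶ X')
    (ρ : Y ⟶ (reindex c pres.BCov : E))
    (h : s ≫ x' = ρ ≫ (reindex c pres.BCov).arrow ≫ prod.fst) :
    ∃ (Y' : E) (r : Y' ⟶ Y) (e : Y' ⟶ D), ExtremalEpi r ∧
      e ≫ q ≫ pullback.fst b pres.idx = r ≫ s ∧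
      e ≫ q ≫ pullback.snd b pres.idx ≫ pres.arr =
        r ≫ ρ ≫ (reindex c pres.BCov).arrow ≫ prod.snd := by
  obtain ⟨ρ₀, h₁, h₂⟩ := mem_iff.1 (mem_reindex.1 (mem_iff.2 ⟨ρ, rfl, rfl⟩))
  obtain ⟨Y', r, e, hr, he⟩ := exists_lift_of_cover hq (pullback.lift s ρ₀ (by
    rw [h₁, ← hb, reassoc_of% h]
    simp))
  refine ⟨Y', r, e, hr, ?_, ?_⟩
  · rw [reassoc_of% he, pullback.lift_fst]
  · rw [reassoc_of% he, pullback.lift_snd_assoc, h₂]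

include hcod in
/-- In a commuting square with sides `F` and `θ` that is locally a quasi-pullback, where `F` is a
small map of presheaves and `θ` a map of sheaves, the fibres of `θ` over elements coming from `Q` are
small. For `y` in `Q`, the basic covering sieves form a small collection, and each `a` in the fibre of
`θ` over the image of `y` is described on one of them by elements of the fibres of `F` over the
restrictions of `y`. -/
lemma pullback_small_of_pairSieve (hP : IsPredicative S) (hF : Fullness S) (pres : Presentation J)
    {P Q A B : Presheaf C}
    (hA : Presieve.IsSheaf (stageTopology J hP.toIsClassOfSmallMaps hcod) A.ext)
    (hB : Presieve.IsSheaf (stageTopology J hP.toIsClassOfSmallMaps hcod) B.ext) (θ : A ⟶ B)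
    (F : P ⟶ Q) (t : P ⟶ A) (z : Q ⟶ B) (hw : t ≫ θ = F ≫ z) (hFS : S (Presheaf.Hom.hom F))
    (H : ∀ {X : Stage C} (y : Q.ext.obj (op X)) (a : A.ext.obj (op X)),
      (Presheaf.toExt θ).app a = (Presheaf.toExt z).app y →
        pairSieve F t y a ∈ stageTopology J hP.toIsClassOfSmallMaps hcod X) :
    S (pullback.snd (Presheaf.Hom.hom θ) (Presheaf.Hom.hom z)) := by
  have hS := hP.toIsClassOfSmallMaps
  -- `π` is the small map of elements of `Q` with a basic covering sieve, `R` the generic such sieve,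
  -- and `δ : D ⟶ R` the fibres of `F` over the restrictions of the element to the members of `R`
  let π : pullback Q.proj pres.β ⟶ Q.obj := pullback.fst _ _
  let c : pullback Q.proj pres.β ⟶ pres.B := pullback.snd _ _
  have hπ : S π := hS.fst_small _ _ pres.small
  let X : Stage C := ⟨pullback Q.proj pres.β, π ≫ Presheaf.Hom.hom z ≫ B.proj⟩
  have hX : π ≫ Q.proj = X.pt := by simp [X, Presheaf.Hom.hom_proj]
  have hR : J.Cov X.pt (reindex c pres.BCov) :=
    pres.cov_reindex_BCov (X := X) c (pullback.condition.symm.trans hX)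
  let y : Q.ext.obj (op X) := Q.el π hX
  let γ := genericMember (J.isSieve _ _ hR)
  let yR := Presheaf.val (Q.ext.map γ.op y)
  let δ := pullback.snd (Presheaf.Hom.hom F) yR
  have hδ : S δ := hS.snd_small _ _ hFS
  let D : Stage C := ⟨pullback (Presheaf.Hom.hom F) yR, δ ≫ ((reindex c pres.BCov).arrow ≫ prod.snd) ≫ C.dom⟩
  let x : P.ext.obj (op D) := P.el (pullback.fst _ _) (by
    rw [← Presheaf.Hom.hom_proj F, ← Category.assoc, pullback.condition, Category.assoc]
    exact congrArg (δ ≫ ·) (Presheaf.val_proj _))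
  have hx : (Presheaf.toExt F).app x = Q.ext.map (Stage.rebase δ rfl ≫ γ).op y := by
    rw [← Stage.map_map]
    refine Presheaf.val_injective ?_
    rw [Presheaf.val_map_rebase, Presheaf.val_toExt]
    exact pullback.condition
  refine pullback_small_of_local_description hcod hP hF hA hB θ _ π hπ hR δ hδ
    ((Presheaf.toExt t).app x) ?_ fun {W} w a ha => ?_
  · rw [← Presheaf.toExt_comp, hw, Presheaf.toExt_comp, hx, Presheaf.ExtHom.map_app]
    rfl
  · let Ws : Stage C := ⟨W, w ≫ Q.proj⟩
    let a' : A.ext.obj (op Ws) := A.el a (by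
      rw [← Presheaf.Hom.hom_proj θ, reassoc_of% ha, Presheaf.Hom.hom_proj])
    obtain ⟨W', p, b, hb, hp, D', q, hq, x₀, hx₀, hx₀'⟩ := pres.exists_member hS hcod
      (H (Q.el (X := Ws) w rfl) a' (Presheaf.val_injective ha))
    refine ⟨W', p, pullback.lift (p ≫ w) b (by rw [hb, Category.assoc]), hp,
      pullback.lift_fst _ _ _, fun {Y} s ρ h => ?_⟩
    obtain ⟨Y', r, e, hr, h₁, h₂⟩ := pres.exists_lift_member
      (pullback.lift_snd _ _ _ : pullback.lift (p ≫ w) b _ ≫ c = b) hq s ρ h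
    let φ : (⟨D', q ≫ (pres.members b).pt⟩ : Stage C) ⟶ Ws :=
      Stage.rebase (Y := ⟨D', q ≫ (pres.members b).pt⟩) q rfl ≫ pres.member b hb ≫
        Stage.rebase (Y := ⟨W', p ≫ Ws.pt⟩) p rfl
    have hφ₁ : e ≫ Stage.Hom.map φ = r ≫ s ≫ p := by simp [φ, reassoc_of% h₁]
    have hφ₂ : e ≫ Stage.Hom.arr φ = r ≫ ρ ≫ (reindex c pres.BCov).arrow ≫ prod.snd :=
      (by simp [φ] : e ≫ Stage.Hom.arr φ = e ≫ q ≫ pullback.snd b pres.idx ≫ pres.arr).trans h₂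
    have h₃ := congrArg (fun x => e ≫ Presheaf.val x) hx₀
    have h₄ := congrArg (fun x => e ≫ Presheaf.val x) hx₀'
    simp only [Presheaf.val_map, Presheaf.precomp_restr, Presheaf.val_toExt] at h₃ h₄
    have h₅ : (r ≫ s ≫ p ≫ a) ≫ A.proj =
        (r ≫ ρ ≫ (reindex c pres.BCov).arrow ≫ prod.snd) ≫ C.cod := by
      have h₆ : a ≫ A.proj = Ws.pt := Presheaf.val_proj a'
      rw [← hφ₂, Category.assoc e, φ.arr_cod, reassoc_of% hφ₁]
      simp [h₆]
    refine ⟨Y', r, pullback.lift (e ≫ Presheaf.val x₀) (r ≫ ρ) ?_, hr, pullback.lift_snd _ _ _,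
      h₅, ?_⟩
    · simp only [yR, Presheaf.val_map, Presheaf.precomp_restr, Category.assoc]
      refine h₃.trans (Q.restr_congr ?_ ?_ _ _)
      · have h₆ := h =≫ π
        simp only [π, Category.assoc, pullback.lift_fst] at h₆
        refine (congrArg (· ≫ w) hφ₁).trans ?_ |> ((Category.assoc _ _ _).symm.trans ·)
        simp only [Category.assoc, h₆]
        simp only [γ, genericMember, y, π, Presheaf.val_el, Stage.mkHom_map, Category.assoc]
        rfl
      · refine hφ₂.trans ?_
        simp only [γ, genericMember, Stage.mkHom_arr]
        rfl
    · rw [Presheaf.val_toExt]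
      simp only [x, Presheaf.val_el, pullback.lift_fst_assoc, Category.assoc]
      refine h₄.trans (A.restr_congr ?_ hφ₂ _ _)
      refine (Category.assoc _ _ _).symm.trans ((congrArg (· ≫ a) hφ₁).trans ?_)
      simp

/-- A map of sheaves is small if it is locally covered by a small map of presheaves. The square is
a local quasi-pullback by `H`, and the lower side is locally surjective by `hz`. -/
lemma small_of_pairSieve (hP : IsPredicative S) (hF : Fullness S) (pres : Presentation J)
    {P Q A B : Presheaf C}
    (hA : Presieve.IsSheaf (stageTopology J hP.toIsClassOfSmallMaps hcod) A.ext)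
    (hB : Presieve.IsSheaf (stageTopology J hP.toIsClassOfSmallMaps hcod) B.ext) (θ : A ⟶ B)
    (F : P ⟶ Q) (t : P ⟶ A) (z : Q ⟶ B) (hw : t ≫ θ = F ≫ z) (hFS : S (Presheaf.Hom.hom F))
    (H : ∀ {X : Stage C} (y : Q.ext.obj (op X)) (a : A.ext.obj (op X)),
      (Presheaf.toExt θ).app a = (Presheaf.toExt z).app y →
        pairSieve F t y a ∈ stageTopology J hP.toIsClassOfSmallMaps hcod X)
    (hz : IsLocallySurjective (J := J) hP.toIsClassOfSmallMaps hcod (Presheaf.toExt z)) :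
    S (Presheaf.Hom.hom θ) := by
  have hS := hP.toIsClassOfSmallMaps
  have hQ := pullback_small_of_pairSieve hcod hP hF pres hA hB θ F t z hw hFS H
  -- over the cover `p` the generic element of `B` is given, on the basic covering sieve `b`, by
  -- elements of `Q`; as smallness descends along covers, the fibres of `θ` over these restrictions are
  -- small
  obtain ⟨T, p, b, hb, hp, D', q, hq, y, hy⟩ := pres.exists_member hS hcod (hz B.gen)
  let X : Stage C := ⟨T, 𝟙 T ≫ p ≫ B.proj⟩
  have hX : b ≫ pres.β = X.pt := by simp [X, hb, Presheaf.stage]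
  have hR : J.Cov X.pt (reindex b pres.BCov) := pres.cov_reindex_BCov (X := X) b hX
  let γ := genericMember (J.isSieve _ _ hR)
  let β := B.el (X := X) (𝟙 T ≫ p) (Category.assoc _ _ _)
  let bR := Presheaf.val (B.ext.map γ.op β)
  let δ := pullback.snd (Presheaf.Hom.hom θ) bR
  have hδ : S δ := by
    obtain ⟨Y', r, e, hr, h₁, h₂⟩ := pres.exists_lift_member (Category.id_comp b) hq
      ((reindex b pres.BCov).arrow ≫ prod.fst) (𝟙 _) (by simp)
    have h₃ := congrArg (fun x => e ≫ Presheaf.val x) hy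
    simp only [Presheaf.val_map, Presheaf.precomp_restr, Presheaf.val_toExt] at h₃
    have h₄ : (e ≫ Presheaf.val y) ≫ Presheaf.Hom.hom z = r ≫ bR := by
      simp only [bR, Presheaf.val_map, Presheaf.precomp_restr, Category.assoc]
      refine h₃.trans (B.restr_congr ?_ ?_ _ _)
      · simp only [γ, genericMember, β, Presheaf.gen, Stage.comp_map, Stage.rebase_map,
          Presentation.member_map, Presheaf.val_el, Stage.mkHom_map, Category.assoc,
          reassoc_of% h₁]
        exact congrArg (r ≫ (reindex b pres.BCov).arrow ≫ prod.fst ≫ ·)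
          ((Category.comp_id p).trans (Category.id_comp p).symm)
      · refine Eq.trans ?_ (h₂.trans ?_)
        · simp
        · simp only [γ, genericMember, Stage.mkHom_arr, Category.id_comp]
          rfl
    exact hS.pullback_snd_of_cover hr (hS.pullback_snd_comp _ h₄ hQ)
  let D : Stage C := ⟨pullback (Presheaf.Hom.hom θ) bR,
    δ ≫ ((reindex b pres.BCov).arrow ≫ prod.snd) ≫ C.dom⟩
  let x : A.ext.obj (op D) := A.el (pullback.fst _ _) (by
    rw [← Presheaf.Hom.hom_proj θ, ← Category.assoc, pullback.condition, Category.assoc]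
    exact congrArg (δ ≫ ·) (Presheaf.val_proj _))
  -- an element `a` of the fibre over a point of `T` is described on the basic covering sieve by its
  -- own restrictions, which lie in the small fibres `D`
  have h : S (pullback.snd (Presheaf.Hom.hom θ) p) := by
    refine pullback_small_of_local_description hcod hP hF hA hB θ p (𝟙 T) (hS.id_small _) hR δ hδ
      x ?_ fun {W} w a ha => ?_
    · refine Presheaf.val_injective ?_
      rw [← Stage.map_map, Presheaf.val_map_rebase, Presheaf.val_toExt]
      exact pullback.condition
    · refine ⟨W, 𝟙 W, w, inferInstance, by simp, fun {Y} s ρ hs => ?_⟩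
      have hcod : (s ≫ a) ≫ A.proj = (ρ ≫ (reindex b pres.BCov).arrow ≫ prod.snd) ≫ C.cod := by
        have := ρ ≫= (J.isSieve _ _ hR).cod_eq _ _ (mem_generic _)
        simp only [Category.assoc] at this hs ⊢
        rw [this, ← reassoc_of% hs, ← Presheaf.Hom.hom_proj θ, reassoc_of% ha]
        simp [X]
      refine ⟨Y, 𝟙 Y, pullback.lift (A.restr (s ≫ a) _ hcod) ρ ?_, inferInstance,
        (pullback.lift_snd _ _ _).trans (Category.id_comp ρ).symm, by simpa using hcod, ?_⟩
      · rw [Presheaf.Hom.hom_restr]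
        simp only [bR, Presheaf.val_map, Presheaf.precomp_restr]
        refine B.restr_congr ?_ ?_ _ _
        · simp only [γ, genericMember, β, Presheaf.val_el, Stage.mkHom_map, Category.assoc, ha,
            reassoc_of% hs]
          exact congrArg (ρ ≫ (reindex b pres.BCov).arrow ≫ prod.fst ≫ ·) (Category.id_comp p).symm
        · simp only [γ, genericMember, Stage.mkHom_arr]
          rfl
      · simp only [x, Presheaf.val_el, pullback.lift_fst]
        exact A.restr_congr (by simp) (by simp) _ _
  exact hS.descent (IsPullback.of_hasPullback (Presheaf.Hom.hom θ) p) hp h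

end

end

section

variable {E : Type u} [Category.{v} E] [PositiveHeyting E]
  {C : InternalCategory E} {S : MorphismProperty E} {J : Topology S C}

/-! ### Fibre products of sheaves -/

/-- The fibre product of the elements of two presheaves. -/
def fibreProduct {P Q R : Presheaf C} (F : P ⟶ R) (G : Q ⟶ R) : (Stage C)ᵒᵖ ⥤ Type v where
  obj X := {x : P.ext.obj (op X.unop) × Q.ext.obj (op X.unop) //
    (Presheaf.toExt F).app x.1 = (Presheaf.toExt G).app x.2}
  map φ := ↾fun x => ⟨(P.ext.map φ x.1.1, Q.ext.map φ x.1.2), by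
    have h₁ := (Presheaf.toExt F).map_app φ.unop x.1.1
    have h₂ := (Presheaf.toExt G).map_app φ.unop x.1.2
    exact h₁.trans ((congrArg _ x.2).trans h₂.symm)⟩
  map_id X := by
    ext x
    · exact Functor.map_id_apply P.ext _ x.1.1
    · exact Functor.map_id_apply Q.ext _ x.1.2
  map_comp φ ψ := by
    ext x
    · exact Functor.map_comp_apply P.ext φ ψ x.1.1
    · exact Functor.map_comp_apply Q.ext φ ψ x.1.2

section

variable (hS : IsClassOfSmallMaps S) (hcod : S C.cod)

/-- The fibre product of internal presheaves, described by its elements. The generic pair of elements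
lives over the pullback of the underlying objects. -/
lemma exists_fibreProduct {P Q R : Presheaf C} (F : P ⟶ R) (G : Q ⟶ R) :
    ∃ (W : Presheaf C) (p : W ⟶ P) (q : W ⟶ Q), p ≫ F = q ≫ G ∧
      ∀ {X : Stage C} (x : P.ext.obj (op X)) (y : Q.ext.obj (op X)),
        (Presheaf.toExt F).app x = (Presheaf.toExt G).app y →
          ∃! w, (Presheaf.toExt p).app w = x ∧ (Presheaf.toExt q).app w = y := by
  let V : Stage C := ⟨pullback (Presheaf.Hom.hom F) (Presheaf.Hom.hom G), pullback.fst _ _ ≫ P.proj⟩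
  let x₀ : P.ext.obj (op V) := P.el (pullback.fst _ _) rfl
  let y₀ : Q.ext.obj (op V) := Q.el (pullback.snd _ _) (by
    rw [← Presheaf.Hom.hom_proj G, ← Category.assoc, ← pullback.condition, Category.assoc,
      Presheaf.Hom.hom_proj])
  obtain ⟨W, e, he⟩ := exists_presheaf_of_representable (fibreProduct F G) V
    ⟨(x₀, y₀), Presheaf.val_injective pullback.condition⟩ (by
      rintro X ⟨⟨x, y⟩, h⟩
      have h' : Presheaf.val x ≫ Presheaf.Hom.hom F = Presheaf.val y ≫ Presheaf.Hom.hom G :=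
        congrArg Presheaf.val h
      refine ⟨pullback.lift _ _ h', ⟨by simp [V], Subtype.ext (Prod.ext ?_ ?_)⟩, ?_⟩
      · refine Presheaf.val_injective ((Presheaf.val_map_rebase _ _ _).trans ?_)
        simp [x₀]
      · refine Presheaf.val_injective ((Presheaf.val_map_rebase _ _ _).trans ?_)
        simp [y₀]
      · rintro t ⟨ht, ht'⟩
        have h₁ := congrArg (fun z => Presheaf.val z.1.1) ht'
        have h₂ := congrArg (fun z => Presheaf.val z.1.2) ht'
        apply pullback.hom_ext
        · rw [pullback.lift_fst]
          exact (Presheaf.val_map_rebase _ _ _).symm.trans h₁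
        · rw [pullback.lift_snd]
          exact (Presheaf.val_map_rebase _ _ _).symm.trans h₂)
  let p : W.ExtHom P.ext := ⟨fun w => (e.app w).1.1, fun φ w => by rw [e.map_app]; rfl⟩
  let q : W.ExtHom Q.ext := ⟨fun w => (e.app w).1.2, fun φ w => by rw [e.map_app]; rfl⟩
  refine ⟨W, Presheaf.homOfExt p, Presheaf.homOfExt q, Presheaf.hom_ext_app fun w => ?_,
    fun {X} x y h => ?_⟩
  · rw [Presheaf.toExt_comp, Presheaf.toExt_comp, Presheaf.toExt_homOfExt, Presheaf.toExt_homOfExt]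
    exact (e.app w).2
  · obtain ⟨w, hw⟩ := (he X).2 ⟨(x, y), h⟩
    simp only [Presheaf.toExt_homOfExt]
    refine ⟨w, ⟨congrArg (fun z => z.1.1) hw, congrArg (fun z => z.1.2) hw⟩, fun w' hw' => ?_⟩
    exact (he X).1 ((Subtype.ext (Prod.ext hw'.1 hw'.2)).trans hw.symm)

/-- A fibre product of sheaves, formed among presheaves, is a sheaf. -/
lemma isSheaf_fibreProduct {T : GrothendieckTopology (Stage C)} {W P Q R : Presheaf C}
    (hP : Presieve.IsSheaf T P.ext) (hQ : Presieve.IsSheaf T Q.ext) (hR : Presieve.IsSheaf T R.ext)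
    {F : P ⟶ R} {G : Q ⟶ R} {p : W ⟶ P} {q : W ⟶ Q} (hw : p ≫ F = q ≫ G)
    (H : ∀ {X : Stage C} (x : P.ext.obj (op X)) (y : Q.ext.obj (op X)),
        (Presheaf.toExt F).app x = (Presheaf.toExt G).app y →
          ∃! w, (Presheaf.toExt p).app w = x ∧ (Presheaf.toExt q).app w = y) :
    Presieve.IsSheaf T W.ext := by
  have hw' {X : Stage C} (w : W.ext.obj (op X)) : (Presheaf.toExt F).app ((Presheaf.toExt p).app w) =
      (Presheaf.toExt G).app ((Presheaf.toExt q).app w) := by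
    rw [← Presheaf.toExt_comp, hw, Presheaf.toExt_comp]
  intro X σ hσ ξ hξ
  obtain ⟨x, hx, hx'⟩ := hP σ hσ (fun Y φ hφ => (Presheaf.toExt p).app (ξ φ hφ))
    (fun Y₁ Y₂ Z g₁ g₂ f₁ f₂ h₁ h₂ hc => by
      rw [← Presheaf.ExtHom.map_app, ← Presheaf.ExtHom.map_app, hξ g₁ g₂ h₁ h₂ hc])
  obtain ⟨y, hy, hy'⟩ := hQ σ hσ (fun Y φ hφ => (Presheaf.toExt q).app (ξ φ hφ))
    (fun Y₁ Y₂ Z g₁ g₂ f₁ f₂ h₁ h₂ hc => by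
      rw [← Presheaf.ExtHom.map_app, ← Presheaf.ExtHom.map_app, hξ g₁ g₂ h₁ h₂ hc])
  have hxy : (Presheaf.toExt F).app x = (Presheaf.toExt G).app y := by
    refine (hR σ hσ).isSeparatedFor.ext fun Y φ hφ => ?_
    rw [← Presheaf.ExtHom.map_app, ← Presheaf.ExtHom.map_app, hx φ hφ, hy φ hφ, hw']
  obtain ⟨w, ⟨hwx, hwy⟩, hw''⟩ := H x y hxy
  refine ⟨w, fun Y φ hφ => ?_, fun w' h => ?_⟩
  · refine (H _ _ (hw' (ξ φ hφ))).unique ⟨?_, ?_⟩ ⟨rfl, rfl⟩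
    · rw [Presheaf.ExtHom.map_app, hwx, hx φ hφ]
    · rw [Presheaf.ExtHom.map_app, hwy, hy φ hφ]
  · refine hw'' _ ⟨hx' _ fun Y φ hφ => ?_, hy' _ fun Y φ hφ => ?_⟩
    · dsimp only
      rw [← Presheaf.ExtHom.map_app, h φ hφ]
    · dsimp only
      rw [← Presheaf.ExtHom.map_app, h φ hφ]

/-! ### Elements of a sheaf as maps from sheafified representables -/

namespace Presheaf

/-- The generic element `(x, id)` of `π_!`. -/
def shriekGen (X : Stage C) : (shriek (Over.mk X.pt)).ext.obj (op X) :=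
  el _ (pullback.lift (𝟙 _) (X.pt ≫ C.ident) (by simp [C.ident_cod])) (by
    simp [shriek, C.ident_dom])

/-- An element of `π_!` over a stage, as a map into the pullback that underlies `π_!`. -/
abbrev shriekVal {X Y : Stage C} (x : (shriek (Over.mk X.pt)).ext.obj (op Y)) :
    Y.base ⟶ pullback X.pt C.cod := val x

/-- An element of `π_!` is an arrow between stages. -/
def shriekArrow {X Y : Stage C} (x : (shriek (Over.mk X.pt)).ext.obj (op Y)) : Y ⟶ X :=
  Stage.mkHom (shriekVal x ≫ pullback.fst X.pt C.cod) (shriekVal x ≫ pullback.snd X.pt C.cod)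
    ((Category.assoc _ _ _).trans (val_proj x))
    (by rw [Category.assoc, Category.assoc, pullback.condition])

/-- The formula `(x, f) · g = (x, f g)`. -/
lemma shriekVal_map {X Y Z : Stage C} (φ : Z ⟶ Y) (x : (shriek (Over.mk X.pt)).ext.obj (op Y)) :
    shriekVal ((shriek (Over.mk X.pt)).ext.map φ.op x) =
      pullback.lift (Stage.Hom.map φ ≫ shriekVal x ≫ pullback.fst X.pt C.cod)
        (C.mul (Stage.Hom.map φ ≫ shriekVal x ≫ pullback.snd X.pt C.cod) (Stage.Hom.arr φ)
          (by
            rw [φ.arr_cod]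
            exact (Category.assoc _ _ _).trans (congrArg (Stage.Hom.map φ ≫ ·) (shriekArrow x).arr_dom)))
        (by
          rw [C.mul_cod, Category.assoc, Category.assoc, Category.assoc, Category.assoc,
            pullback.condition]) := by
  refine (val_map φ x).trans ((shriek_restr _ _ _ _).trans ?_)
  apply pullback.hom_ext
  · exact (pullback.lift_fst _ _ _).trans
      ((Category.assoc _ _ _).trans (pullback.lift_fst _ _ _).symm)
  · refine (pullback.lift_snd _ _ _).trans (Eq.trans ?_ (pullback.lift_snd _ _ _).symm)
    congr 1
    exact Category.assoc _ _ _

lemma shriekVal_shriekGen (X : Stage C) : shriekVal (shriekGen X) =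
    pullback.lift (𝟙 _) (X.pt ≫ C.ident) (by simp [C.ident_cod]) := rfl

/-- Each `(x, f)` is the restriction along `f` of the generic element at `x`. -/
lemma map_shriekGen {X Y : Stage C} (x : (shriek (Over.mk X.pt)).ext.obj (op Y)) :
    (shriek (Over.mk X.pt)).ext.map (shriekArrow x).op (shriekGen X) = x := by
  refine val_injective ((shriekVal_map _ _).trans ?_)
  change _ = shriekVal x
  apply pullback.hom_ext
  · simp [shriekVal_shriekGen, shriekArrow]
  · rw [pullback.lift_snd]
    simp only [shriekVal_shriekGen, pullback.lift_snd]
    refine Eq.trans ?_ (C.ident_mul _ _ (shriekArrow x).arr_cod)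
    simp [shriekArrow]

lemma shriekArrow_map {X Y Z : Stage C} (φ : Z ⟶ Y) (x : (shriek (Over.mk X.pt)).ext.obj (op Y)) :
    shriekArrow ((shriek (Over.mk X.pt)).ext.map φ.op x) = φ ≫ shriekArrow x := by
  refine Stage.hom_ext ?_ ?_
  · simp only [shriekArrow, Stage.mkHom_map, Stage.comp_map, shriekVal_map, pullback.lift_fst]
  · rw [Stage.comp_arr]
    simp only [shriekArrow, Stage.mkHom_arr, shriekVal_map, pullback.lift_snd]

lemma shriekArrow_shriekGen (X : Stage C) : shriekArrow (shriekGen X) = 𝟙 X := by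
  refine Stage.hom_ext ?_ ?_
  · simp only [shriekArrow, Stage.mkHom_map, shriekVal_shriekGen, pullback.lift_fst, Stage.id_map]
  · simp only [shriekArrow, Stage.mkHom_arr, shriekVal_shriekGen, pullback.lift_snd, Stage.id_arr]

/-- The map from `π_!` determined by an element. -/
def ofElement {P : Presheaf C} {X : Stage C} (x : P.ext.obj (op X)) : shriek (Over.mk X.pt) ⟶ P :=
  homOfExt ⟨fun y => P.ext.map (shriekArrow y).op x, fun φ y => by
    rw [shriekArrow_map, Stage.map_map]⟩

lemma ofElement_app {P : Presheaf C} {X Y : Stage C} (x : P.ext.obj (op X))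
    (y : (shriek (Over.mk X.pt)).ext.obj (op Y)) :
    (toExt (ofElement x)).app y = P.ext.map (shriekArrow y).op x :=
  toExt_homOfExt _ _

/-- Maps out of `π_!` are determined by the image of the generic element. -/
lemma shriek_hom_ext {P : Presheaf C} {X : Stage C} {F G : shriek (Over.mk X.pt) ⟶ P}
    (h : (toExt F).app (shriekGen X) = (toExt G).app (shriekGen X)) : F = G := by
  refine hom_ext_app fun x => ?_
  rw [← map_shriekGen x, ExtHom.map_app, h, ExtHom.map_app]

end Presheaf

/-- Elements of a sheaf over a stage `X` are represented by the sheafification of `π_! X`. This allows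
notions defined by maps of sheaves, such as monomorphisms and pullbacks, to be tested on elements. -/
lemma exists_representing_sheaf {L : Presheaf C ⥤ InternalSheaf J} (adj : L ⊣ inclusion J)
    (X : Stage C) : ∃ (U : InternalSheaf J) (u : U.obj.ext.obj (op X)),
      ∀ (A : InternalSheaf J) (a : A.obj.ext.obj (op X)),
        ∃! h : U ⟶ A, (Presheaf.toExt h.hom).app u = a := by
  refine ⟨L.obj (Presheaf.shriek (Over.mk X.pt)),
    (Presheaf.toExt (adj.unit.app _)).app (Presheaf.shriekGen X), fun A a => ?_⟩
  have h (k : L.obj (Presheaf.shriek (Over.mk X.pt)) ⟶ A) :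
      (Presheaf.toExt k.hom).app ((Presheaf.toExt (adj.unit.app _)).app (Presheaf.shriekGen X)) =
        (Presheaf.toExt (adj.homEquiv _ _ k)).app (Presheaf.shriekGen X) := by
    rw [adj.homEquiv_unit, Presheaf.toExt_comp]
    rfl
  refine ⟨(adj.homEquiv _ A).symm (Presheaf.ofElement a), ?_, fun k hk => ?_⟩
  · dsimp only
    rw [h, Equiv.apply_symm_apply, Presheaf.ofElement_app, Presheaf.shriekArrow_shriekGen]
    simp
  · rw [Equiv.eq_symm_apply]
    refine Presheaf.shriek_hom_ext ?_
    rw [← h, hk, Presheaf.ofElement_app, Presheaf.shriekArrow_shriekGen]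
    simp

end

end

section

variable {E : Type u} [Category.{v} E] [PositiveHeyting E]
  {C : InternalCategory E} {S : MorphismProperty E} {J : Topology S C}

section

variable (hS : IsClassOfSmallMaps S) (hcod : S C.cod)

/-! ### Covers of sheaves are the locally surjective maps -/

/-- For elements of an internal presheaf, agreement of reindexings is equality of maps into the
underlying object. -/
lemma sameAt_ext_iff {P : Presheaf C} {V V' : Stage C} {x : P.ext.obj (op V)}
    {y : P.ext.obj (op V')} {T : E} {t : T ⟶ V.base} {t' : T ⟶ V'.base} :
    SameAt x t y t' ↔ t ≫ Presheaf.val x = t' ≫ Presheaf.val y := by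
  constructor
  · rintro ⟨h, h'⟩
    have := congrArg Presheaf.val h'
    rwa [Presheaf.val_map_rebase, Presheaf.val_map_rebase] at this
  · intro h
    refine ⟨?_, Presheaf.val_injective ?_⟩
    · rw [← Presheaf.val_proj x, ← Presheaf.val_proj y, reassoc_of% h]
    · rw [Presheaf.val_map_rebase, Presheaf.val_map_rebase]
      exact h

lemma mem_of_transitive {X : Stage C} {τ σ : Sieve X} (hτ : τ ∈ stageTopology J hS hcod X)
    (h : ∀ {Y : Stage C} (φ : Y ⟶ X), τ φ → σ.pullback φ ∈ stageTopology J hS hcod Y) :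
    σ ∈ stageTopology J hS hcod X :=
  (stageTopology J hS hcod).transitive hτ σ fun _ φ hφ => h φ hφ

/-- A sieve is covering if it contains the base changes along a cover. -/
lemma mem_of_baseChange {X : Stage C} {σ : Sieve X} {X' : E} {q : X' ⟶ X.base}
    (hq : ExtremalEpi q) (h : σ (Stage.rebase (Y := ⟨X', q ≫ X.pt⟩) q rfl)) :
    σ ∈ stageTopology J hS hcod X :=
  GrothendieckTopology.superset_covering _ (baseSieve_le q h) (baseSieve_mem hS hcod hq)

include hS hcod in
lemma InternalSheaf.ext_isSheaf (A : InternalSheaf J) :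
    Presieve.IsSheaf (stageTopology J hS hcod) A.obj.ext :=
  (isSheaf_iff hS hcod A.obj).1 A.property

/-- Monomorphisms of sheaves are injective on elements. -/
lemma injective_of_mono {L : Presheaf C ⥤ InternalSheaf J} (adj : L ⊣ inclusion J)
    {A B : InternalSheaf J} (i : A ⟶ B) [Mono i] (X : Stage C) :
    Function.Injective ((Presheaf.toExt i.hom).app (X := X)) := by
  intro x y hxy
  obtain ⟨U, u, hU⟩ := exists_representing_sheaf adj X
  obtain ⟨h, hh, -⟩ := hU A x
  obtain ⟨k, hk, -⟩ := hU A y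
  have : h ≫ i = k ≫ i := by
    refine (hU B ((Presheaf.toExt i.hom).app x)).unique ?_ ?_
    · exact (Presheaf.toExt_comp h.hom i.hom u).trans (by rw [hh])
    · exact (Presheaf.toExt_comp k.hom i.hom u).trans (by rw [hk, hxy])
  rw [cancel_mono] at this
  rw [← hh, ← hk, this]

lemma mono_of_injective {A B : InternalSheaf J} (i : A ⟶ B)
    (hi : ∀ X : Stage C, Function.Injective ((Presheaf.toExt i.hom).app (X := X))) : Mono i where
  right_cancellation {T} h k hhk := by
    refine ObjectProperty.hom_ext _ (Presheaf.hom_ext_app fun {X} x => hi X ?_)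
    rw [← Presheaf.toExt_comp, ← Presheaf.toExt_comp]
    exact congrArg (fun f => (Presheaf.toExt f).app x) ((inclusion J).congr_map hhk)

/-- A locally surjective map of sheaves is a cover: a monomorphism through which it factors is
injective on elements and locally surjective, and a locally bijective map of sheaves is invertible
by its universal property. -/
lemma extremalEpi_of_locallySurjective {L : Presheaf C ⥤ InternalSheaf J} (adj : L ⊣ inclusion J)
    {A B : InternalSheaf J} (c : A ⟶ B)
    (hc : IsLocallySurjective (J := J) hS hcod (Presheaf.toExt c.hom)) : ExtremalEpi c where
  left_cancellation {T} h k hhk := by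
    refine ObjectProperty.hom_ext _ (Presheaf.hom_ext_app fun {X} b => ?_)
    refine eq_of_eqSieve_mem hS hcod (T.ext_isSheaf hS hcod)
      (GrothendieckTopology.superset_covering _ ?_ (hc b))
    rintro Y φ ⟨a, ha⟩
    rw [eqSieve_apply, ← Presheaf.ExtHom.map_app, ← Presheaf.ExtHom.map_app, ← ha,
      ← Presheaf.toExt_comp, ← Presheaf.toExt_comp]
    exact congrArg (fun f => (Presheaf.toExt f).app a) ((inclusion J).congr_map hhk)
  isIso {Z} p i fac _ := by
    have hinj : IsLocallyInjective (J := J) hS hcod (Presheaf.toExt i.hom) := fun {X} x y h => by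
      rw [injective_of_mono adj i X h, eqSieve_self]
      exact GrothendieckTopology.top_mem _ _
    have hsurj : IsLocallySurjective (J := J) hS hcod (Presheaf.toExt i.hom) := fun {X} b => by
      refine GrothendieckTopology.superset_covering _ ?_ (hc b)
      rintro Y φ ⟨a, ha⟩
      refine ⟨(Presheaf.toExt p.hom).app a, ?_⟩
      rw [← ha, ← Presheaf.toExt_comp]
      exact congrArg (fun f => (Presheaf.toExt f).app a) ((inclusion J).congr_map fac)
    obtain ⟨K, hK, -⟩ := existsUnique_extension hS hcod i.hom hinj hsurj Z.property (𝟙 _)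
    refine ⟨ObjectProperty.homMk K, ObjectProperty.hom_ext _ hK, ObjectProperty.hom_ext _ ?_⟩
    refine (existsUnique_extension hS hcod i.hom hinj hsurj B.property i.hom).unique ?_
      (Category.comp_id _)
    exact (Category.assoc _ _ _).symm.trans ((congrArg (· ≫ i.hom) hK).trans (Category.id_comp _))

/-- A cover of sheaves is locally surjective: it factors through the sheafification of its image,
which is a subobject. -/
lemma locallySurjective_of_extremalEpi (hP : IsPredicative S) (pres : Presentation J)
    {A B : InternalSheaf J} (c : A ⟶ B) (hc : ExtremalEpi c) :
    IsLocallySurjective (J := J) hS hcod (Presheaf.toExt c.hom) := by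
  have hB := isCoverSheaf_of_isSheaf hS hcod (B.ext_isSheaf hS hcod)
  let e := Presheaf.toExt c.hom
  -- the image of `c` among presheaves, which exists because diagonals are small
  obtain ⟨Q, i, hi, hiQ⟩ := exists_image_presheaf hP e hB ((IsSmallPred.eq hS
    (prod.fst ≫ Presheaf.Hom.hom c.hom) (prod.snd ≫ Presheaf.Hom.hom c.hom)).congr
      fun T t => by
        rw [sameAt_ext_iff, Presheaf.val_toExt]
        simp [Presheaf.gen])
  have hiP {X : Stage C} (x : A.obj.ext.obj (op X)) : ∃ y, i.app y = e.app x :=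
    (hiQ _).2 ⟨X.base, 𝟙 _, Presheaf.val x, inferInstance, e.sameAt_gen x⟩
  choose α hα using @hiP
  let p : A.obj ⟶ Q := Presheaf.homOfExt ⟨α, fun φ x => hi _ (by
    rw [hα, i.map_app, hα, e.map_app])⟩
  have hp : p ≫ Presheaf.homOfExt i = c.hom := Presheaf.hom_ext_app fun x => by
    rw [Presheaf.toExt_comp, Presheaf.toExt_homOfExt, Presheaf.toExt_homOfExt]
    exact hα x
  obtain ⟨I, F, hI, hF, hF'⟩ := exists_sheaf hS hcod hP pres Q
  obtain ⟨K, hK, -⟩ := existsUnique_extension hS hcod F hF hF' B.property (Presheaf.homOfExt i)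
  have hK' {X : Stage C} (q : Q.ext.obj (op X)) :
      (Presheaf.toExt K).app ((Presheaf.toExt F).app q) = i.app q := by
    rw [← Presheaf.toExt_comp, hK, Presheaf.toExt_homOfExt]
  let K₀ : (⟨I, hI⟩ : InternalSheaf J) ⟶ B := ObjectProperty.homMk K
  have : Mono K₀ := mono_of_injective K₀ fun X x y hxy => by
    refine eq_of_eqSieve_mem hS hcod ((isSheaf_iff hS hcod I).1 hI)
      (GrothendieckTopology.superset_covering _ ?_
        (GrothendieckTopology.intersection_covering _ (hF' x) (hF' y)))
    rintro Y φ ⟨⟨q, hq⟩, ⟨q', hq'⟩⟩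
    rw [eqSieve_apply, ← hq, ← hq']
    congr 1
    refine hi _ ?_
    rw [← hK', ← hK', hq, hq', Presheaf.ExtHom.map_app, Presheaf.ExtHom.map_app]
    exact congrArg _ hxy
  have hiso : IsIso K₀ := hc.isIso (ObjectProperty.homMk (p ≫ F)) K₀
    (ObjectProperty.hom_ext _ ((Category.assoc _ _ _).trans ((congrArg (p ≫ ·) hK).trans hp)))
  intro X b
  let x := (Presheaf.toExt (inv K₀).hom).app b
  have hx : (Presheaf.toExt K).app x = b := by
    have h₁ := congrArg (fun f => (Presheaf.toExt f).app b)
      ((inclusion J).congr_map (IsIso.inv_hom_id K₀))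
    refine (Presheaf.toExt_comp _ _ b).symm.trans (h₁.trans ?_)
    exact Presheaf.val_injective (Category.comp_id _)
  refine mem_of_transitive hS hcod (hF' x) ?_
  rintro Y φ ⟨q, hq⟩
  obtain ⟨Y', r, a, hr, ha⟩ := (hiQ (i.app q)).1 ⟨q, rfl⟩
  refine mem_of_baseChange hS hcod hr ?_
  refine ⟨A.obj.el a ha.1.symm, ?_⟩
  have hb : B.obj.ext.map φ.op b = i.app q := by
    rw [← hK', hq, Presheaf.ExtHom.map_app, hx]
  rw [sameAt_ext_iff] at ha
  rw [← Stage.map_map, hb]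
  refine Presheaf.val_injective (Eq.trans ?_ (Presheaf.val_map_rebase _ _ _).symm)
  rw [← ha]
  simp [e, Presheaf.gen]

end

end

section

variable {E : Type u} [Category.{v} E] [PositiveHeyting E]
  {C : InternalCategory E} {S : MorphismProperty E} {J : Topology S C}

section

variable (hS : IsClassOfSmallMaps S) (hcod : S C.cod)

/-! ### Pointwise small maps are preserved by sheafification and closed under covered maps -/

/-- A pullback of sheaves consists of the pairs of elements with a common image. -/
lemma exists_of_isPullback {L : Presheaf C ⥤ InternalSheaf J} (adj : L ⊣ inclusion J)
    {W A Y B : InternalSheaf J} {p : W ⟶ A} {q : W ⟶ Y} {G : A ⟶ B} {z : Y ⟶ B}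
    (h : IsPullback p q G z) {X : Stage C} (a : A.obj.ext.obj (op X)) (y : Y.obj.ext.obj (op X))
    (hay : (Presheaf.toExt G.hom).app a = (Presheaf.toExt z.hom).app y) :
    ∃ w, (Presheaf.toExt p.hom).app w = a ∧ (Presheaf.toExt q.hom).app w = y := by
  obtain ⟨U, u, hU⟩ := exists_representing_sheaf adj X
  obtain ⟨k, rfl, -⟩ := hU A a
  obtain ⟨l, rfl, -⟩ := hU Y y
  have hkl : k ≫ G = l ≫ z := by
    refine (hU B _).unique rfl ?_
    exact (Presheaf.toExt_comp l.hom z.hom u).trans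
      (hay.symm.trans (Presheaf.toExt_comp k.hom G.hom u).symm)
  refine ⟨(Presheaf.toExt (h.lift k l hkl).hom).app u, ?_, ?_⟩
  · rw [← Presheaf.toExt_comp]
    exact congrArg (fun f => (Presheaf.toExt f).app u)
      ((inclusion J).congr_map (h.lift_fst k l hkl))
  · rw [← Presheaf.toExt_comp]
    exact congrArg (fun f => (Presheaf.toExt f).app u)
      ((inclusion J).congr_map (h.lift_snd k l hkl))

include hcod in
/-- Pointwise small maps of sheaves are closed under covered maps. -/
lemma pointwiseSmall_of_covers (hP : IsPredicative S) (hF : Fullness S) (pres : Presentation J)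
    {X Y A B : InternalSheaf J} (F : X ⟶ Y) (G : A ⟶ B) (hFG : Covers F G)
    (hFS : PointwiseSmall F) : PointwiseSmall G := by
  have hS := hP.toIsClassOfSmallMaps
  have := inclusion_isRightAdjoint hS hcod hP pres
  have adj := Adjunction.ofIsRightAdjoint (inclusion J)
  obtain ⟨t, z, ⟨W, p, q, c, hpb, rfl, rfl, hc⟩, hz⟩ := hFG
  have hw : (c ≫ p) ≫ G = (c ≫ q) ≫ z := by
    rw [Category.assoc, hpb.w, Category.assoc]
  refine small_of_pairSieve hcod hP hF pres (A.ext_isSheaf hS hcod) (B.ext_isSheaf hS hcod) G.hom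
    (c ≫ q).hom (c ≫ p).hom z.hom ((inclusion J).congr_map hw) hFS (fun {X'} y a hya => ?_)
    (locallySurjective_of_extremalEpi hS hcod hP pres z hz)
  obtain ⟨w, rfl, rfl⟩ := exists_of_isPullback adj hpb a y hya
  refine GrothendieckTopology.superset_covering _ ?_
    (locallySurjective_of_extremalEpi hS hcod hP pres c hc w)
  rintro Y φ ⟨x, hx⟩
  refine ⟨x, ?_, ?_⟩
  · exact (Presheaf.toExt_comp c.hom q.hom x).trans (by rw [hx, Presheaf.ExtHom.map_app])
  · exact (Presheaf.toExt_comp c.hom p.hom x).trans (by rw [hx, Presheaf.ExtHom.map_app])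

include hcod in
/-- Sheafification preserves pointwise small maps. -/
lemma pointwiseSmall_sheafification (hP : IsPredicative S) (hF : Fullness S)
    (pres : Presentation J) {L : Presheaf C ⥤ InternalSheaf J} (adj : L ⊣ inclusion J)
    {P Q : Presheaf C} (F : P ⟶ Q) (hFS : Presheaf.PointwiseSmall S F) :
    PointwiseSmall (L.map F) := by
  have hS := hP.toIsClassOfSmallMaps
  obtain ⟨-, hPs⟩ := unit_locallyBijective hS hcod hP pres adj P
  obtain ⟨hQi, hQs⟩ := unit_locallyBijective hS hcod hP pres adj Q
  have hw : adj.unit.app P ≫ (L.map F).hom = F ≫ adj.unit.app Q := (adj.unit.naturality F).symm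
  refine small_of_pairSieve hcod hP hF pres ((L.obj P).ext_isSheaf hS hcod)
    ((L.obj Q).ext_isSheaf hS hcod) (L.map F).hom F (adj.unit.app P) (adj.unit.app Q) hw hFS
    (fun {X} y a hya => mem_of_transitive hS hcod (hPs a) ?_) hQs
  rintro Y φ ⟨p, hp⟩
  refine GrothendieckTopology.superset_covering _ ?_
    (hQi ((Presheaf.toExt F).app p) (Q.ext.map φ.op y) ?_)
  · intro Z ψ hψ
    refine ⟨P.ext.map ψ.op p, ?_, ?_⟩
    · rw [Presheaf.ExtHom.map_app, ← Stage.map_map]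
      exact hψ
    · rw [Presheaf.ExtHom.map_app, hp]
      exact Stage.map_map _ _ _
  · rw [← Presheaf.toExt_comp, ← hw, Presheaf.toExt_comp, hp, Presheaf.ExtHom.map_app, hya]
    exact ((Presheaf.toExt (adj.unit.app Q)).map_app φ y).symm

/-! ### Pointwise small and locally small maps of sheaves -/

include hcod in
/-- The fibre of `(r, s)_!` over `(x, f)` is contained in the small collection of pairs `(b, g)` with
`r b = x`, because both `r` and the codomain map are small. -/
lemma pointwiseSmall_shriekMap (hS : IsClassOfSmallMaps S) {A B : Over C.C₀} (r : B.left ⟶ A.left)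
    (s : B.left ⟶ C.C₁) (hdom : s ≫ C.dom = B.hom) (hcod' : s ≫ C.cod = r ≫ A.hom) (hr : S r) :
    Presheaf.PointwiseSmall S (Presheaf.shriekMap r s hdom hcod') := by
  change S (Presheaf.shriekHom r s hdom hcod')
  refine hS.of_comp (g := pullback.fst A.hom C.cod) ?_
  rw [Presheaf.shriekHom, pullback.lift_fst]
  exact hS.composition (hS.fst_small _ _ hcod) hr

/-- A commuting square of sheaves is a pullback if it is one on elements. -/
lemma isPullback_of_elements {W A Y B : InternalSheaf J} {p : W ⟶ A} {q : W ⟶ Y} {G : A ⟶ B}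
    {z : Y ⟶ B} (hw : p ≫ G = q ≫ z)
    (H : ∀ {X : Stage C} (x : A.obj.ext.obj (op X)) (y : Y.obj.ext.obj (op X)),
        (Presheaf.toExt G.hom).app x = (Presheaf.toExt z.hom).app y →
          ∃! w, (Presheaf.toExt p.hom).app w = x ∧ (Presheaf.toExt q.hom).app w = y) :
    IsPullback p q G z := by
  have comp {A B D : InternalSheaf J} {f : A ⟶ B} {g : B ⟶ D} {k : A ⟶ D} (h : f ≫ g = k)
      {X : Stage C} (x : A.obj.ext.obj (op X)) :
      (Presheaf.toExt g.hom).app ((Presheaf.toExt f.hom).app x) = (Presheaf.toExt k.hom).app x := by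
    rw [← Presheaf.toExt_comp]
    exact congrArg (fun f => (Presheaf.toExt f).app x) ((inclusion J).congr_map h)
  choose w hw₁ hw₂ using @H
  have hs (s : PullbackCone G z) {X : Stage C} (x : s.pt.obj.ext.obj (op X)) :=
    (comp s.condition x).trans (Presheaf.toExt_comp s.snd.hom z.hom x)
  let l (s : PullbackCone G z) : s.pt ⟶ W := ObjectProperty.homMk (Presheaf.homOfExt
    ⟨fun x => w _ _ (hs s x), fun φ x => (hw₂ _ _ (hs s _) _ (by
      have h := hw₁ _ _ (hs s x)
      refine ⟨?_, ?_⟩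
      · rw [Presheaf.ExtHom.map_app, h.1, Presheaf.ExtHom.map_app]
      · rw [Presheaf.ExtHom.map_app, h.2, Presheaf.ExtHom.map_app])).symm⟩)
  have hl (s : PullbackCone G z) {X : Stage C} (x : s.pt.obj.ext.obj (op X)) :
      (Presheaf.toExt (l s).hom).app x = w _ _ (hs s x) := Presheaf.toExt_homOfExt _ x
  refine ⟨⟨hw⟩, ⟨PullbackCone.IsLimit.mk _ l (fun s => ?_) (fun s => ?_) fun s m h₁ h₂ => ?_⟩⟩
  · refine ObjectProperty.hom_ext _ (Presheaf.hom_ext_app fun x => ?_)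
    exact (Presheaf.toExt_comp _ _ _).trans (by rw [hl, (hw₁ _ _ (hs s x)).1])
  · refine ObjectProperty.hom_ext _ (Presheaf.hom_ext_app fun x => ?_)
    exact (Presheaf.toExt_comp _ _ _).trans (by rw [hl, (hw₁ _ _ (hs s x)).2])
  · refine ObjectProperty.hom_ext _ (Presheaf.hom_ext_app fun x => ?_)
    rw [hl]
    exact hw₂ _ _ (hs s x) _ ⟨comp h₁ x, comp h₂ x⟩

/-- As an arrow between stages, the image of the generic element under `(r, s)_!` is the arrow `s` over
`r`. -/
lemma shriekArrow_shriekMap {X Y : Stage C} (r : X.base ⟶ Y.base) (s : X.base ⟶ C.C₁)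
    (hdom : s ≫ C.dom = X.pt) (hcod' : s ≫ C.cod = r ≫ Y.pt) :
    Presheaf.shriekArrow ((Presheaf.toExt (Presheaf.shriekMap (A := Over.mk Y.pt)
      (B := Over.mk X.pt) r s hdom hcod')).app (Presheaf.shriekGen X)) =
        Stage.mkHom r s hdom hcod' := by
  have h : Presheaf.shriekVal ((Presheaf.toExt (Presheaf.shriekMap (A := Over.mk Y.pt)
      (B := Over.mk X.pt) r s hdom hcod')).app (Presheaf.shriekGen X)) =
        pullback.lift r s hcod'.symm := by
    change pullback.lift (𝟙 _) (X.pt ≫ C.ident) _ ≫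
      Presheaf.shriekHom (A := Over.mk Y.pt) (B := Over.mk X.pt) r s hdom hcod' = _
    rw [Presheaf.shriekHom]
    apply pullback.hom_ext
    · refine (Category.assoc _ _ _).trans ?_
      simp
    · refine (Category.assoc _ _ _).trans ?_
      simp only [pullback.lift_snd, C.precomp_mul]
      refine Eq.trans ?_ ((C.mul_ident s X.pt hdom).trans (pullback.lift_snd _ _ hcod'.symm).symm)
      simp
  refine Stage.hom_ext ?_ ?_
  · simp only [Presheaf.shriekArrow, Stage.mkHom_map, h, pullback.lift_fst]
  · simp only [Presheaf.shriekArrow, Stage.mkHom_arr, h, pullback.lift_snd]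

lemma shriekArrow_injective {X Y : Stage C}
    {x y : (Presheaf.shriek (Over.mk X.pt)).ext.obj (op Y)}
    (h : Presheaf.shriekArrow x = Presheaf.shriekArrow y) : x = y := by
  rw [← Presheaf.map_shriekGen x, h, Presheaf.map_shriekGen]

include hcod in
/-- A pointwise small map `F : B ⟶ A` of sheaves is covered by the sheafification of
`(r, s)_! : π_! X ⟶ π_! A`, where `X` consists of the triples `(x, f, y)` with `x` in `A` and
`F y = x · f`, and `r (x, f, y) = x`, `s (x, f, y) = f`. -/
lemma locallySmall_of_pointwiseSmall (hP : IsPredicative S) (pres : Presentation J)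
    {L : Presheaf C ⥤ InternalSheaf J} (adj : L ⊣ inclusion J) {A B : InternalSheaf J}
    (F : B ⟶ A) (hF : PointwiseSmall F) : LocallySmall L F := by
  have hS := hP.toIsClassOfSmallMaps
  let m := pullback.snd (Presheaf.Hom.hom F.hom) A.obj.act
  have hm : S m := hS.snd_small _ _ hF
  let r := m ≫ pullback.fst A.obj.proj C.cod
  let s := m ≫ pullback.snd A.obj.proj C.cod
  let X : Stage C := ⟨pullback (Presheaf.Hom.hom F.hom) A.obj.act, s ≫ C.dom⟩
  let Y : Stage C := A.obj.stage
  have hrs : s ≫ C.cod = r ≫ Y.pt := by simp [r, s, Y, pullback.condition]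
  let M : Presheaf.shriek (Over.mk X.pt) ⟶ Presheaf.shriek (Over.mk Y.pt) :=
    Presheaf.shriekMap (A := Over.mk Y.pt) (B := Over.mk X.pt) r s rfl hrs
  let b₀ : B.obj.ext.obj (op X) := B.obj.el (pullback.fst _ _) (by
    rw [← Presheaf.Hom.hom_proj F.hom, ← Category.assoc, pullback.condition, Category.assoc,
      A.obj.act_proj]
    exact (Category.assoc _ _ _).symm)
  have hb₀ : (Presheaf.toExt F.hom).app b₀ =
      A.obj.ext.map (Stage.mkHom (Y := X) (X := Y) r s rfl hrs).op A.obj.gen := by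
    refine Presheaf.val_injective (pullback.condition.trans (Eq.trans ?_
      (Presheaf.val_map (Stage.mkHom (Y := X) (X := Y) r s rfl hrs) A.obj.gen).symm))
    rw [Presheaf.restr]
    congr 1
    apply pullback.hom_ext
    · simp [Presheaf.gen, m, r, Y]
    · simp [m, s]
  let t₀ : Presheaf.shriek (Over.mk X.pt) ⟶ B.obj := Presheaf.ofElement b₀
  let z₀ : Presheaf.shriek (Over.mk Y.pt) ⟶ A.obj := Presheaf.ofElement A.obj.gen
  have hsq : t₀ ≫ F.hom = M ≫ z₀ := by
    refine Presheaf.shriek_hom_ext ?_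
    rw [Presheaf.toExt_comp, Presheaf.toExt_comp, Presheaf.ofElement_app, Presheaf.ofElement_app,
      Presheaf.shriekArrow_shriekGen, shriekArrow_shriekMap, ← hb₀]
    simp
  let t := (adj.homEquiv _ B).symm t₀
  let z := (adj.homEquiv _ A).symm z₀
  have ht : adj.unit.app _ ≫ t.hom = t₀ :=
    (adj.homEquiv_unit (f := t)).symm.trans (Equiv.apply_symm_apply _ _)
  have hz : adj.unit.app _ ≫ z.hom = z₀ :=
    (adj.homEquiv_unit (f := z)).symm.trans (Equiv.apply_symm_apply _ _)
  have hM : adj.unit.app _ ≫ (L.map M).hom = M ≫ adj.unit.app _ := (adj.unit.naturality M).symm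
  have hw : t ≫ F = L.map M ≫ z := by
    rw [← adj.homEquiv_naturality_right_symm, ← adj.homEquiv_naturality_left_symm]
    exact congrArg _ hsq
  obtain ⟨W, p, q, hpq, H⟩ := exists_fibreProduct F.hom z.hom
  have hW := isSheaf_fibreProduct (B.ext_isSheaf hS hcod) ((L.obj _).ext_isSheaf hS hcod)
    (A.ext_isSheaf hS hcod) hpq H
  let W' : InternalSheaf J := ⟨W, (isSheaf_iff hS hcod W).2 hW⟩
  let p' : W' ⟶ B := ObjectProperty.homMk p
  let q' : W' ⟶ L.obj (Presheaf.shriek (Over.mk Y.pt)) := ObjectProperty.homMk q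
  have hpb : IsPullback p' q' F z := isPullback_of_elements (ObjectProperty.hom_ext _ hpq) H
  let c := hpb.lift t (L.map M) hw
  have hcp : c ≫ p' = t := hpb.lift_fst _ _ _
  have hcq : c ≫ q' = L.map M := hpb.lift_snd _ _ _
  refine ⟨Over.mk X.pt, Over.mk Y.pt, r, s, rfl, hrs, hS.composition hm (hS.fst_small _ _ hcod),
    t, z, ⟨W', p', q', c, hpb, hcp, hcq, ?_⟩, ?_⟩
  · refine extremalEpi_of_locallySurjective hS hcod adj c fun {T} w => ?_
    refine GrothendieckTopology.superset_covering _ ?_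
      ((unit_locallyBijective hS hcod hP pres adj _).2 ((Presheaf.toExt q).app w))
    rintro T' φ ⟨y, hy⟩
    change (Presheaf.shriek (Over.mk Y.pt)).ext.obj (op T') at y
    have hy' : A.obj.ext.map (Presheaf.shriekArrow y).op A.obj.gen =
        (Presheaf.toExt F.hom).app (B.obj.ext.map φ.op ((Presheaf.toExt p).app w)) := by
      rw [Presheaf.ExtHom.map_app, ← Presheaf.toExt_comp, hpq, Presheaf.toExt_comp,
        ← Presheaf.ExtHom.map_app]
      refine (Presheaf.ofElement_app _ _).symm.trans ((congrArg (fun k => (Presheaf.toExt k).app y) hz.symm).trans ?_)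
      exact (Presheaf.toExt_comp _ _ _).trans (congrArg _ hy)
    set b := B.obj.ext.map φ.op ((Presheaf.toExt p).app w) with hb
    -- the triple `(x, f, b)`, where `y = (x, f)`
    let ψ : T'.base ⟶ X.base := pullback.lift (Presheaf.val b)
      (pullback.lift (Stage.Hom.map (Presheaf.shriekArrow y))
        (Stage.Hom.arr (Presheaf.shriekArrow y)) (Presheaf.shriekArrow y).arr_cod.symm) (by
          refine (congrArg Presheaf.val hy').symm.trans ((Presheaf.val_map _ _).trans ?_)
          rw [Presheaf.restr]
          congr 1
          apply pullback.hom_ext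
          · simp only [Presheaf.gen, Presheaf.val_el, pullback.lift_fst]
            exact Category.comp_id _
          · simp)
    have hψm : ψ ≫ m = pullback.lift (Stage.Hom.map (Presheaf.shriekArrow y))
        (Stage.Hom.arr (Presheaf.shriekArrow y)) (Presheaf.shriekArrow y).arr_cod.symm :=
      pullback.lift_snd _ _ _
    have hψr : ψ ≫ r = Stage.Hom.map (Presheaf.shriekArrow y) :=
      (Category.assoc _ _ _).symm.trans
        ((congrArg (· ≫ pullback.fst _ _) hψm).trans (pullback.lift_fst _ _ _))
    have hψs : ψ ≫ s = Stage.Hom.arr (Presheaf.shriekArrow y) :=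
      (Category.assoc _ _ _).symm.trans
        ((congrArg (· ≫ pullback.snd _ _) hψm).trans (pullback.lift_snd _ _ _))
    have hψ : ψ ≫ X.pt = T'.pt :=
      (Category.assoc _ _ _).symm.trans
        ((congrArg (· ≫ C.dom) hψs).trans (Presheaf.shriekArrow y).arr_dom)
    let x := (Presheaf.shriek (Over.mk X.pt)).ext.map (Stage.rebase ψ hψ).op (Presheaf.shriekGen X)
    have hx : (Presheaf.toExt t₀).app x = b := by
      rw [Presheaf.ofElement_app, Presheaf.shriekArrow_map, Presheaf.shriekArrow_shriekGen,
        Category.comp_id]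
      refine Presheaf.val_injective ((Presheaf.val_map_rebase _ _ _).trans ?_)
      exact pullback.lift_fst _ _ _
    have hx' : (Presheaf.toExt M).app x = y := by
      refine shriekArrow_injective ?_
      rw [Presheaf.ExtHom.map_app, Presheaf.shriekArrow_map, shriekArrow_shriekMap]
      refine Stage.hom_ext ?_ ?_
      · exact hψr
      · rw [Stage.rebase_comp_arr]
        exact hψs
    refine ⟨(Presheaf.toExt (adj.unit.app _)).app x, ?_⟩
    refine (H b (L.obj _ |>.obj.ext.map φ.op ((Presheaf.toExt q).app w)) ?_).unique ⟨?_, ?_⟩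
      ⟨Presheaf.ExtHom.map_app _ _ _, Presheaf.ExtHom.map_app _ _ _⟩
    · rw [hb, Presheaf.ExtHom.map_app, Presheaf.ExtHom.map_app, ← Presheaf.toExt_comp, hpq,
        Presheaf.toExt_comp]
    · refine ((Presheaf.toExt_comp _ _ _).trans (Presheaf.toExt_comp _ _ _)).symm.trans
        ((congrArg (fun k => (Presheaf.toExt k).app x) ?_).trans hx)
      exact (congrArg (adj.unit.app _ ≫ ·) ((inclusion J).congr_map hcp)).trans ht
    · refine ((Presheaf.toExt_comp _ _ _).trans (Presheaf.toExt_comp _ _ _)).symm.trans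
        ((congrArg (fun k => (Presheaf.toExt k).app x)
          ((congrArg (adj.unit.app _ ≫ ·) ((inclusion J).congr_map hcq)).trans hM)).trans
            ((Presheaf.toExt_comp _ _ _).trans ?_))
      rw [hx']
      exact hy
  · refine extremalEpi_of_locallySurjective hS hcod adj z fun {T} a => ?_
    refine GrothendieckTopology.superset_covering _ (fun {T'} φ _ => ?_)
      (GrothendieckTopology.top_mem _ _)
    let x := A.obj.ext.map φ.op a
    let y := (Presheaf.shriek (Over.mk Y.pt)).ext.map
      (Stage.rebase (Y := T') (X := Y) (Presheaf.val x) (Presheaf.val_proj x)).op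
      (Presheaf.shriekGen Y)
    refine ⟨(Presheaf.toExt (adj.unit.app _)).app y, ?_⟩
    refine (Presheaf.toExt_comp _ _ _).symm.trans
      ((congrArg (fun k => (Presheaf.toExt k).app y) hz).trans ?_)
    simp only [y, z₀]
    rw [Presheaf.ofElement_app, Presheaf.shriekArrow_map, Presheaf.shriekArrow_shriekGen,
      Category.comp_id]
    exact Presheaf.map_gen x

end

end

end

end SmallMaps

theorem mainTheorem7 {E : Type u} [Category.{v} E] [SmallMaps.PositiveHeyting E]
    (S : MorphismProperty E) (hS : SmallMaps.IsPredicative S) (hF : SmallMaps.Fullness S)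
    (C : SmallMaps.InternalCategory E) (hcod : S C.cod)
    (J : SmallMaps.Topology S C) (hJ : J.IsPresentable) :
    -- the sheafification functor exists
    (SmallMaps.inclusion J).IsRightAdjoint ∧
    -- sheafification preserves smallness
    (∀ (L : SmallMaps.Presheaf C ⥤ SmallMaps.InternalSheaf J), (L ⊣ SmallMaps.inclusion J) →
      ∀ {P Q : SmallMaps.Presheaf C} (F : P ⟶ Q),
        SmallMaps.Presheaf.PointwiseSmall S F → SmallMaps.PointwiseSmall (L.map F)) ∧
    -- pointwise small maps of sheaves are closed under covered maps
    (∀ {X Y A B : SmallMaps.InternalSheaf J} (F : X ⟶ Y) (G : A ⟶ B),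
      SmallMaps.Covers F G → SmallMaps.PointwiseSmall F → SmallMaps.PointwiseSmall G) ∧
    -- the pointwise small and the locally small maps of sheaves coincide
    (∀ (L : SmallMaps.Presheaf C ⥤ SmallMaps.InternalSheaf J), (L ⊣ SmallMaps.inclusion J) →
      ∀ {A B : SmallMaps.InternalSheaf J} (F : B ⟶ A),
        SmallMaps.PointwiseSmall F ↔ SmallMaps.LocallySmall L F) := by
  obtain ⟨pres⟩ := hJ
  refine ⟨SmallMaps.inclusion_isRightAdjoint hS.toIsClassOfSmallMaps hcod hS pres,
    fun L adj {P Q} F h => SmallMaps.pointwiseSmall_sheafification hcod hS hF pres adj F h,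
    fun {X Y A B} F G h h' => SmallMaps.pointwiseSmall_of_covers hcod hS hF pres F G h h',
    fun L adj {A B} F => ⟨SmallMaps.locallySmall_of_pointwiseSmall hcod hS pres adj F, ?_⟩⟩
  rintro ⟨X, Y, r, s, hdom, hcod', hr, hc⟩
  exact SmallMaps.pointwiseSmall_of_covers hcod hS hF pres _ F hc
    (SmallMaps.pointwiseSmall_sheafification hcod hS hF pres adj _
      (SmallMaps.pointwiseSmall_shriekMap hcod hS.toIsClassOfSmallMaps r s hdom hcod' hr))
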